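/- **Setting.** Let $\mathcal A$ be a set of particles and $L=(L(\alpha,\beta))_{\alpha,\beta\in\mathcal A}$ a real symmetric matrix with finitely many non-zero entries in each row and with $\langle L\xi,\xi\rangle>0$ for all $0\ne\xi\in l^2(\mathcal A)$. Let $\mathcal C$ be a finite set of channels: each $\sigma\in\mathcal C$ is a sequence $\sigma(0),\sigma(1),\dots$ in $\mathcal A$, all particles $\sigma(k)$ ($\sigma\in\mathcal C$, $k\ge0$) are distinct, for $k\ge1$ the particle $\sigma(k)$ interacts only with $\sigma(k-1)$, $\sigma(k+1)$ and itself (i.e. $L(\sigma(k),\beta)=0$ for all other $\beta$), and the central part $\mathcal A_1=\mathcal A\setminus\{\sigma(k):\sigma\in\mathcal C,\,k\ge1\}$ is finite. Put $\mathfrak b_\sigma(k)=-L(\sigma(k),\sigma(k+1))$, $\mathfrak a_\sigma(k)=L(\sigma(k),\sigma(k))$, and assume that all $\mathfrak b_\sigma(k)>0$ and that there are $a_\sigma\in\mathbb R$, $b_\sigma>0$, $\epsilon>0$ with $\sum_{k\ge1}(1+\epsilon)^k\{|\mathfrak a_\sigma(k)-a_\sigma|+|\mathfrak b_\sigma(k)-b_\sigma|\}<\infty$.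 Assume that $\bigcup_\sigma(a_\sigma-2b_\sigma,a_\sigma+2b_\sigma)$ is non-empty and connected, and let $\bigcup_\sigma[a_\sigma-2b_\sigma,a_\sigma+2b_\sigma]=[a-2b,a+2b]$. Let $\mathbb D$ be the open unit disk, $\mathbb T$ the unit circle, $\lambda(\omega)=W(\omega)=a-b(\omega+\omega^{-1})$, $W_\sigma(\theta)=a_\sigma-b_\sigma(\theta+\theta^{-1})$, $\theta_\sigma=W_\sigma^{-1}\circ W$ on $\mathbb D\setminus\{0\}$ (with values in $\mathbb D\setminus\{0\}$), extended continuously to $\overline{\mathbb D}\setminus\{0\}$, and $T_\sigma^+=\{\omega\in\mathbb T:\theta_\sigma(\omega)\in\mathbb T\}$. For $0<|\theta|\le1$ let $e_\sigma(k,\theta)$, $k\ge0$, be the Jost solution, i.e. the solution of $$-\mathfrak b_\sigma(k-1)x(k-1)+\mathfrak a_\sigma(k)x(k)-\mathfrak b_\sigma(k)x(k+1)=\mu x(k),\quad k\ge1,\qquad(*)$$ with $\mu=W_\sigma(\theta)$ and $x(k)=\theta^k(1+o(1))$ as $k\to\infty$. Let $p_\sigma(k,\omega)$ be the solution of $(*)$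 with $\mu=\lambda(\omega)$, $p_\sigma(0,\omega)=1$, $p_\sigma(1,\omega)=0$. Let $(r(\alpha,\beta;\lambda))_{\alpha,\beta\in\mathcal A_1}=(L_1-\lambda I)^{-1}$, where $L_1=(L(\alpha,\beta))_{\alpha,\beta\in\mathcal A_1}$, and $\mathcal R(\lambda)=(r(\sigma(0),\nu(0);\lambda))_{\sigma,\nu\in\mathcal C}$. With the diagonal matrices $\mathcal E(k,\omega)=\mathrm{diag}\{e_\sigma(k,\theta_\sigma(\omega))\}$, $P(k,\omega)=\mathrm{diag}\{p_\sigma(k,\omega)\}$, $B=\mathrm{diag}\{b_\sigma\}$, $B(0)=\mathrm{diag}\{\mathfrak b_\sigma(0)\}$, $D(\omega)=\mathrm{diag}\{\theta_\sigma(\omega)^{-1}-\theta_\sigma(\omega)\}$ put $$T(\omega)=\mathcal E(0,\omega)-\mathcal R(\lambda(\omega))B(0)\mathcal E(1,\omega),$$ $$U(k,\omega)=(u_{\sigma\nu}(k,\omega))_{\sigma,\nu\in\mathcal C}=\bigl[-P(k,\omega)+\mathcal E(k,\omega)T(\omega)^{-1}\bigr]BB(0)^{-1}D(\omega)\mathcal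 E(1,\omega)^{-1}.$$ The special solution $\psi^\sigma(\alpha,\omega)$ is given by $\psi^\sigma(\gamma(k),\omega)=u_{\gamma\sigma}(k,\omega)$ for $\gamma\in\mathcal C$, $k\ge0$, and by $\psi^\sigma(\alpha,\omega)=\sum_{\nu\in\mathcal C}r(\alpha,\nu(0);\lambda(\omega))\,\mathfrak b_\nu(0)\,u_{\nu\sigma}(1,\omega)$ for the other $\alpha\in\mathcal A_1$. For $\hat\omega\in\mathbb T$ we write $\mathrm{Res}_{\hat\omega}f=0$ if $(\omega-\hat\omega)f(\omega)\to0$ as $\omega\to\hat\omega$ in $\overline{\mathbb D}\setminus\{\hat\omega\}$ and, moreover, $f$ continues from $\overline{\mathbb D}$ to a function meromorphic near $\hat\omega$ with residue $0$ at $\hat\omega$; the second requirement is dropped if $\hat\omega\ne\pm1$ and $\theta_\gamma(\hat\omega)=\pm1$ for some $\gamma\in\mathcal C$ (there $\theta_\gamma$ has a square root branch point). **Corollary.** Let $\sigma,\nu\in\mathcal C$ and $k\ge0$. 1. If $\hat\omega\in T_\sigma^+\cup T_\nu^+$ and $\hat\omega\ne\pm1$, then $\mathrm{Res}_{\hat\omega}u_{\sigma\nu}(k,\cdot)=\mathrm{Res}_{\hat\omega}u_{\nu\sigma}(k,\cdot)=0$.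 2. If $\hat\omega\in T_\nu^+$ (the points $\pm1$ included), then $\mathrm{Res}_{\hat\omega}u_{\sigma\nu}(k,\cdot)=0$. 3. Consequently the special solutions are continuous on their arcs even at poles of $U$: for all $\sigma\in\mathcal C$ and $\alpha\in\mathcal A$ there is a function $\psi$, continuous on $T_\sigma^+$, which equals $\psi^\sigma(\alpha,\omega)$ at all $\omega\in T_\sigma^+$ at which $L_1-\lambda(\omega)I$, $T(\omega)$ and $\mathcal E(1,\omega)$ are invertible, and such that $\psi^\sigma(\alpha,\omega)\to\psi(\hat\omega)$ as $\omega\to\hat\omega$ in $\overline{\mathbb D}\setminus\{\hat\omega\}$, for every $\hat\omega\in T_\sigma^+$. -/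

import Mathlib

open Filter Topology Metric

noncomputable section

/-- A system of particles `A` with interaction matrix `L`, made of a finite central part and of
finitely many semi-infinite channels (indexed by `C`) whose coefficients converge exponentially
fast. `chan σ k` is the particle `σ(k)`; the attachment point of the channel `σ` is `chan σ 0`. -/
structure WebSystem (A C : Type*) where
  /-- the interaction matrix -/
  L : A → A → ℝ
  /-- the particles of the channels -/
  chan : C → ℕ → A
  /-- the limits `a_σ` of the diagonal coefficients along the channels -/
  aLim : C → ℝ
  /-- the limits `b_σ` of the off-diagonal coefficients along the channels -/
  bLim : C → ℝ
  /-- the centre of the continuous spectrum `[a - 2b, a + 2b]` -/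
  a : ℝ
  /-- a quarter of the length of the continuous spectrum `[a - 2b, a + 2b]` -/
  b : ℝ
  symm : ∀ α β, L α β = L β α
  finite_interaction : ∀ α, {β | L α β ≠ 0}.Finite
  /-- `L > 0` as an operator in `l²(A)` -/
  pos : ∀ ξ : lp (fun _ : A => ℝ) 2, ξ ≠ 0 → 0 < ∑' α, ξ α * ∑' β, L α β * ξ β
  /-- the particles `σ(k)` are pairwise distinct, also for different channels -/
  chan_injective : Function.Injective (fun q : C × ℕ => chan q.1 q.2)
  /-- for `k ≥ 0` the particle `σ(k+1)` interacts with `σ(k)`, itself and `σ(k+2)` only -/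
  chan_interaction : ∀ σ k β, L (chan σ (k + 1)) β ≠ 0 →
    β = chan σ k ∨ β = chan σ (k + 1) ∨ β = chan σ (k + 2)
  /-- the central part is finite -/
  finite_central : Finite {α : A // ∀ σ k, α ≠ chan σ (k + 1)}
  /-- the numbers `𝔟_σ(k) = - L(σ(k), σ(k+1))` are positive -/
  offdiag_pos : ∀ σ k, 0 < - L (chan σ k) (chan σ (k + 1))
  bLim_pos : ∀ σ, 0 < bLim σ
  exp_decay : ∀ σ, ∃ ε : ℝ, 0 < ε ∧ Summable fun k : ℕ => (1 + ε) ^ (k + 1) *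
    (|L (chan σ (k + 1)) (chan σ (k + 1)) - aLim σ| +
      |- L (chan σ (k + 1)) (chan σ (k + 2)) - bLim σ|)
  bands_connected :
    IsConnected (⋃ σ, Set.Ioo (aLim σ - 2 * bLim σ) (aLim σ + 2 * bLim σ))
  bands_union :
    (⋃ σ, Set.Icc (aLim σ - 2 * bLim σ) (aLim σ + 2 * bLim σ)) =
      Set.Icc (a - 2 * b) (a + 2 * b)

/-- The Zhukovskii mapping `z ↦ a - b (z + 1/z)`. -/
def zhukovskii (a b : ℝ) (z : ℂ) : ℂ := a - b * (z + z⁻¹)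

namespace WebSystem

variable {A C : Type*}

/-- `𝔞_σ(k) = L(σ(k), σ(k))` -/
def diagCoeff (S : WebSystem A C) (σ : C) (k : ℕ) : ℝ := S.L (S.chan σ k) (S.chan σ k)

/-- `𝔟_σ(k) = - L(σ(k), σ(k+1))` -/
def offCoeff (S : WebSystem A C) (σ : C) (k : ℕ) : ℝ :=
  - S.L (S.chan σ k) (S.chan σ (k + 1))

/-- The central part: all particles other than `σ(k)`, `k ≥ 1`. -/
abbrev Central (S : WebSystem A C) : Type _ := {α : A // ∀ σ k, α ≠ S.chan σ (k + 1)}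

instance (S : WebSystem A C) : Finite S.Central := S.finite_central

instance (S : WebSystem A C) : Fintype S.Central := Fintype.ofFinite _

instance (S : WebSystem A C) : DecidableEq S.Central := Classical.decEq _

/-- The attachment point `σ(0)` as an element of the central part. -/
def attach (S : WebSystem A C) (σ : C) : S.Central :=
  ⟨S.chan σ 0, fun τ k h => by
    have h2 := S.chan_injective (a₁ := (σ, 0)) (a₂ := (τ, k + 1)) h
    simp at h2⟩

/-- The spectral parameter `λ(ω) = a - b (ω + 1/ω)`. -/
def lam (S : WebSystem A C) (ω : ℂ) : ℂ := zhukovskii S.a S.b ω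

/-- `θ_σ = W_σ⁻¹ ∘ W` on the punctured open unit disk, where `W` and `W_σ` are the
Zhukovskii mappings of the unit disk with the parameters `a, b` and `a_σ, b_σ`. -/
def thetaDisk (S : WebSystem A C) (σ : C) (ω : ℂ) : ℂ :=
  Function.invFunOn (zhukovskii (S.aLim σ) (S.bLim σ)) (ball (0 : ℂ) 1 \ {0}) (S.lam ω)

/-- `θ_σ` on the closed unit disk, extended by continuity from the interior. -/
def theta (S : WebSystem A C) (σ : C) : ℂ → ℂ :=
  extendFrom (ball (0 : ℂ) 1 \ {0}) (S.thetaDisk σ)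

/-- `T_σ⁺ = θ_σ⁻¹(𝕋)`, a subset of the unit circle. -/
def TPlus (S : WebSystem A C) (σ : C) : Set ℂ := {ω | ‖ω‖ = 1 ∧ ‖S.theta σ ω‖ = 1}

/-- `x` is the Jost solution on the channel `σ` with parameter `θ`, `0 < |θ| ≤ 1`: it solves the
recurrence of the channel with spectral parameter `a_σ - b_σ (θ + 1/θ)`, and
`x(k) = θ^k (1 + o(1))` as `k → ∞`. These conditions determine `x`. -/
def IsJost (S : WebSystem A C) (σ : C) (θ : ℂ) (x : ℕ → ℂ) : Prop :=
  (∀ k : ℕ, -(S.offCoeff σ k : ℂ) * x k + (S.diagCoeff σ (k + 1) : ℂ) * x (k + 1)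
      - (S.offCoeff σ (k + 1) : ℂ) * x (k + 2)
      = zhukovskii (S.aLim σ) (S.bLim σ) θ * x (k + 1)) ∧
    Tendsto (fun k => x k / θ ^ k) atTop (𝓝 1)

/-- The Jost solution `e_σ(k, θ)`, for `0 < |θ| ≤ 1`. -/
def jost (S : WebSystem A C) (σ : C) (k : ℕ) (θ : ℂ) : ℂ :=
  Classical.epsilon (S.IsJost σ θ) k

/-- The solution `p_σ(k, ω)` of the recurrence of the channel `σ` with spectral parameter
`λ(ω)` and with `p_σ(0, ω) = 1`, `p_σ(1, ω) = 0`. -/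
def pSol (S : WebSystem A C) (σ : C) (ω : ℂ) : ℕ → ℂ
  | 0 => 1
  | 1 => 0
  | k + 2 => (((S.diagCoeff σ (k + 1) : ℂ) - S.lam ω) * pSol S σ ω (k + 1)
      - (S.offCoeff σ k : ℂ) * pSol S σ ω k) / (S.offCoeff σ (k + 1) : ℂ)

/-- The matrix `L₁ - z I`, where `L₁` is the restriction of `L` to the central part. -/
def centralMatrix (S : WebSystem A C) (z : ℂ) : Matrix S.Central S.Central ℂ :=
  Matrix.of (fun α β => (S.L α.1 β.1 : ℂ)) - z • (1 : Matrix S.Central S.Central ℂ)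

/-- `(r(α, β; z)) = (L₁ - z I)⁻¹` -/
def resolvent (S : WebSystem A C) (z : ℂ) : Matrix S.Central S.Central ℂ :=
  (S.centralMatrix z)⁻¹

/-- `ℛ(z) = (r(σ(0), ν(0); z))` -/
def RMat (S : WebSystem A C) (z : ℂ) : Matrix C C ℂ :=
  Matrix.of fun σ ν => S.resolvent z (S.attach σ) (S.attach ν)

section Matrices

variable [DecidableEq C]

/-- `ℰ(k, ω) = diag {e_σ(k, θ_σ(ω))}` -/
def EMat (S : WebSystem A C) (k : ℕ) (ω : ℂ) : Matrix C C ℂ :=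
  Matrix.diagonal fun σ => S.jost σ k (S.theta σ ω)

/-- `P(k, ω) = diag {p_σ(k, ω)}` -/
def PMat (S : WebSystem A C) (k : ℕ) (ω : ℂ) : Matrix C C ℂ :=
  Matrix.diagonal fun σ => S.pSol σ ω k

/-- `B = diag {b_σ}` -/
def BMat (S : WebSystem A C) : Matrix C C ℂ := Matrix.diagonal fun σ => (S.bLim σ : ℂ)

/-- `B(0) = diag {𝔟_σ(0)}` -/
def BZero (S : WebSystem A C) : Matrix C C ℂ := Matrix.diagonal fun σ => (S.offCoeff σ 0 : ℂ)

/-- `D(ω) = diag {θ_σ(ω)⁻¹ - θ_σ(ω)}` -/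
def DMat (S : WebSystem A C) (ω : ℂ) : Matrix C C ℂ :=
  Matrix.diagonal fun σ => (S.theta σ ω)⁻¹ - S.theta σ ω

variable [Fintype C]

/-- `T(ω) = ℰ(0, ω) - ℛ(λ(ω)) B(0) ℰ(1, ω)` -/
def TMat (S : WebSystem A C) (ω : ℂ) : Matrix C C ℂ :=
  S.EMat 0 ω - S.RMat (S.lam ω) * S.BZero * S.EMat 1 ω

/-- `U(k, ω) = [-P(k, ω) + ℰ(k, ω) T(ω)⁻¹] B B(0)⁻¹ D(ω) ℰ(1, ω)⁻¹` -/
def U (S : WebSystem A C) (k : ℕ) (ω : ℂ) : Matrix C C ℂ :=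
  (-S.PMat k ω + S.EMat k ω * (S.TMat ω)⁻¹) * S.BMat * (S.BZero)⁻¹ * S.DMat ω * (S.EMat 1 ω)⁻¹

/-- The points at which all inverses in the formula for `U` exist. -/
def IsRegular (S : WebSystem A C) (ω : ℂ) : Prop :=
  IsUnit (S.centralMatrix (S.lam ω)).det ∧ IsUnit (S.TMat ω).det ∧ IsUnit (S.EMat 1 ω).det

open Classical in
/-- The special solution `ψ^σ(α, ω)`: on the channels (attachment points included) it is the
`σ`-th column of `U(k, ω)`, and it is prolongated to the other particles of the central part by
`ψ^σ(α, ω) = ∑_ν r(α, ν(0); λ(ω)) 𝔟_ν(0) ψ^σ(ν(1), ω)`. -/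
def special (S : WebSystem A C) (σ : C) (α : A) (ω : ℂ) : ℂ :=
  if h : ∃ q : C × ℕ, S.chan q.1 q.2 = α then S.U h.choose.2 ω h.choose.1 σ
  else if h' : ∀ γ k, α ≠ S.chan γ (k + 1) then
    ∑ ν, S.resolvent (S.lam ω) ⟨α, h'⟩ (S.attach ν) * (S.offCoeff ν 0 : ℂ) * S.U 1 ω ν σ
  else 0

end Matrices

/-- The interior band edges: the points `ω ≠ ±1` such that `θ_γ(ω) = ±1` for some channel `γ`.
There `θ_γ` has a square root singularity. -/
def IsInnerEdge (S : WebSystem A C) (ω : ℂ) : Prop :=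
  ω ≠ 1 ∧ ω ≠ -1 ∧ ∃ γ, S.theta γ ω = 1 ∨ S.theta γ ω = -1

end WebSystem

/-- `f`, given on the closed unit disk near `z`, continues to a function meromorphic at `z`
which has the residue `r` at `z`. -/
def HasResidue (f : ℂ → ℂ) (z r : ℂ) : Prop :=
  ∃ F : ℂ → ℂ, MeromorphicAt F z ∧
    (∀ᶠ ω in 𝓝[closedBall (0 : ℂ) 1 \ {z}] z, F ω = f ω) ∧
    ∀ᶠ ρ : ℝ in 𝓝[>] 0, (2 * Real.pi * Complex.I : ℂ)⁻¹ * (∮ ω in C(z, ρ), F ω) = r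

/-- `Res_z f = 0`: one has `(ω - z) f(ω) → 0` as `ω → z` in the closed unit disk, and, unless `z`
is an interior band edge (where there is no meromorphic continuation in general), `f` continues
meromorphically to a neighbourhood of `z` with residue zero. -/
def WebSystem.ResidueVanishes {A C : Type*} (S : WebSystem A C) (f : ℂ → ℂ) (z : ℂ) : Prop :=
  Tendsto (fun ω => (ω - z) * f ω) (𝓝[closedBall (0 : ℂ) 1 \ {z}] z) (𝓝 0) ∧
    (¬ S.IsInnerEdge z → HasResidue f z 0)

end

/-! On the channel γ the special solution ψ^σ is an incoming Jost wave, present only for γ = σ, plus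
an outgoing one: u_{γσ}(k) = δ_{γσ} e_σ(k, θ_σ⁻¹) + s_{γσ} e_γ(k, θ_γ) (`U_apply`). The incoming
wave needs Jost solutions slightly outside the unit disk, and the exponential convergence of the
coefficients provides them (`analyticAt_jostE`). Near a point ω₀ of the circle every ingredient is
meromorphic in a local parameter τ = (1 - ω/ω₀)^(1/m); the choice m = 2 resolves the square root
branch points of the θ_γ (`Admissible.exists_theta_branch`). The heart of the matter is that for ω₀
∈ T_σ⁺ the functions s_{γσ} and the central part of ψ^σ have no pole in τ
(`Admissible.special_analytic`).

Suppose there is a pole of order n ≥ 1, and let φ be the limit of τⁿ ψ^σ. It solves the equation at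
λ(ω₀) and is purely outgoing, because the incoming wave stays bounded. Two arguments show φ = 0.

Current: on the circle λ is real, so the total current vanishes, and the outgoing currents of all
open channels have the same sign. Hence |s_{γσ}|² |Im θ_γ| is bounded by a constant plus |s_{σσ}|
times a null factor (`current_bound`). On T_γ⁺ the quantity |Im θ_γ| is at least of order |τ|, which
forces τⁿ s_{γσ} → 0 if γ is open at ω₀ (`IsLeading.eq_zero_of_open`). So φ vanishes on the open
channels, σ among them, and decays exponentially on the closed ones: it is a bound state.

Orthogonality: Green's formula for ψ^σ(ω) and φ gives (λ(ω) - λ(ω₀)) ⟨ψ^σ, φ⟩ = 0, since the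
incoming wave lives on σ, where φ is zero. Division by λ(ω) - λ(ω₀), multiplication by τⁿ and the
limit ω → ω₀ give ‖φ‖² = 0 (`IsLeading.eq_zero`).

This settles the columns of U and the continuity of ψ^σ. For the transposed entries the symmetry of
T⁻¹ B(0)⁻¹ ℰ(1)⁻¹ (`TMat_inv_symm`) exhibits u_{νσ}, σ ≠ ν, as an analytic function of τ divided by
θ_ν⁻¹ - θ_ν. For ω₀ ≠ ±1 one may take m = 2: the divisor costs at most one power of τ, while ω - ω₀
= -ω₀ τ². Off the inner edges the divisor does not vanish at all (`residueVanishes_transpose`). -/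

noncomputable section

/-! ### Jost solutions by backward recursion -/

/-- The coefficients of a semi-infinite Jacobi matrix which converge exponentially fast. -/
structure JacobiTail where
  diag : ℕ → ℝ
  off : ℕ → ℝ
  A : ℝ
  B : ℝ
  ρ : ℝ
  off_pos : ∀ k, 0 < off k
  B_pos : 0 < B
  one_lt : 1 < ρ
  summ : Summable fun k : ℕ => ρ ^ (k + 1) * (|diag (k + 1) - A| + |off (k + 1) - B|)

namespace JacobiTail

variable (J : JacobiTail)

lemma rho_pos : 0 < J.ρ := zero_lt_one.trans J.one_lt

/-- The perturbation term of the recurrence for `y k = x k / θ ^ k`. -/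
def pert (k : ℕ) (θ : ℂ) : ℂ :=
  ((J.diag (k + 1) - J.A : ℝ) : ℂ) * θ + ((J.B - J.off (k + 1) : ℝ) : ℂ) * θ ^ 2 +
    ((J.B - J.off k : ℝ) : ℂ)

/-- A bound of `pert k θ` for `‖θ‖² ≤ ρ`. -/
def pertBound (k : ℕ) : ℝ :=
  J.ρ * (|J.diag (k + 1) - J.A| + |J.off (k + 1) - J.B|) + |J.off k - J.B|

/-- One step of the backward recursion for the pairs `(y k, off k * (y k - y (k + 1)))`. -/
def backStep (k : ℕ) (θ : ℂ) (v : ℂ × ℂ) : ℂ × ℂ :=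
  (v.1 + (θ ^ 2 * v.2 + J.pert k θ * v.1) / (J.off k : ℂ), θ ^ 2 * v.2 + J.pert k θ * v.1)

/-- The backward recursion from the level `k + m` to the level `k`. -/
def back (θ : ℂ) : ℕ → ℕ → ℂ × ℂ → ℂ × ℂ
  | _, 0, v => v
  | k, m + 1, v => J.backStep k θ (back θ (k + 1) m v)

/-- The solution that is constant from the level `k + m` on, at the level `k`. -/
def approx (k m : ℕ) (θ : ℂ) : ℂ := (J.back θ k m (1, 0)).1

lemma pertBound_nonneg (k : ℕ) : 0 ≤ J.pertBound k := by
  have := J.rho_pos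
  unfold pertBound; positivity

lemma norm_le_rho {θ : ℂ} (h : ‖θ‖ ^ 2 ≤ J.ρ) : ‖θ‖ ≤ J.ρ := by
  have := J.one_lt
  nlinarith [norm_nonneg θ]

lemma norm_pert_le {θ : ℂ} (h : ‖θ‖ ^ 2 ≤ J.ρ) (k : ℕ) : ‖J.pert k θ‖ ≤ J.pertBound k := by
  unfold pert pertBound
  refine (norm_add₃_le).trans ?_
  rw [norm_mul, norm_mul, norm_pow, Complex.norm_real, Complex.norm_real, Complex.norm_real,
    Real.norm_eq_abs, Real.norm_eq_abs, Real.norm_eq_abs, abs_sub_comm J.B, abs_sub_comm J.B]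
  have h1 := J.norm_le_rho h
  nlinarith [abs_nonneg (J.diag (k + 1) - J.A), abs_nonneg (J.off (k + 1) - J.B)]

lemma summable_pow_pertBound : Summable fun k => J.ρ ^ k * J.pertBound k := by
  have hρ := J.rho_pos
  have h1 : Summable fun k : ℕ => J.ρ ^ (k + 1) * |J.off (k + 1) - J.B| := by
    refine J.summ.of_nonneg_of_le (fun k => by positivity) fun k => ?_
    gcongr
    linarith [abs_nonneg (J.diag (k + 1) - J.A)]
  -- The decay hypothesis starts at index 1; the coefficient `off 0` adds a single term.
  have h2 : Summable fun k : ℕ => J.ρ ^ k * |J.off k - J.B| :=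
    (summable_nat_add_iff (f := fun k : ℕ => J.ρ ^ k * |J.off k - J.B|) 1).1 h1
  refine (J.summ.add h2).congr fun k => ?_
  unfold pertBound; ring

lemma tendsto_off : Tendsto J.off atTop (𝓝 J.B) := by
  have hρ := J.one_lt
  have h1 : Summable fun k : ℕ => |J.off (k + 1) - J.B| := by
    refine J.summ.of_nonneg_of_le (fun k => by positivity) fun k => ?_
    have : 1 ≤ J.ρ ^ (k + 1) := one_le_pow₀ hρ.le
    nlinarith [abs_nonneg (J.diag (k + 1) - J.A), abs_nonneg (J.off (k + 1) - J.B)]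
  have h2 := h1.tendsto_atTop_zero
  have h3 := (tendsto_zero_iff_abs_tendsto_zero (fun k => J.off (k + 1) - J.B)).2 h2
  have h4 : Tendsto (fun k => J.off (k + 1)) atTop (𝓝 J.B) := by
    simpa using h3.add_const J.B
  exact (tendsto_add_atTop_iff_nat 1).1 h4

lemma exists_inv_off_le : ∃ K : ℝ, 0 < K ∧ ∀ k, (J.off k)⁻¹ ≤ K := by
  have h := J.tendsto_off.inv₀ J.B_pos.ne'
  obtain ⟨K, hK⟩ := h.bddAbove_range
  exact ⟨K, (inv_pos.2 (J.off_pos 0)).trans_le (hK ⟨0, rfl⟩), fun k => hK ⟨k, rfl⟩⟩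

/-- The logarithmic growth bound of one backward step. -/
def growth (k : ℕ) : ℝ := (J.ρ ^ k)⁻¹ * (J.off k)⁻¹ + J.ρ ^ k * J.pertBound k

lemma growth_nonneg (k : ℕ) : 0 ≤ J.growth k := by
  have := J.rho_pos
  have := J.off_pos k
  have := J.pertBound_nonneg k
  unfold growth; positivity

lemma summable_growth : Summable J.growth := by
  obtain ⟨K, hK, h⟩ := J.exists_inv_off_le
  have hρ := J.rho_pos
  refine Summable.add ?_ J.summable_pow_pertBound
  have hg : Summable fun k : ℕ => (J.ρ⁻¹) ^ k * K :=
    (summable_geometric_of_lt_one (by positivity) (inv_lt_one_of_one_lt₀ J.one_lt)).mul_right K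
  refine hg.of_nonneg_of_le (fun k => ?_) fun k => ?_
  · have := J.off_pos k; positivity
  · rw [inv_pow]; gcongr; exact h k

/-- The weighted norm at the level `k`. -/
def levelNorm (k : ℕ) (v : ℂ × ℂ) : ℝ := ‖v.1‖ + J.ρ ^ k * ‖v.2‖

lemma levelNorm_nonneg (k : ℕ) (v : ℂ × ℂ) : 0 ≤ J.levelNorm k v := by
  have := J.rho_pos
  unfold levelNorm; positivity

/-- The weight `ρ ^ k` on the difference absorbs the factor `θ ^ 2`. What remains is the factor `1 +
p` from adding the difference to `y` and `1 + q` from the perturbation, with `p` and `q` summable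
over the levels. This is why arguments with `‖θ‖ > 1` are allowed. -/
lemma levelNorm_backStep_le {θ : ℂ} (h : ‖θ‖ ^ 2 ≤ J.ρ) (k : ℕ) (v : ℂ × ℂ) :
    J.levelNorm k (J.backStep k θ v) ≤ Real.exp (J.growth k) * J.levelNorm (k + 1) v := by
  have hρ := J.rho_pos
  have hb := J.off_pos k
  have hH := J.pertBound_nonneg k
  set d : ℂ := θ ^ 2 * v.2 + J.pert k θ * v.1 with hd
  have hdn : J.ρ ^ k * ‖d‖ ≤ J.ρ ^ (k + 1) * ‖v.2‖ + J.ρ ^ k * J.pertBound k * ‖v.1‖ := by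
    have h1 : ‖d‖ ≤ J.ρ * ‖v.2‖ + J.pertBound k * ‖v.1‖ := by
      refine (norm_add_le _ _).trans ?_
      rw [norm_mul, norm_mul, norm_pow]
      gcongr
      exact J.norm_pert_le h k
    calc J.ρ ^ k * ‖d‖ ≤ J.ρ ^ k * (J.ρ * ‖v.2‖ + J.pertBound k * ‖v.1‖) := by gcongr
      _ = _ := by ring
  have hy : ‖v.1 + d / (J.off k : ℂ)‖ ≤ ‖v.1‖ + (J.ρ ^ k)⁻¹ * (J.off k)⁻¹ * (J.ρ ^ k * ‖d‖) := by
    refine (norm_add_le _ _).trans ?_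
    rw [norm_div, Complex.norm_real, Real.norm_of_nonneg hb.le]
    apply le_of_eq
    field_simp
  set p : ℝ := (J.ρ ^ k)⁻¹ * (J.off k)⁻¹ with hp
  set q : ℝ := J.ρ ^ k * J.pertBound k with hq
  have hp0 : 0 ≤ p := by positivity
  have hq0 : 0 ≤ q := by positivity
  have hfin : J.levelNorm k (J.backStep k θ v) ≤ (1 + p) * (1 + q) * J.levelNorm (k + 1) v := by
    unfold levelNorm backStep
    simp only [← hd]
    have hx : 0 ≤ ‖v.1‖ := norm_nonneg _
    have hz : 0 ≤ J.ρ ^ (k + 1) * ‖v.2‖ := by positivity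
    set D := J.ρ ^ k * ‖d‖
    set Z := J.ρ ^ (k + 1) * ‖v.2‖
    nlinarith [mul_le_mul_of_nonneg_left hdn hp0, mul_nonneg hp0 hx, mul_nonneg hq0 hz,
      mul_nonneg hp0 (mul_nonneg hq0 hz), mul_nonneg hp0 hz]
  refine hfin.trans ?_
  have : (1 + p) * (1 + q) ≤ Real.exp (J.growth k) := by
    have e : J.growth k = p + q := rfl
    rw [e, Real.exp_add]
    have := Real.add_one_le_exp p
    have := Real.add_one_le_exp q
    have := Real.exp_pos p
    gcongr <;> linarith
  exact mul_le_mul_of_nonneg_right this (J.levelNorm_nonneg _ _)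

/-- A bound for the growth of all backward recursions. -/
def growthConst : ℝ := Real.exp (∑' k, J.growth k)

lemma levelNorm_back_le {θ : ℂ} (h : ‖θ‖ ^ 2 ≤ J.ρ) (k m : ℕ) (v : ℂ × ℂ) :
    J.levelNorm k (J.back θ k m v) ≤ J.growthConst * J.levelNorm (k + m) v := by
  have key : ∀ m k, J.levelNorm k (J.back θ k m v) ≤
      Real.exp (∑ i ∈ Finset.Ico k (k + m), J.growth i) * J.levelNorm (k + m) v := by
    intro m
    induction m with
    | zero => intro k; simp [back]
    | succ m ih =>
      intro k
      refine (J.levelNorm_backStep_le h k _).trans ?_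
      have := ih (k + 1)
      rw [Finset.sum_eq_sum_Ico_succ_bot (by omega), Real.exp_add, mul_assoc]
      rw [show k + (m + 1) = k + 1 + m by ring]
      gcongr
  refine (key m k).trans ?_
  refine mul_le_mul_of_nonneg_right ?_ (J.levelNorm_nonneg _ _)
  exact Real.exp_le_exp.2 (J.summable_growth.sum_le_tsum _ fun i _ => J.growth_nonneg i)

/-- The recursion is peeled off at its far end, so that approximations started at consecutive levels
can be compared. -/
lemma back_succ' (θ : ℂ) (m : ℕ) : ∀ (k : ℕ) (v : ℂ × ℂ),
    J.back θ k (m + 1) v = J.back θ k m (J.backStep (k + m) θ v) := by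
  induction m with
  | zero => intro k v; simp [back]
  | succ m ih =>
    intro k v
    rw [back, ih, back, show k + 1 + m = k + (m + 1) by ring]

lemma backStep_sub (k : ℕ) (θ : ℂ) (v w : ℂ × ℂ) :
    J.backStep k θ v - J.backStep k θ w = J.backStep k θ (v - w) := by
  ext
  · simp only [backStep, Prod.fst_sub, Prod.snd_sub]; ring
  · simp only [backStep, Prod.fst_sub, Prod.snd_sub]; ring

lemma back_sub (θ : ℂ) (m : ℕ) : ∀ (k : ℕ) (v w : ℂ × ℂ),
    J.back θ k m v - J.back θ k m w = J.back θ k m (v - w) := by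
  induction m with
  | zero => intro k v w; rfl
  | succ m ih => intro k v w; simp only [back]; rw [backStep_sub, ih]

/-- A summable bound for the differences of consecutive approximations. -/
def stepBound (k : ℕ) : ℝ :=
  J.growthConst * (((J.ρ ^ k)⁻¹ * (J.off k)⁻¹ + 1) * (J.ρ ^ k * J.pertBound k))

lemma stepBound_nonneg (k : ℕ) : 0 ≤ J.stepBound k := by
  have := J.rho_pos
  have := J.off_pos k
  have := J.pertBound_nonneg k
  have : 0 < J.growthConst := Real.exp_pos _
  unfold stepBound; positivity

lemma summable_stepBound : Summable J.stepBound := by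
  obtain ⟨K, hK, h⟩ := J.exists_inv_off_le
  refine Summable.mul_left _ ?_
  refine (J.summable_pow_pertBound.mul_left (K + 1)).of_nonneg_of_le (fun k => ?_) fun k => ?_
  · have := J.rho_pos
    have := J.off_pos k
    have := J.pertBound_nonneg k
    positivity
  · have hρ := J.rho_pos
    have := J.pertBound_nonneg k
    gcongr
    have h1 : (J.ρ ^ k)⁻¹ ≤ 1 := inv_le_one_of_one_le₀ (one_le_pow₀ J.one_lt.le)
    have h2 : 0 ≤ (J.off k)⁻¹ := (inv_pos.2 (J.off_pos k)).le
    calc (J.ρ ^ k)⁻¹ * (J.off k)⁻¹ ≤ 1 * (J.off k)⁻¹ := by gcongr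
      _ ≤ K := by rw [one_mul]; exact h k

/-- By linearity the difference is the recursion applied to the defect of the constant pair `(1, 0)`
at the level `k + m`, and this defect consists of the perturbation term alone. -/
lemma norm_approx_sub_le {θ : ℂ} (h : ‖θ‖ ^ 2 ≤ J.ρ) (k m : ℕ) :
    ‖J.approx k (m + 1) θ - J.approx k m θ‖ ≤ J.stepBound (k + m) := by
  have hρ := J.rho_pos
  have e : J.approx k (m + 1) θ - J.approx k m θ =
      (J.back θ k m (J.backStep (k + m) θ (1, 0) - (1, 0))).1 := by
    rw [← back_sub, ← back_succ']; rfl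
  rw [e]
  set w := J.backStep (k + m) θ (1, 0) - (1, 0) with hw
  have h1 : ‖(J.back θ k m w).1‖ ≤ J.levelNorm k (J.back θ k m w) := by
    unfold levelNorm
    have : 0 ≤ J.ρ ^ k * ‖(J.back θ k m w).2‖ := by positivity
    linarith
  refine h1.trans ((J.levelNorm_back_le h k m w).trans ?_)
  unfold stepBound
  refine mul_le_mul_of_nonneg_left ?_ (Real.exp_pos _).le
  have hb := J.off_pos (k + m)
  have hp := J.norm_pert_le h (k + m)
  have e1 : w.1 = J.pert (k + m) θ / (J.off (k + m) : ℂ) := by simp [hw, backStep]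
  have e2 : w.2 = J.pert (k + m) θ := by simp [hw, backStep]
  unfold levelNorm
  rw [e1, e2, norm_div, Complex.norm_real, Real.norm_of_nonneg hb.le]
  have : ‖J.pert (k + m) θ‖ / J.off (k + m) + J.ρ ^ (k + m) * ‖J.pert (k + m) θ‖ =
    ((J.ρ ^ (k + m))⁻¹ * (J.off (k + m))⁻¹ + 1) * (J.ρ ^ (k + m) * ‖J.pert (k + m) θ‖) := by
    field_simp
  rw [this]
  gcongr

/-- The Jost solution divided by `θ ^ k`. -/
def jostY (k : ℕ) (θ : ℂ) : ℂ := 1 + ∑' m, (J.approx k (m + 1) θ - J.approx k m θ)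

/-- The Jost solution, on `‖θ‖² ≤ ρ`. -/
def jostE (k : ℕ) (θ : ℂ) : ℂ := θ ^ k * J.jostY k θ

lemma summable_stepBound_add (k : ℕ) : Summable fun m => J.stepBound (k + m) := by
  simpa only [add_comm k] using (summable_nat_add_iff k).2 J.summable_stepBound

lemma summable_approx_sub {θ : ℂ} (h : ‖θ‖ ^ 2 ≤ J.ρ) (k : ℕ) :
    Summable fun m => (J.approx k (m + 1) θ - J.approx k m θ) :=
  Summable.of_norm_bounded (J.summable_stepBound_add k) (J.norm_approx_sub_le h k)

lemma tendsto_approx {θ : ℂ} (h : ‖θ‖ ^ 2 ≤ J.ρ) (k : ℕ) :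
    Tendsto (fun m => J.approx k m θ) atTop (𝓝 (J.jostY k θ)) := by
  have h1 := (J.summable_approx_sub h k).hasSum.tendsto_sum_nat
  have h2 := h1.const_add 1
  refine h2.congr fun n => ?_
  rw [Finset.sum_range_sub (fun m => J.approx k m θ)]
  simp [approx, back]

lemma norm_jostY_sub_one_le {θ : ℂ} (h : ‖θ‖ ^ 2 ≤ J.ρ) (k : ℕ) :
    ‖J.jostY k θ - 1‖ ≤ ∑' m, J.stepBound (m + k) := by
  unfold jostY
  rw [add_sub_cancel_left]
  simp only [add_comm _ k]
  exact tsum_of_norm_bounded (J.summable_stepBound_add k).hasSum (J.norm_approx_sub_le h k)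

lemma tendsto_jostY {θ : ℂ} (h : ‖θ‖ ^ 2 ≤ J.ρ) :
    Tendsto (fun k => J.jostY k θ) atTop (𝓝 1) := by
  have h1 := tendsto_sum_nat_add J.stepBound
  have h2 := squeeze_zero_norm (J.norm_jostY_sub_one_le h) h1
  simpa using h2.add_const 1

lemma exists_norm_jostY_le :
    ∃ K : ℝ, 0 < K ∧ ∀ k (θ : ℂ), ‖θ‖ ^ 2 ≤ J.ρ → ‖J.jostY k θ‖ ≤ K := by
  refine ⟨1 + ∑' m, J.stepBound m, ?_, fun k θ h => ?_⟩
  · have : 0 ≤ ∑' m, J.stepBound m := tsum_nonneg J.stepBound_nonneg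
    linarith
  · have h1 := J.norm_jostY_sub_one_le h k
    have h2 : ∑' m, J.stepBound (m + k) ≤ ∑' m, J.stepBound m := by
      rw [← J.summable_stepBound.sum_add_tsum_nat_add k]
      have := Finset.sum_nonneg (s := Finset.range k) fun i _ => J.stepBound_nonneg i
      linarith
    calc ‖J.jostY k θ‖ = ‖1 + (J.jostY k θ - 1)‖ := by ring_nf
      _ ≤ ‖(1 : ℂ)‖ + ‖J.jostY k θ - 1‖ := norm_add_le _ _
      _ ≤ _ := by rw [norm_one]; linarith

lemma differentiable_back (m : ℕ) : ∀ k, Differentiable ℂ fun θ => J.back θ k m (1, 0) := by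
  induction m with
  | zero => intro k; simp only [back]; fun_prop
  | succ m ih =>
    intro k
    have := ih (k + 1)
    simp only [back, backStep, pert]
    fun_prop

lemma differentiable_approx (k m : ℕ) : Differentiable ℂ (J.approx k m) := by
  have := J.differentiable_back m k
  unfold approx
  fun_prop

/-- The series of entire functions converges uniformly on `‖θ‖ ^ 2 < ρ`. This disk contains the
closed unit disk, so that `jostE k θ⁻¹` makes sense for `θ` near the unit circle. -/
lemma analyticAt_jostE {θ : ℂ} (h : ‖θ‖ ^ 2 < J.ρ) (k : ℕ) : AnalyticAt ℂ (J.jostE k) θ := by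
  set V : Set ℂ := {z | ‖z‖ ^ 2 < J.ρ}
  have hV : IsOpen V := isOpen_lt (by fun_prop) continuous_const
  have hd : DifferentiableOn ℂ
      (fun z => ∑' m, (J.approx k (m + 1) z - J.approx k m z)) V := by
    refine Complex.differentiableOn_tsum_of_summable_norm (J.summable_stepBound_add k) (fun m => ?_) hV
      fun m z hz => J.norm_approx_sub_le (le_of_lt hz) k m
    exact ((J.differentiable_approx k _).sub (J.differentiable_approx k _)).differentiableOn
  have h1 := hd.analyticAt (hV.mem_nhds h)
  unfold jostE jostY
  fun_prop

lemma conj_approx (θ : ℂ) (k m : ℕ) :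
    J.approx k m (star θ) = star (J.approx k m θ) := by
  have key : ∀ m k, (J.back (star θ) k m (1, 0)) = star (J.back θ k m (1, 0)) := by
    intro m
    induction m with
    | zero => intro k; simp [back, Prod.ext_iff]
    | succ m ih =>
      intro k
      simp only [back]
      rw [ih]
      ext <;> simp [backStep, pert]
  unfold approx
  rw [key]; rfl

lemma conj_jostE (θ : ℂ) (k : ℕ) : J.jostE k (star θ) = star (J.jostE k θ) := by
  unfold jostE jostY
  simp only [conj_approx, ← star_sub, ← tsum_star]
  simp

/-- The recurrence of the tail with the spectral parameter `μ`. -/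
def IsSol (μ : ℂ) (x : ℕ → ℂ) : Prop :=
  ∀ k : ℕ, -(J.off k : ℂ) * x k + (J.diag (k + 1) : ℂ) * x (k + 1) - (J.off (k + 1) : ℂ) * x (k + 2)
    = μ * x (k + 1)

lemma jostY_recurrence {θ : ℂ} (h : ‖θ‖ ^ 2 ≤ J.ρ) (k : ℕ) :
    (J.off k : ℂ) * (J.jostY k θ - J.jostY (k + 1) θ) =
      θ ^ 2 * ((J.off (k + 1) : ℂ) * (J.jostY (k + 1) θ - J.jostY (k + 2) θ)) +
        J.pert k θ * J.jostY (k + 1) θ := by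
  have hb : (J.off k : ℂ) ≠ 0 := by exact_mod_cast (J.off_pos k).ne'
  have hb1 : (J.off (k + 1) : ℂ) ≠ 0 := by exact_mod_cast (J.off_pos (k + 1)).ne'
  -- The shifts 2, 1, 0 make all three approximations constant from the same level `k + m + 2` on,
  -- so that they satisfy the recurrence exactly.
  have t0 := (tendsto_add_atTop_iff_nat 2).2 (J.tendsto_approx h k)
  have t1 := (tendsto_add_atTop_iff_nat 1).2 (J.tendsto_approx h (k + 1))
  have t2 := J.tendsto_approx h (k + 2)
  have L := (t0.sub t1).const_mul (J.off k : ℂ)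
  have R := (((t1.sub t2).const_mul (J.off (k + 1) : ℂ)).const_mul (θ ^ 2)).add
    (t1.const_mul (J.pert k θ))
  refine tendsto_nhds_unique L (R.congr fun m => ?_)
  simp only [approx, back, backStep]
  field_simp
  ring

lemma isSol_jostE {θ : ℂ} (h : ‖θ‖ ^ 2 ≤ J.ρ) (h0 : θ ≠ 0) :
    J.IsSol (zhukovskii J.A J.B θ) (fun k => J.jostE k θ) := by
  intro k
  have := J.jostY_recurrence h k
  unfold pert at this
  unfold jostE zhukovskii
  push_cast at this
  field_simp
  linear_combination (-θ^(k+1)) * this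

end JacobiTail
end

/-! ### Wronskians, uniqueness of the Jost solution and channel sums -/

noncomputable section

namespace JacobiTail

variable (J : JacobiTail)

/-- The Wronskian of two sequences. -/
def wronskian (x x' : ℕ → ℂ) (k : ℕ) : ℂ := (J.off k : ℂ) * (x (k + 1) * x' k - x k * x' (k + 1))

variable {J}

lemma IsSol.wronskian_sub {μ μ' : ℂ} {x x' : ℕ → ℂ} (h : J.IsSol μ x) (h' : J.IsSol μ' x') (k : ℕ) :
    J.wronskian x x' k - J.wronskian x x' (k + 1) = (μ - μ') * (x (k + 1) * x' (k + 1)) := by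
  unfold wronskian
  linear_combination x' (k + 1) * h k - x (k + 1) * h' k

lemma IsSol.wronskian_eq {μ : ℂ} {x x' : ℕ → ℂ} (h : J.IsSol μ x) (h' : J.IsSol μ x') (k : ℕ) :
    J.wronskian x x' k = J.wronskian x x' 0 := by
  induction k with
  | zero => rfl
  | succ k ih =>
    have := h.wronskian_sub h' k
    rw [sub_self, zero_mul, sub_eq_zero] at this
    rw [← this, ih]

lemma IsSol.wronskian_eq_sum {μ μ' : ℂ} {x x' : ℕ → ℂ} (h : J.IsSol μ x) (h' : J.IsSol μ' x')
    (n : ℕ) : J.wronskian x x' 0 - J.wronskian x x' n =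
      (μ - μ') * ∑ k ∈ Finset.range n, x (k + 1) * x' (k + 1) := by
  rw [Finset.mul_sum, ← Finset.sum_congr rfl fun k _ => h.wronskian_sub h' k,
    Finset.sum_range_sub']

lemma IsSol.add {μ : ℂ} {x x' : ℕ → ℂ} (h : J.IsSol μ x) (h' : J.IsSol μ x') (c c' : ℂ) :
    J.IsSol μ (fun k => c * x k + c' * x' k) := fun k => by
  linear_combination c * h k + c' * h' k

lemma off_ne_zero (k : ℕ) : (J.off k : ℂ) ≠ 0 := by exact_mod_cast (J.off_pos k).ne'

lemma IsSol.eq_of_initial {μ : ℂ} {x x' : ℕ → ℂ} (h : J.IsSol μ x) (h' : J.IsSol μ x')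
    (h0 : x 0 = x' 0) (h1 : x 1 = x' 1) (k : ℕ) : x k = x' k := by
  have key : ∀ k, x k = x' k ∧ x (k + 1) = x' (k + 1) := by
    intro k
    induction k with
    | zero => exact ⟨h0, h1⟩
    | succ k ih =>
      refine ⟨ih.2, ?_⟩
      have e : (J.off (k + 1) : ℂ) * x (k + 2) = J.off (k + 1) * x' (k + 2) := by
        have a := h k
        have b := h' k
        rw [ih.1, ih.2] at a
        linear_combination b - a
      exact mul_left_cancel₀ (off_ne_zero _) e
  exact (key k).1

lemma IsSol.eq_of_eventually {μ : ℂ} {x x' : ℕ → ℂ} (h : J.IsSol μ x) (h' : J.IsSol μ x')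
    {N : ℕ} (hN : ∀ k, N ≤ k → x k = x' k) (k : ℕ) : x k = x' k := by
  induction N with
  | zero => exact hN k (Nat.zero_le _)
  | succ N ih =>
    refine ih fun k hk => ?_
    rcases hk.eq_or_lt with rfl | hk
    · have a := h N
      have b := h' N
      rw [hN (N + 1) le_rfl, hN (N + 2) (by omega)] at a
      have e : (J.off N : ℂ) * x N = J.off N * x' N := by linear_combination b - a
      exact mul_left_cancel₀ (off_ne_zero _) e
    · exact hN k hk

lemma tendsto_jostE_div {θ : ℂ} (h : ‖θ‖ ^ 2 ≤ J.ρ) (h0 : θ ≠ 0) :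
    Tendsto (fun k => J.jostE k θ / θ ^ k) atTop (𝓝 1) := by
  refine (J.tendsto_jostY h).congr fun k => ?_
  unfold jostE
  field_simp

/-- A solution asymptotic to `θ ^ k` is the Jost solution. -/
lemma IsSol.eq_jostE {θ : ℂ} (h1 : ‖θ‖ ≤ 1) (h0 : θ ≠ 0) {x : ℕ → ℂ}
    (hx : J.IsSol (zhukovskii J.A J.B θ) x) (hl : Tendsto (fun k => x k / θ ^ k) atTop (𝓝 1))
    (k : ℕ) : x k = J.jostE k θ := by
  have hr : ‖θ‖ ^ 2 ≤ J.ρ := (pow_le_one₀ (norm_nonneg _) h1).trans J.one_lt.le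
  have he := J.isSol_jostE hr h0
  have hle := tendsto_jostE_div hr h0
  -- The Wronskian is constant in `k`, and it equals `θ ^ (2 * k + 1)` times a null sequence; as
  -- `‖θ‖ ≤ 1` it is zero.
  have hW : ∀ k, J.wronskian x (fun k => J.jostE k θ) k = 0 := by
    have hlim : Tendsto (J.wronskian x (fun k => J.jostE k θ)) atTop (𝓝 0) := by
      have t1 := (tendsto_add_atTop_iff_nat 1).2 hl
      have t2 := (tendsto_add_atTop_iff_nat 1).2 hle
      have ho : Tendsto (fun k => (J.off k : ℂ)) atTop (𝓝 (J.B : ℂ)) :=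
        (Complex.continuous_ofReal.tendsto _).comp J.tendsto_off
      have t3 := ho.mul ((t1.mul hle).sub (hl.mul t2))
      rw [mul_one, sub_self, mul_zero] at t3
      refine squeeze_zero_norm (fun k => ?_) (tendsto_zero_iff_norm_tendsto_zero.1 t3)
      have e : J.wronskian x (fun k => J.jostE k θ) k = θ ^ (k + (k + 1)) * ((J.off k : ℂ) *
          (x (k + 1) / θ ^ (k + 1) * (J.jostE k θ / θ ^ k) -
            x k / θ ^ k * (J.jostE (k + 1) θ / θ ^ (k + 1)))) := by
        unfold wronskian; field_simp; ring
      rw [e, norm_mul, norm_pow]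
      exact mul_le_of_le_one_left (norm_nonneg _) (pow_le_one₀ (norm_nonneg _) h1)
    intro k
    have hc : J.wronskian x (fun k => J.jostE k θ) = fun _ =>
        J.wronskian x (fun k => J.jostE k θ) 0 := funext fun k => hx.wronskian_eq he k
    rw [hc] at hlim ⊢
    exact tendsto_const_nhds_iff.1 hlim
  have hne : ∀ᶠ k in atTop, x k ≠ 0 ∧ J.jostE k θ ≠ 0 := by
    filter_upwards [hl.eventually_ne one_ne_zero, hle.eventually_ne one_ne_zero] with k a b
    exact ⟨fun h => a (by simp [h]), fun h => b (by simp [h])⟩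
  obtain ⟨N, hN⟩ := eventually_atTop.1 hne
  -- Vanishing of the Wronskian makes the ratio constant as soon as both solutions are nonzero; its
  -- limit identifies it as 1.
  have hconst : ∀ m, x (N + m) / J.jostE (N + m) θ = x N / J.jostE N θ := by
    intro m
    induction m with
    | zero => rfl
    | succ m ih =>
      rw [← ih]
      have w := hW (N + m)
      unfold wronskian at w
      have w2 := (mul_eq_zero.1 w).resolve_left (off_ne_zero _)
      have a := (hN (N + m) (by omega)).2
      have b := (hN (N + (m + 1)) (by omega)).2
      rw [div_eq_div_iff b a]
      rw [add_assoc] at w2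
      linear_combination w2
  have hratio : Tendsto (fun k => x k / J.jostE k θ) atTop (𝓝 1) := by
    have := hl.div hle one_ne_zero
    rw [div_one] at this
    refine this.congr fun k => ?_
    simp only [Pi.div_apply]
    field_simp
  have hone : x N / J.jostE N θ = 1 := by
    have t : Tendsto (fun m => x (m + N) / J.jostE (m + N) θ) atTop (𝓝 1) :=
      (tendsto_add_atTop_iff_nat N).2 hratio
    simp only [add_comm _ N, hconst] at t
    exact tendsto_const_nhds_iff.1 t
  refine hx.eq_of_eventually he (N := N) (fun k hk => ?_) k
  obtain ⟨m, rfl⟩ := Nat.exists_eq_add_of_le hk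
  have := hconst m
  rw [hone, div_eq_one_iff_eq (hN (N + m) hk).2] at this
  exact this

variable (J)

/-- Both solutions belong to the same spectral parameter, so the constant Wronskian can be read off
at infinity, where the powers of `θ` and `θ⁻¹` cancel. -/
lemma wronskian_jostE_inv {θ : ℂ} (h : ‖θ‖ ^ 2 ≤ J.ρ) (h' : ‖θ⁻¹‖ ^ 2 ≤ J.ρ) (h0 : θ ≠ 0) :
    J.wronskian (fun k => J.jostE k θ) (fun k => J.jostE k θ⁻¹) 0 = J.B * (θ - θ⁻¹) := by
  have he := J.isSol_jostE h h0
  have he' := J.isSol_jostE h' (inv_ne_zero h0)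
  have hz : zhukovskii J.A J.B θ⁻¹ = zhukovskii J.A J.B θ := by
    unfold zhukovskii; rw [inv_inv, add_comm θ]
  rw [hz] at he'
  have ho : Tendsto (fun k => (J.off k : ℂ)) atTop (𝓝 (J.B : ℂ)) :=
    (Complex.continuous_ofReal.tendsto _).comp J.tendsto_off
  have t := J.tendsto_jostY h
  have t' := J.tendsto_jostY h'
  have s := (tendsto_add_atTop_iff_nat 1).2 t
  have s' := (tendsto_add_atTop_iff_nat 1).2 t'
  have lim := ho.mul (((s.mul t').const_mul θ).sub ((t.mul s').const_mul θ⁻¹))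
  rw [mul_one, mul_one, mul_one] at lim
  refine tendsto_nhds_unique ?_ lim
  have hc : (fun _ : ℕ => J.wronskian (fun k => J.jostE k θ) (fun k => J.jostE k θ⁻¹) 0) =
      J.wronskian (fun k => J.jostE k θ) (fun k => J.jostE k θ⁻¹) :=
    funext fun k => (he.wronskian_eq he' k).symm
  have := (tendsto_const_nhds (x := J.wronskian (fun k => J.jostE k θ) (fun k => J.jostE k θ⁻¹) 0)
    (f := (atTop : Filter ℕ)))
  rw [hc] at this
  refine this.congr fun k => ?_
  simp only [wronskian, jostE, inv_pow]
  field_simp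
  ring

lemma summable_jostE_mul {θ θ' : ℂ} (h : ‖θ‖ ^ 2 ≤ J.ρ) (h' : ‖θ'‖ ^ 2 ≤ J.ρ)
    (hlt : ‖θ‖ * ‖θ'‖ < 1) : Summable fun k => J.jostE (k + 1) θ * J.jostE (k + 1) θ' := by
  obtain ⟨K, hK, hb⟩ := J.exists_norm_jostY_le
  refine Summable.of_norm_bounded (g := fun k => (‖θ‖ * ‖θ'‖) ^ (k + 1) * (K * K)) ?_ fun k => ?_
  · exact ((summable_nat_add_iff 1).2
      (summable_geometric_of_lt_one (by positivity) hlt)).mul_right _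
  · unfold jostE
    rw [norm_mul, norm_mul, norm_mul, norm_pow, norm_pow, mul_pow]
    have := hb (k + 1) θ h
    have := hb (k + 1) θ' h'
    calc _ = ‖θ‖ ^ (k + 1) * ‖θ'‖ ^ (k + 1) * (‖J.jostY (k + 1) θ‖ * ‖J.jostY (k + 1) θ'‖) := by
          ring
      _ ≤ _ := by gcongr

/-- The discrete Lagrange identity is summed along the channel; the Wronskian at infinity vanishes
because `‖θ‖ * ‖θ'‖ < 1`. The sum is the contribution of the channel to the inner product in Green's
formula. -/
lemma wronskian_jostE {θ θ' : ℂ} (h : ‖θ‖ ^ 2 ≤ J.ρ) (h' : ‖θ'‖ ^ 2 ≤ J.ρ) (h0 : θ ≠ 0)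
    (h0' : θ' ≠ 0) (hlt : ‖θ‖ * ‖θ'‖ < 1) :
    J.wronskian (fun k => J.jostE k θ) (fun k => J.jostE k θ') 0 =
      (zhukovskii J.A J.B θ - zhukovskii J.A J.B θ') *
        ∑' k, J.jostE (k + 1) θ * J.jostE (k + 1) θ' := by
  have he := J.isSol_jostE h h0
  have he' := J.isSol_jostE h' h0'
  have t1 := (J.summable_jostE_mul h h' hlt).hasSum.tendsto_sum_nat.const_mul
    (zhukovskii J.A J.B θ - zhukovskii J.A J.B θ')
  have ho : Tendsto (fun k => (J.off k : ℂ)) atTop (𝓝 (J.B : ℂ)) :=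
    (Complex.continuous_ofReal.tendsto _).comp J.tendsto_off
  have t := J.tendsto_jostY h
  have t' := J.tendsto_jostY h'
  have s := (tendsto_add_atTop_iff_nat 1).2 t
  have s' := (tendsto_add_atTop_iff_nat 1).2 t'
  have lim := ho.mul (((s.mul t').const_mul θ).sub ((t.mul s').const_mul θ'))
  have hp : Tendsto (fun k => (θ * θ') ^ k) atTop (𝓝 0) :=
    tendsto_pow_atTop_nhds_zero_of_norm_lt_one (by rwa [norm_mul])
  have lim0 := hp.mul lim
  rw [zero_mul] at lim0
  have hw : Tendsto (J.wronskian (fun k => J.jostE k θ) (fun k => J.jostE k θ')) atTop (𝓝 0) := by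
    refine lim0.congr fun k => ?_
    unfold wronskian jostE
    ring
  have t2 := hw.const_sub (J.wronskian (fun k => J.jostE k θ) (fun k => J.jostE k θ') 0)
  rw [sub_zero] at t2
  exact tendsto_nhds_unique t2 (t1.congr fun n => (he.wronskian_eq_sum he' n).symm)

/-- The Jost solution does not vanish identically. -/
lemma exists_jostE_ne_zero {θ : ℂ} (h : ‖θ‖ ^ 2 ≤ J.ρ) (h0 : θ ≠ 0) :
    ∃ k, J.jostE (k + 1) θ ≠ 0 := by
  have t := (tendsto_add_atTop_iff_nat 1).2 (tendsto_jostE_div h h0)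
  obtain ⟨k, hk⟩ := (t.eventually_ne one_ne_zero).exists
  exact ⟨k, fun h => hk (by simp [h])⟩

/-- Dominated convergence with a geometric majorant. The moving factor may be any Jost solution near
`θ`, as the fixed factor supplies the decay. -/
lemma tendsto_tsum_jostE {ι : Type*} {l : Filter ι} {f : ι → ℂ} {θ θ' : ℂ} (hf : Tendsto f l (𝓝 θ))
    (hle : ∀ᶠ i in l, ‖f i‖ ^ 2 ≤ J.ρ) (h : ‖θ‖ ^ 2 < J.ρ) (h' : ‖θ'‖ ^ 2 ≤ J.ρ)
    (hlt : ‖θ‖ * ‖θ'‖ < 1) :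
    Tendsto (fun i => ∑' k, J.jostE (k + 1) (f i) * J.jostE (k + 1) θ') l
      (𝓝 (∑' k, J.jostE (k + 1) θ * J.jostE (k + 1) θ')) := by
  obtain ⟨K, hK, hb⟩ := J.exists_norm_jostY_le
  obtain ⟨r, hr1, hr2⟩ := exists_between hlt
  have hr0 : 0 ≤ r := (by positivity : 0 ≤ ‖θ‖ * ‖θ'‖).trans hr1.le
  have hev : ∀ᶠ i in l, ‖f i‖ * ‖θ'‖ < r :=
    (hf.norm.mul_const ‖θ'‖).eventually_lt_const hr1
  refine tendsto_tsum_of_dominated_convergence (bound := fun k => r ^ (k + 1) * (K * K)) ?_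
    (fun k => ?_) ?_
  · exact ((summable_nat_add_iff 1).2 (summable_geometric_of_lt_one hr0 hr2)).mul_right _
  · exact (((J.analyticAt_jostE h (k + 1)).continuousAt.tendsto.comp hf).mul_const _)
  · filter_upwards [hle, hev] with i hi1 hi2 k
    unfold jostE
    rw [norm_mul, norm_mul, norm_mul, norm_pow, norm_pow]
    have := hb (k + 1) (f i) hi1
    have := hb (k + 1) θ' h'
    calc _ = (‖f i‖ * ‖θ'‖) ^ (k + 1) * (‖J.jostY (k + 1) (f i)‖ * ‖J.jostY (k + 1) θ'‖) := by
          ring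
      _ ≤ _ := by gcongr

/-- For conjugate arguments the terms of the sum are nonnegative, one of them positive. -/
lemma tsum_jostE_conj {θ : ℂ} (h : ‖θ‖ ^ 2 ≤ J.ρ) (h0 : θ ≠ 0) (hlt : ‖θ‖ < 1) :
    ∃ t : ℝ, 0 < t ∧ ∑' k, J.jostE (k + 1) θ * J.jostE (k + 1) (star θ) = t := by
  have hs := J.summable_jostE_mul h (by rwa [norm_star]) (θ' := star θ)
    (by rw [norm_star]; nlinarith [norm_nonneg θ])
  have e : ∀ k, J.jostE (k + 1) θ * J.jostE (k + 1) (star θ) =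
      ((‖J.jostE (k + 1) θ‖ ^ 2 : ℝ) : ℂ) := fun k => by
    rw [conj_jostE, Complex.star_def, Complex.mul_conj']; norm_cast
  simp only [e] at hs ⊢
  have hs' := Complex.summable_ofReal.1 hs
  refine ⟨∑' k, ‖J.jostE (k + 1) θ‖ ^ 2, ?_, (Complex.ofReal_tsum _).symm⟩
  obtain ⟨k, hk⟩ := J.exists_jostE_ne_zero h h0
  exact hs'.tsum_pos (fun k => by positivity) k (by positivity)

end JacobiTail
end

/-! ### The Zhukovskii mapping and θ_σ inside the disk -/

noncomputable section

section Zhukovskii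

lemma zhukovskii_eq_iff {a b : ℝ} (hb : b ≠ 0) {z w : ℂ} (hz : z ≠ 0) (hw : w ≠ 0) :
    zhukovskii a b z = zhukovskii a b w ↔ z = w ∨ z * w = 1 := by
  have hb' : (b : ℂ) ≠ 0 := by exact_mod_cast hb
  have e : zhukovskii a b z - zhukovskii a b w = -b * ((z - w) * (z * w - 1)) / (z * w) := by
    unfold zhukovskii; field_simp; ring
  rw [← sub_eq_zero, e]
  simp [hb', hz, hw, sub_eq_zero]

lemma zhukovskii_inv (a b : ℝ) (z : ℂ) : zhukovskii a b z⁻¹ = zhukovskii a b z := by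
  unfold zhukovskii; rw [inv_inv, add_comm z]

lemma zhukovskii_star (a b : ℝ) (z : ℂ) : zhukovskii a b (star z) = star (zhukovskii a b z) := by
  simp [zhukovskii]

lemma exists_zhukovskii_eq {a b : ℝ} (hb : b ≠ 0) (μ : ℂ) :
    ∃ z : ℂ, z ≠ 0 ∧ ‖z‖ ≤ 1 ∧ zhukovskii a b z = μ := by
  have hb' : (b : ℂ) ≠ 0 := by exact_mod_cast hb
  obtain ⟨h, hh⟩ := IsAlgClosed.exists_pow_nat_eq (((a - μ) / b) ^ 2 - 4 : ℂ) (n := 2) (by norm_num)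
  set w : ℂ := (a - μ) / b with hw
  have hμ : μ = a - b * w := by rw [hw]; field_simp; ring
  set z : ℂ := (w + h) / 2 with hz
  have hprod : z * (w - z) = 1 := by rw [hz]; linear_combination (-1/4 : ℂ) * hh
  have hz0 : z ≠ 0 := left_ne_zero_of_mul_eq_one hprod
  have hinv : z⁻¹ = w - z := inv_eq_of_mul_eq_one_right hprod
  have hzz : zhukovskii a b z = μ := by unfold zhukovskii; rw [hinv, hμ]; ring
  rcases le_total ‖z‖ 1 with h1 | h1
  · exact ⟨z, hz0, h1, hzz⟩
  · refine ⟨z⁻¹, inv_ne_zero hz0, ?_, by rw [zhukovskii_inv, hzz]⟩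
    rw [norm_inv]; exact inv_le_one_of_one_le₀ h1

lemma inv_eq_conj_of_norm_one {z : ℂ} (hz : ‖z‖ = 1) : z⁻¹ = star z := by
  rw [Complex.inv_def, Complex.normSq_eq_norm_sq, hz]; simp

lemma zhukovskii_of_norm_one (a b : ℝ) {z : ℂ} (hz : ‖z‖ = 1) :
    zhukovskii a b z = ((a - 2 * b * z.re : ℝ) : ℂ) := by
  unfold zhukovskii
  rw [inv_eq_conj_of_norm_one hz, Complex.star_def, Complex.add_conj]; push_cast; ring

lemma exists_norm_one_zhukovskii_eq {a b : ℝ} (hb : 0 < b) {x : ℝ}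
    (hx : x ∈ Set.Icc (a - 2 * b) (a + 2 * b)) : ∃ u : ℂ, ‖u‖ = 1 ∧ zhukovskii a b u = x := by
  set t : ℝ := (a - x) / (2 * b) with ht
  have h1 : -1 ≤ t := by rw [ht, le_div_iff₀ (by positivity)]; linarith [hx.2]
  have h2 : t ≤ 1 := by rw [ht, div_le_iff₀ (by positivity)]; linarith [hx.1]
  have h3 : ‖(⟨t, Real.sqrt (1 - t ^ 2)⟩ : ℂ)‖ = 1 := by
    rw [← sq_eq_sq₀ (norm_nonneg _) zero_le_one, ← Complex.normSq_eq_norm_sq, Complex.normSq_mk,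
      Real.mul_self_sqrt (by nlinarith)]
    ring
  refine ⟨_, h3, ?_⟩
  rw [zhukovskii_of_norm_one a b h3, Complex.ofReal_inj]
  simp only [ht]; field_simp; ring

lemma zhukovskii_ne_of_norm_lt_one {a b : ℝ} (hb : 0 < b) {z : ℂ} (hz : z ≠ 0) (hz1 : ‖z‖ < 1)
    {x : ℝ} (hx : x ∈ Set.Icc (a - 2 * b) (a + 2 * b)) : zhukovskii a b z ≠ x := by
  intro h
  obtain ⟨u, hu, hux⟩ := exists_norm_one_zhukovskii_eq hb hx
  have hu0 : u ≠ 0 := by rintro rfl; simp at hu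
  rcases (zhukovskii_eq_iff hb.ne' hz hu0).1 (h.trans hux.symm) with rfl | h1
  · linarith
  · have := congrArg norm h1
    rw [norm_mul, hu, mul_one, norm_one] at this
    linarith

lemma norm_one_of_zhukovskii_mem {a b : ℝ} (hb : 0 < b) {z : ℂ} (hz : z ≠ 0)
    {x : ℝ} (hx : x ∈ Set.Icc (a - 2 * b) (a + 2 * b)) (h : zhukovskii a b z = x) : ‖z‖ = 1 := by
  obtain ⟨u, hu, hux⟩ := exists_norm_one_zhukovskii_eq hb hx
  have hu0 : u ≠ 0 := by rintro rfl; simp at hu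
  rcases (zhukovskii_eq_iff hb.ne' hz hu0).1 (h.trans hux.symm) with rfl | h1
  · exact hu
  · have := congrArg norm h1
    rwa [norm_mul, hu, mul_one, norm_one] at this

lemma zhukovskii_mem_of_norm_one {a b : ℝ} (hb : 0 < b) {z : ℂ} (hz : ‖z‖ = 1) {x : ℝ}
    (h : zhukovskii a b z = x) : x ∈ Set.Icc (a - 2 * b) (a + 2 * b) := by
  rw [zhukovskii_of_norm_one a b hz, Complex.ofReal_inj] at h
  have := abs_le.1 ((Complex.abs_re_le_norm z).trans hz.le)
  constructor <;> nlinarith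

/-- A real value of the Zhukovskii mapping is taken on the unit circle or on the real axis. -/
lemma im_eq_zero_or_norm_one {a b : ℝ} (hb : b ≠ 0) {z : ℂ} (hz : z ≠ 0) {x : ℝ}
    (h : zhukovskii a b z = x) : z.im = 0 ∨ ‖z‖ = 1 := by
  have h1 : zhukovskii a b (star z) = zhukovskii a b z := by
    rw [zhukovskii_star, h]; simp
  rcases (zhukovskii_eq_iff hb (star_ne_zero.2 hz) hz).1 h1 with h2 | h2
  · exact Or.inl (Complex.conj_eq_iff_im.1 h2)
  · right
    have := congrArg norm h2
    rw [norm_mul, norm_star, norm_one] at this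
    nlinarith [norm_nonneg z]

lemma zhukovskii_im (a b : ℝ) {z : ℂ} (hz : z ≠ 0) :
    (zhukovskii a b z).im = b * z.im * ((Complex.normSq z)⁻¹ - 1) := by
  have : Complex.normSq z ≠ 0 := by simpa using hz
  simp only [zhukovskii, Complex.sub_im, Complex.ofReal_im, Complex.mul_im, Complex.ofReal_re,
    Complex.add_im, Complex.inv_im]
  field_simp
  ring

end Zhukovskii

namespace WebSystem

variable {A C : Type*} (S : WebSystem A C)

lemma band_subset (σ : C) :
    S.a - 2 * S.b ≤ S.aLim σ - 2 * S.bLim σ ∧ S.aLim σ + 2 * S.bLim σ ≤ S.a + 2 * S.b := by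
  have hb := S.bLim_pos σ
  have h1 : Set.Icc (S.aLim σ - 2 * S.bLim σ) (S.aLim σ + 2 * S.bLim σ) ⊆
      Set.Icc (S.a - 2 * S.b) (S.a + 2 * S.b) := by
    rw [← S.bands_union]
    exact Set.subset_iUnion (fun σ => Set.Icc (S.aLim σ - 2 * S.bLim σ) (S.aLim σ + 2 * S.bLim σ)) σ
  exact (Set.Icc_subset_Icc_iff (by linarith)).1 h1

lemma b_pos : 0 < S.b := by
  obtain ⟨x, hx⟩ := S.bands_connected.nonempty
  obtain ⟨σ, _⟩ := Set.mem_iUnion.1 hx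
  have := S.band_subset σ
  have := S.bLim_pos σ
  linarith

lemma mem_band {σ : C} {x : ℝ}
    (h : x ∈ Set.Icc (S.aLim σ - 2 * S.bLim σ) (S.aLim σ + 2 * S.bLim σ)) :
    x ∈ Set.Icc (S.a - 2 * S.b) (S.a + 2 * S.b) :=
  ⟨(S.band_subset σ).1.trans h.1, h.2.trans (S.band_subset σ).2⟩

/-- Unimodular `z` have values in the band of `σ`, hence in `[a - 2b, a + 2b]`, an interval which
`λ` omits on the punctured open disk. -/
lemma norm_ne_one_of_zhukovskii_eq {σ : C} {ω z : ℂ} (hω : ω ≠ 0) (hω1 : ‖ω‖ < 1)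
    (h : zhukovskii (S.aLim σ) (S.bLim σ) z = S.lam ω) : ‖z‖ ≠ 1 := by
  intro hz
  have h1 := zhukovskii_of_norm_one (S.aLim σ) (S.bLim σ) hz
  have h2 := zhukovskii_mem_of_norm_one (S.bLim_pos σ) hz h1
  exact zhukovskii_ne_of_norm_lt_one S.b_pos hω hω1 (S.mem_band h2) (h.symm.trans h1)

lemma thetaDisk_spec (σ : C) {ω : ℂ} (hω : ω ≠ 0) (hω1 : ‖ω‖ < 1) :
    S.thetaDisk σ ω ≠ 0 ∧ ‖S.thetaDisk σ ω‖ < 1 ∧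
      zhukovskii (S.aLim σ) (S.bLim σ) (S.thetaDisk σ ω) = S.lam ω := by
  have hex : ∃ z ∈ ball (0 : ℂ) 1 \ {0}, zhukovskii (S.aLim σ) (S.bLim σ) z = S.lam ω := by
    obtain ⟨z, h0, h1, hz⟩ := exists_zhukovskii_eq (a := S.aLim σ) (S.bLim_pos σ).ne' (S.lam ω)
    refine ⟨z, ⟨?_, h0⟩, hz⟩
    rw [mem_ball_zero_iff]
    exact lt_of_le_of_ne h1 (S.norm_ne_one_of_zhukovskii_eq hω hω1 hz)
  have hm := Function.invFunOn_mem hex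
  exact ⟨hm.2, mem_ball_zero_iff.1 hm.1, Function.invFunOn_eq hex⟩

lemma eq_thetaDisk {σ : C} {ω z : ℂ} (hω : ω ≠ 0) (hω1 : ‖ω‖ < 1) (hz : z ≠ 0) (hz1 : ‖z‖ < 1)
    (h : zhukovskii (S.aLim σ) (S.bLim σ) z = S.lam ω) : S.thetaDisk σ ω = z := by
  obtain ⟨h1, h2, h3⟩ := S.thetaDisk_spec σ hω hω1
  rcases (zhukovskii_eq_iff (S.bLim_pos σ).ne' h1 hz).1 (h3.trans h.symm) with h4 | h4
  · exact h4
  · have := congrArg norm h4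
    rw [norm_mul, norm_one] at this
    nlinarith [norm_nonneg z, norm_nonneg (S.thetaDisk σ ω)]

/-- The two preimages are inverse to each other and never unimodular over the disk. By the
intermediate value theorem a continuous choice of preimage on a connected set stays inside the unit
disk or stays outside. -/
lemma thetaDisk_eq_or_inv {σ : C} {X : Set ℂ} (hX : IsPreconnected X)
    (hX1 : ∀ ω ∈ X, ω ≠ 0 ∧ ‖ω‖ < 1) {g : ℂ → ℂ} (hg : ContinuousOn g X) (hg0 : ∀ ω ∈ X, g ω ≠ 0)
    (h : ∀ ω ∈ X, zhukovskii (S.aLim σ) (S.bLim σ) (g ω) = S.lam ω) :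
    (∀ ω ∈ X, S.thetaDisk σ ω = g ω) ∨ (∀ ω ∈ X, S.thetaDisk σ ω = (g ω)⁻¹) := by
  by_cases hlt : ∀ ω ∈ X, ‖g ω‖ < 1
  · exact Or.inl fun ω hω => S.eq_thetaDisk (hX1 ω hω).1 (hX1 ω hω).2 (hg0 ω hω) (hlt ω hω) (h ω hω)
  · right
    push Not at hlt
    obtain ⟨w, hw, hw1⟩ := hlt
    intro ω hω
    have hgt : 1 < ‖g ω‖ := by
      by_contra! hle
      obtain ⟨y, hy, hy1⟩ := hX.intermediate_value hω hw hg.norm ⟨hle, hw1⟩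
      exact S.norm_ne_one_of_zhukovskii_eq (hX1 y hy).1 (hX1 y hy).2 (h y hy) hy1
    refine S.eq_thetaDisk (hX1 ω hω).1 (hX1 ω hω).2 (inv_ne_zero (hg0 ω hω)) ?_
      ((zhukovskii_inv _ _ _).trans (h ω hω))
    rw [norm_inv]; exact inv_lt_one_of_one_lt₀ hgt

/-- Both imaginary parts have the sign of `Im λ(ω)`. On the circle this means that the outgoing
currents of all channels have a common sign. -/
lemma thetaDisk_im_nonneg (σ : C) {ω : ℂ} (hω : ω ≠ 0) (hω1 : ‖ω‖ < 1) :
    0 ≤ (S.thetaDisk σ ω).im * ω.im := by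
  obtain ⟨h1, h2, h3⟩ := S.thetaDisk_spec σ hω hω1
  have e := congrArg Complex.im h3
  rw [lam, zhukovskii_im _ _ h1, zhukovskii_im _ _ hω] at e
  have key : ∀ z : ℂ, z ≠ 0 → ‖z‖ < 1 → 0 < (Complex.normSq z)⁻¹ - 1 := by
    intro z hz hz1
    have hp : 0 < Complex.normSq z := Complex.normSq_pos.2 hz
    rw [sub_pos]
    refine (one_lt_inv₀ hp).2 ?_
    rw [Complex.normSq_eq_norm_sq]
    nlinarith [norm_nonneg z]
  have p1 := key _ h1 h2
  have p2 := key _ hω hω1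
  set P := (Complex.normSq (S.thetaDisk σ ω))⁻¹ - 1
  set Q := (Complex.normSq ω)⁻¹ - 1
  have hb := S.bLim_pos σ
  have hB := S.b_pos
  have e2 : S.bLim σ * P * ((S.thetaDisk σ ω).im * ω.im) = S.b * Q * ω.im ^ 2 := by
    linear_combination ω.im * e
  have h4 : 0 ≤ S.bLim σ * P * ((S.thetaDisk σ ω).im * ω.im) := by rw [e2]; positivity
  exact nonneg_of_mul_nonneg_right h4 (by positivity)

end WebSystem

/-! ### The local parameter and the branches of θ_σ at the circle -/

/-- A nonvanishing analytic function has an analytic square root. -/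
lemma AnalyticAt.exists_sq_eq {g : ℂ → ℂ} {z : ℂ} (hg : AnalyticAt ℂ g z) (h0 : g z ≠ 0) :
    ∃ r : ℂ → ℂ, AnalyticAt ℂ r z ∧ ∀ s, r s ^ 2 = g s := by
  obtain ⟨c, hc⟩ := IsAlgClosed.exists_pow_nat_eq (g z) (n := 2) (by norm_num)
  refine ⟨fun s => c * (g s / g z) ^ ((2 : ℕ) : ℂ)⁻¹, ?_, fun s => ?_⟩
  · refine analyticAt_const.mul (AnalyticAt.cpow (hg.div analyticAt_const h0) analyticAt_const ?_)
    simp [h0]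
  · rw [mul_pow, Complex.cpow_nat_inv_pow _ two_ne_zero, hc]
    field_simp

/-- The local parameter `(1 - ω / ω₀) ^ (1 / m)` at the point `ω₀` of the unit circle. -/
def tau (m : ℕ) (ω₀ ω : ℂ) : ℂ := (1 - ω / ω₀) ^ ((m : ℂ)⁻¹)

section Tau

variable {m : ℕ} {ω₀ : ℂ}

lemma tau_pow (hm : m ≠ 0) (ω : ℂ) : tau m ω₀ ω ^ m = 1 - ω / ω₀ := Complex.cpow_nat_inv_pow _ hm

lemma mul_one_sub_tau_pow (hm : m ≠ 0) (h0 : ω₀ ≠ 0) (ω : ℂ) : ω₀ * (1 - tau m ω₀ ω ^ m) = ω := by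
  rw [tau_pow hm]; field_simp; ring

lemma tau_self (hm : m ≠ 0) (h0 : ω₀ ≠ 0) : tau m ω₀ ω₀ = 0 := by
  simp [tau, h0, hm]

lemma tau_ne_zero (hm : m ≠ 0) (h0 : ω₀ ≠ 0) {ω : ℂ} (h : ω ≠ ω₀) : tau m ω₀ ω ≠ 0 := by
  intro h1
  have := mul_one_sub_tau_pow hm h0 ω
  rw [h1, zero_pow hm, sub_zero, mul_one] at this
  exact h this.symm

/-- For `ω ≠ ω₀` in the closed disk `1 - ω / ω₀` has positive real part, so the principal power is
off its cut; at `ω₀` itself the modulus tends to zero. -/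
lemma continuousAt_tau (hm : m ≠ 0) (hω₀ : ‖ω₀‖ = 1) {ω : ℂ} (hω : ‖ω‖ ≤ 1) :
    ContinuousAt (tau m ω₀) ω := by
  have h0 : ω₀ ≠ 0 := by rintro rfl; simp at hω₀
  by_cases h : ω = ω₀
  · subst h
    have hn : Tendsto (fun w => ‖tau m ω w‖) (𝓝 ω) (𝓝 0) := by
      have h1 : ∀ w, ‖tau m ω w‖ = ‖1 - w / ω‖ ^ ((m : ℝ)⁻¹) := fun w => by
        rw [← Complex.norm_cpow_real]; simp [tau]
      have h2 : Continuous fun w : ℂ => ‖1 - w / ω‖ ^ ((m : ℝ)⁻¹) :=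
        Continuous.rpow_const (by fun_prop) fun w => Or.inr (by positivity)
      have h3 := h2.tendsto ω
      simp only [h1]
      rwa [div_self h0, sub_self, norm_zero, Real.zero_rpow (by positivity)] at h3
    unfold ContinuousAt
    rw [tau_self hm h0]
    exact tendsto_zero_iff_norm_tendsto_zero.2 hn
  · have hs : 1 - ω / ω₀ ∈ Complex.slitPlane := by
      have hn : ‖ω / ω₀‖ ≤ 1 := by rw [norm_div, hω₀, div_one]; exact hω
      have hne : ω / ω₀ ≠ 1 := fun h1 => h ((div_eq_one_iff_eq h0).1 h1)
      set z := ω / ω₀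
      left
      rw [Complex.sub_re, Complex.one_re, sub_pos]
      refine lt_of_le_of_ne ((Complex.re_le_norm z).trans hn) fun hre => hne ?_
      have h4 : z.re ^ 2 + z.im ^ 2 ≤ 1 := by
        have := Complex.normSq_eq_norm_sq z
        rw [Complex.normSq_apply] at this
        nlinarith [norm_nonneg z]
      have h5 : z.im = 0 := by nlinarith
      exact Complex.ext (by simpa using hre) (by simpa using h5)
    have hc : ContinuousAt (fun w : ℂ => 1 - w / ω₀) ω := by fun_prop
    exact (continuousAt_cpow_const hs).comp (f := fun w : ℂ => 1 - w / ω₀) hc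

lemma tendsto_tau (hm : m ≠ 0) (hω₀ : ‖ω₀‖ = 1) :
    Tendsto (tau m ω₀) (𝓝[≠] ω₀) (𝓝[≠] 0) := by
  have h0 : ω₀ ≠ 0 := by rintro rfl; simp at hω₀
  refine tendsto_nhdsWithin_iff.2 ⟨?_, ?_⟩
  · have := continuousAt_tau hm hω₀ hω₀.le
    unfold ContinuousAt at this
    rw [tau_self hm h0] at this
    exact this.mono_left nhdsWithin_le_nhds
  · filter_upwards [self_mem_nhdsWithin] with ω hω using tau_ne_zero hm h0 hω

end Tau
end

noncomputable section

namespace WebSystem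

variable {A C : Type*} (S : WebSystem A C)

/-- The sum `θ_σ(ω) + θ_σ(ω)⁻¹`. -/
def joukowski (σ : C) (ω : ℂ) : ℂ := (S.aLim σ - S.lam ω) / S.bLim σ

lemma bLim_ne_zero (σ : C) : (S.bLim σ : ℂ) ≠ 0 := by exact_mod_cast (S.bLim_pos σ).ne'

lemma zhukovskii_eq_lam_iff {σ : C} {ω z : ℂ} :
    zhukovskii (S.aLim σ) (S.bLim σ) z = S.lam ω ↔ z + z⁻¹ = S.joukowski σ ω := by
  have := S.bLim_ne_zero σ
  unfold zhukovskii joukowski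
  constructor
  · intro h; rw [← h]; field_simp; ring
  · intro h; rw [h]; field_simp; ring

lemma analyticAt_lam {ω : ℂ} (h : ω ≠ 0) : AnalyticAt ℂ S.lam ω := by
  unfold lam zhukovskii
  fun_prop (disch := assumption)

/-- `m` is an admissible exponent for the local parameter at `ω₀`. -/
def Admissible (m : ℕ) (ω₀ : ℂ) : Prop :=
  (m = 1 ∧ ∀ σ, S.joukowski σ ω₀ ^ 2 ≠ 4) ∨ (m = 1 ∧ ω₀ ^ 2 = 1) ∨ (m = 2 ∧ ω₀ ^ 2 ≠ 1)

variable {S}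

lemma Admissible.ne_zero {m : ℕ} {ω₀ : ℂ} (h : S.Admissible m ω₀) : m ≠ 0 := by
  rcases h with h | h | h <;> omega

lemma analyticAt_param {m : ℕ} {ω₀ : ℂ} : AnalyticAt ℂ (fun s => ω₀ * (1 - s ^ m)) 0 := by
  fun_prop

lemma analyticAt_lam_param {m : ℕ} {ω₀ : ℂ} (hm : m ≠ 0) (h0 : ω₀ ≠ 0) :
    AnalyticAt ℂ (fun s => S.lam (ω₀ * (1 - s ^ m))) 0 := by
  have : AnalyticAt ℂ S.lam (ω₀ * (1 - 0 ^ m)) := S.analyticAt_lam (by simpa [hm] using h0)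
  exact AnalyticAt.comp (g := S.lam) (f := fun s => ω₀ * (1 - s ^ m)) this analyticAt_param

lemma eventually_param_ne_zero {m : ℕ} {ω₀ : ℂ} (hm : m ≠ 0) (h0 : ω₀ ≠ 0) :
    ∀ᶠ s in 𝓝 (0 : ℂ), ω₀ * (1 - s ^ m) ≠ 0 :=
  (analyticAt_param (m := m) (ω₀ := ω₀)).continuousAt.eventually_ne (by simpa [hm] using h0)

/-- The difference of the Joukowski sums vanishes to second order in the local parameter. -/
lemma Admissible.joukowski_sub {m : ℕ} {ω₀ : ℂ} (h : S.Admissible m ω₀) (h0 : ω₀ ≠ 0) (σ : C)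
    (hσ : S.joukowski σ ω₀ ^ 2 = 4) : ∃ g : ℂ → ℂ, AnalyticAt ℂ g 0 ∧ g 0 ≠ 0 ∧
      ∀ᶠ s in 𝓝 (0 : ℂ), S.joukowski σ (ω₀ * (1 - s ^ m)) - S.joukowski σ ω₀ = s ^ 2 * g s := by
  have hb : (S.b : ℂ) ≠ 0 := by exact_mod_cast S.b_pos.ne'
  have hbσ := S.bLim_ne_zero σ
  rcases h with ⟨_, h⟩ | ⟨rfl, h⟩ | ⟨rfl, h⟩
  · exact absurd hσ (h σ)
  -- At `ω₀ = ±1` the derivative of `λ` vanishes, which gives the second order for `m = 1`.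
  · refine ⟨fun s => (S.b / S.bLim σ) * (ω₀ ^ 2 / (ω₀ * (1 - s))), ?_, ?_, ?_⟩
    · have : ω₀ * (1 - (0 : ℂ)) ≠ 0 := by simpa using h0
      fun_prop (disch := assumption)
    · simp [hb, hbσ, h0]
    · filter_upwards [eventually_param_ne_zero one_ne_zero h0] with s hs
      have hs' : 1 - s ≠ 0 := by simpa using right_ne_zero_of_mul hs
      unfold joukowski lam zhukovskii
      simp only [pow_one]
      field_simp
      linear_combination (-S.b * s) * h
  -- Away from `±1` the zero of `λ - λ(ω₀)` is simple, and the substitution by `s ^ 2` doubles its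
  -- order.
  · refine ⟨fun s => (S.b / S.bLim σ) * (-ω₀ * (1 - 1 / (ω₀ * (1 - s ^ 2) * ω₀))), ?_, ?_, ?_⟩
    · have : ω₀ * (1 - (0 : ℂ) ^ 2) * ω₀ ≠ 0 := by simpa using h0
      fun_prop (disch := assumption)
    · have : 1 - 1 / (ω₀ * (1 - (0 : ℂ) ^ 2) * ω₀) ≠ 0 := by
        intro h1
        apply h
        simp only [ne_eq, OfNat.ofNat_ne_zero, not_false_eq_true, zero_pow, sub_zero, mul_one] at h1
        field_simp at h1
        linear_combination h1
      exact mul_ne_zero (div_ne_zero hb hbσ) (mul_ne_zero (neg_ne_zero.2 h0) this)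
    · filter_upwards [eventually_param_ne_zero two_ne_zero h0] with s hs
      have hs' : 1 - s ^ 2 ≠ 0 := right_ne_zero_of_mul hs
      unfold joukowski lam zhukovskii
      field_simp
      ring

/-- The discriminant of the equation for `θ_σ` has an analytic square root in the local
parameter, which vanishes at most to first order. -/
lemma Admissible.exists_discr_sqrt {m : ℕ} {ω₀ : ℂ} (h : S.Admissible m ω₀) (h0 : ω₀ ≠ 0) (σ : C) :
    ∃ d : ℂ → ℂ, AnalyticAt ℂ d 0 ∧
      (∀ᶠ s in 𝓝 (0 : ℂ), d s ^ 2 = S.joukowski σ (ω₀ * (1 - s ^ m)) ^ 2 - 4) ∧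
      ∃ κ : ℝ, 0 < κ ∧ ∀ᶠ s in 𝓝 (0 : ℂ), κ * ‖s‖ ≤ ‖d s‖ := by
  have hm := h.ne_zero
  have hlam := analyticAt_lam_param (S := S) hm h0
  have hj : AnalyticAt ℂ (fun s => S.joukowski σ (ω₀ * (1 - s ^ m))) 0 := by
    unfold joukowski
    exact (analyticAt_const.sub hlam).div analyticAt_const (S.bLim_ne_zero σ)
  have hlow : ∀ r : ℂ → ℂ, AnalyticAt ℂ r 0 → r 0 ≠ 0 →
      ∀ᶠ s in 𝓝 (0 : ℂ), ‖r 0‖ / 2 ≤ ‖r s‖ := by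
    intro r hr hr0
    have : ‖r 0‖ / 2 < ‖r 0‖ := half_lt_self (norm_pos_iff.2 hr0)
    exact (hr.continuousAt.norm.tendsto.eventually_const_lt this).mono fun _ h => h.le
  by_cases hσ : S.joukowski σ ω₀ ^ 2 = 4
  · obtain ⟨g, hg, hg0, hgs⟩ := h.joukowski_sub h0 σ hσ
    -- At an edge `j ^ 2 - 4 = (j - j₀) * (j + j₀)` is `s ^ 2` times a function not vanishing at 0,
    -- whose square root is analytic.
    have hsum : AnalyticAt ℂ
        (fun s => g s * (S.joukowski σ (ω₀ * (1 - s ^ m)) + S.joukowski σ ω₀)) 0 :=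
      hg.mul (hj.add analyticAt_const)
    have hne : S.joukowski σ ω₀ ≠ 0 := by rintro h1; rw [h1] at hσ; norm_num at hσ
    obtain ⟨r, hr, hr2⟩ := hsum.exists_sq_eq (by
      simp only [zero_pow hm, sub_zero, mul_one]
      exact mul_ne_zero hg0 (by rw [← two_mul]; exact mul_ne_zero two_ne_zero hne))
    have hr0 : r 0 ≠ 0 := by
      intro h1
      have h2 := hr2 0
      rw [h1] at h2
      simp [hm, hg0, hne, ← two_mul] at h2
    refine ⟨fun s => s * r s, analyticAt_id.mul hr, ?_, ‖r 0‖ / 2, by positivity, ?_⟩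
    · filter_upwards [hgs] with s hs
      rw [mul_pow, hr2]
      linear_combination (-(S.joukowski σ (ω₀ * (1 - s ^ m)) + S.joukowski σ ω₀)) * hs - hσ
    · filter_upwards [hlow r hr hr0] with s hs
      rw [norm_mul, mul_comm]; gcongr
  · have hf : AnalyticAt ℂ (fun s => S.joukowski σ (ω₀ * (1 - s ^ m)) ^ 2 - 4) 0 :=
      (hj.pow 2).sub analyticAt_const
    have hf0 : S.joukowski σ (ω₀ * (1 - 0 ^ m)) ^ 2 - 4 ≠ 0 := by
      simpa [hm, sub_eq_zero] using hσ
    obtain ⟨r, hr, hr2⟩ := hf.exists_sq_eq hf0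
    have hr0 : r 0 ≠ 0 := by
      intro h1
      have h2 := hr2 0
      rw [h1, zero_pow two_ne_zero] at h2
      exact hf0 h2.symm
    refine ⟨r, hr, Eventually.of_forall hr2, ‖r 0‖ / 2, by positivity, ?_⟩
    have hs1 : ∀ᶠ s in 𝓝 (0 : ℂ), ‖s‖ < 1 := by
      simpa using eventually_norm_sub_lt (0 : ℂ) (zero_lt_one' ℝ)
    filter_upwards [hlow r hr hr0, hs1] with s hs hs1
    have : 0 < ‖r 0‖ / 2 := by positivity
    nlinarith

lemma mem_closure_punctured_ball {ω : ℂ} (h : ‖ω‖ ≤ 1) (h0 : ω ≠ 0) :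
    ω ∈ closure (ball (0 : ℂ) 1 \ {0}) := by
  have h1 : ω ∈ ({0}ᶜ : Set ℂ) ∩ closure (ball (0 : ℂ) 1) := by
    refine ⟨h0, ?_⟩
    rw [closure_ball _ one_ne_zero]
    simpa using h
  have h2 := isOpen_compl_singleton.inter_closure h1
  rwa [Set.inter_comm, ← Set.sdiff_eq] at h2

/-- `θ_σ` is an analytic function of the local parameter. -/
theorem Admissible.exists_theta_branch {m : ℕ} {ω₀ : ℂ} (h : S.Admissible m ω₀) (hω₀ : ‖ω₀‖ = 1)
    (σ : C) : ∃ Θ : ℂ → ℂ, AnalyticAt ℂ Θ 0 ∧ Θ 0 ≠ 0 ∧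
      (∃ κ : ℝ, 0 < κ ∧ ∀ᶠ s in 𝓝 (0 : ℂ), κ * ‖s‖ ≤ ‖(Θ s)⁻¹ - Θ s‖) ∧
      ∀ᶠ ω in 𝓝 ω₀, zhukovskii (S.aLim σ) (S.bLim σ) (Θ (tau m ω₀ ω)) = S.lam ω ∧
        (‖ω‖ < 1 → S.thetaDisk σ ω = Θ (tau m ω₀ ω)) ∧
        (‖ω‖ ≤ 1 → S.theta σ ω = Θ (tau m ω₀ ω)) := by
  have hm := h.ne_zero
  have h0 : ω₀ ≠ 0 := by rintro rfl; simp at hω₀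
  obtain ⟨d, hd, hd2, κ, hκ, hdκ⟩ := h.exists_discr_sqrt h0 σ
  set j : ℂ → ℂ := fun s => S.joukowski σ (ω₀ * (1 - s ^ m)) with hjdef
  have hj : AnalyticAt ℂ j 0 := by
    simp only [hjdef, joukowski]
    exact (analyticAt_const.sub (analyticAt_lam_param hm h0)).div analyticAt_const (S.bLim_ne_zero σ)
  -- This is one root of `z ^ 2 - j z + 1 = 0`; the other root is its inverse, and the two differ by
  -- `d`.
  set Θ₁ : ℂ → ℂ := fun s => (j s + d s) / 2 with hΘ₁
  have hΘa : AnalyticAt ℂ Θ₁ 0 := (hj.add hd).div analyticAt_const two_ne_zero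
  have hprod : ∀ᶠ s in 𝓝 (0 : ℂ), Θ₁ s ≠ 0 ∧ (Θ₁ s)⁻¹ = j s - Θ₁ s ∧
      ‖(Θ₁ s)⁻¹ - Θ₁ s‖ = ‖d s‖ := by
    filter_upwards [hd2] with s hs
    have e : Θ₁ s * (j s - Θ₁ s) = 1 := by
      simp only [hΘ₁]
      simp only [hjdef]
      linear_combination (-1/4 : ℂ) * hs
    have e2 := inv_eq_of_mul_eq_one_right e
    refine ⟨left_ne_zero_of_mul_eq_one e, e2, ?_⟩
    rw [e2, show j s - Θ₁ s - Θ₁ s = - d s by simp only [hΘ₁]; ring, norm_neg]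
  have hev : ∀ᶠ s in 𝓝 (0 : ℂ), AnalyticAt ℂ Θ₁ s ∧ Θ₁ s ≠ 0 ∧ (Θ₁ s)⁻¹ = j s - Θ₁ s :=
    hΘa.eventually_analyticAt.and (hprod.mono fun s hs => ⟨hs.1, hs.2.1⟩)
  have htau : Tendsto (tau m ω₀) (𝓝 ω₀) (𝓝 0) := by
    have := (continuousAt_tau (m := m) hm hω₀ hω₀.le).tendsto
    rwa [tau_self hm h0] at this
  have hω0 : ∀ᶠ ω in 𝓝 ω₀, ω ≠ 0 := isOpen_ne.mem_nhds h0
  obtain ⟨r, hr, hball⟩ := Metric.eventually_nhds_iff_ball.1 ((htau.eventually hev).and hω0)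
  have hz : ∀ ω ∈ ball ω₀ r, zhukovskii (S.aLim σ) (S.bLim σ) (Θ₁ (tau m ω₀ ω)) = S.lam ω := by
    intro ω hω
    rw [zhukovskii_eq_lam_iff, (hball ω hω).1.2.2]
    simp only [hjdef, mul_one_sub_tau_pow hm h0]
    ring
  have hcont : ∀ ω ∈ ball ω₀ r, ‖ω‖ ≤ 1 → ContinuousAt (fun ω => Θ₁ (tau m ω₀ ω)) ω :=
    fun ω hω h1 => (hball ω hω).1.1.continuousAt.comp (continuousAt_tau hm hω₀ h1)
  have hX : IsPreconnected (ball ω₀ r ∩ ball (0 : ℂ) 1) :=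
    ((convex_ball _ _).inter (convex_ball _ _)).isPreconnected
  -- The part of the disk near `ω₀` is convex, so the same root represents `θ_σ` on all of it.
  have hsel := S.thetaDisk_eq_or_inv (σ := σ) hX
    (fun ω hω => ⟨(hball ω hω.1).2, mem_ball_zero_iff.1 hω.2⟩)
    (g := fun ω => Θ₁ (tau m ω₀ ω))
    (fun ω hω => (hcont ω hω.1 (mem_ball_zero_iff.1 hω.2).le).continuousWithinAt)
    (fun ω hω => (hball ω hω.1).1.2.1) (fun ω hω => hz ω hω.1)
  have hfin : ∀ Θ : ℂ → ℂ,
      (∀ ω ∈ ball ω₀ r, ‖ω‖ ≤ 1 → ContinuousAt (fun ω => Θ (tau m ω₀ ω)) ω) →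
      (∀ ω ∈ ball ω₀ r ∩ ball (0 : ℂ) 1, S.thetaDisk σ ω = Θ (tau m ω₀ ω)) →
      ∀ ω ∈ ball ω₀ r, (‖ω‖ < 1 → S.thetaDisk σ ω = Θ (tau m ω₀ ω)) ∧
        (‖ω‖ ≤ 1 → S.theta σ ω = Θ (tau m ω₀ ω)) := by
    intro Θ hc hs ω hω
    refine ⟨fun h1 => hs ω ⟨hω, mem_ball_zero_iff.2 h1⟩, fun h1 => ?_⟩
    refine extendFrom_eq (mem_closure_punctured_ball h1 (hball ω hω).2) ?_
    refine Tendsto.congr' ?_ ((hc ω hω h1).tendsto.mono_left nhdsWithin_le_nhds)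
    filter_upwards [self_mem_nhdsWithin, nhdsWithin_le_nhds (isOpen_ball.mem_nhds hω)] with z hz1 hz2
    exact (hs z ⟨hz2, hz1.1⟩).symm
  have hΘ0 := hprod.self_of_nhds.1
  rcases hsel with hsel | hsel
  · refine ⟨Θ₁, hΘa, hΘ0, ⟨κ, hκ, ?_⟩, ?_⟩
    · filter_upwards [hprod, hdκ] with s hs1 hs2
      rw [hs1.2.2]; exact hs2
    · filter_upwards [isOpen_ball.mem_nhds (mem_ball_self hr)] with ω hω
      exact ⟨hz ω hω, hfin Θ₁ hcont hsel ω hω⟩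
  · refine ⟨fun s => (Θ₁ s)⁻¹, hΘa.inv hΘ0, inv_ne_zero hΘ0, ⟨κ, hκ, ?_⟩, ?_⟩
    · filter_upwards [hprod, hdκ] with s hs1 hs2
      rw [inv_inv, norm_sub_rev, hs1.2.2]; exact hs2
    · filter_upwards [isOpen_ball.mem_nhds (mem_ball_self hr)] with ω hω
      refine ⟨(zhukovskii_inv _ _ _).trans (hz ω hω), hfin (fun s => (Θ₁ s)⁻¹) (fun z hz1 hz2 => ?_) hsel ω hω⟩
      exact (hcont z hz1 hz2).inv₀ (hball z hz1).1.2.1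

lemma exists_admissible (S : WebSystem A C) (ω₀ : ℂ) : ∃ m, S.Admissible m ω₀ := by
  by_cases h : ω₀ ^ 2 = 1
  · exact ⟨1, Or.inr (Or.inl ⟨rfl, h⟩)⟩
  · exact ⟨2, Or.inr (Or.inr ⟨rfl, h⟩)⟩

variable (S)

/-- Everything is inherited from the punctured open disk by passing to the limit; the local branch
shows that the limit exists and is nonzero. The last clause says that the extension by continuity
does not change `θ_σ` inside. -/
theorem theta_spec (σ : C) {ω : ℂ} (hω : ‖ω‖ = 1) :
    S.theta σ ω ≠ 0 ∧ ‖S.theta σ ω‖ ≤ 1 ∧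
      zhukovskii (S.aLim σ) (S.bLim σ) (S.theta σ ω) = S.lam ω ∧
      0 ≤ (S.theta σ ω).im * ω.im ∧ ContinuousWithinAt (S.theta σ) (closedBall 0 1) ω ∧
      ∀ᶠ z in 𝓝 ω, ‖z‖ < 1 → S.theta σ z = S.thetaDisk σ z := by
  have h0 : ω ≠ 0 := by rintro rfl; simp at hω
  obtain ⟨m, hm⟩ := S.exists_admissible ω
  obtain ⟨Θ, hΘ, hΘ0, _, hev⟩ := hm.exists_theta_branch hω σ
  have hself := hev.self_of_nhds
  have hcΘ : ContinuousAt (fun z => Θ (tau m ω z)) ω := by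
    refine ContinuousAt.comp ?_ (continuousAt_tau hm.ne_zero hω hω.le)
    rw [tau_self hm.ne_zero h0]; exact hΘ.continuousAt
  have hval := hself.2.2 hω.le
  have hne : S.theta σ ω ≠ 0 := by rw [hval, tau_self hm.ne_zero h0]; exact hΘ0
  have hcl := mem_closure_punctured_ball hω.le h0
  have := mem_closure_iff_nhdsWithin_neBot.1 hcl
  have hdisk : Tendsto (S.thetaDisk σ) (𝓝[ball (0 : ℂ) 1 \ {0}] ω) (𝓝 (S.theta σ ω)) := by
    rw [hval]
    refine Tendsto.congr' ?_ (hcΘ.tendsto.mono_left nhdsWithin_le_nhds)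
    filter_upwards [self_mem_nhdsWithin, nhdsWithin_le_nhds hev] with z hz1 hz2
    exact (hz2.2.1 (mem_ball_zero_iff.1 hz1.1)).symm
  refine ⟨hne, ?_, ?_, ?_, ?_, ?_⟩
  · refine le_of_tendsto hdisk.norm ?_
    filter_upwards [self_mem_nhdsWithin] with z hz
    exact (S.thetaDisk_spec σ hz.2 (mem_ball_zero_iff.1 hz.1)).2.1.le
  · rw [hval]; exact hself.1
  · have hid : Tendsto (fun z : ℂ => z.im) (𝓝[ball (0 : ℂ) 1 \ {0}] ω) (𝓝 ω.im) :=
      (Complex.continuous_im.tendsto _).mono_left nhdsWithin_le_nhds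
    refine ge_of_tendsto (((Complex.continuous_im.tendsto _).comp hdisk).mul hid) ?_
    filter_upwards [self_mem_nhdsWithin] with z hz
    exact S.thetaDisk_im_nonneg σ hz.2 (mem_ball_zero_iff.1 hz.1)
  · refine Tendsto.congr' ?_ ((hval ▸ hcΘ.tendsto).mono_left nhdsWithin_le_nhds)
    filter_upwards [self_mem_nhdsWithin, nhdsWithin_le_nhds hev] with z hz1 hz2
    exact (hz2.2.2 (mem_closedBall_zero_iff.1 hz1)).symm
  · filter_upwards [hev] with z hz hz1
    rw [hz.2.2 hz1.le, hz.2.1 hz1]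

/-- This turns the condition on `θ_σ` into one on the real number `λ(ω)`, which is easy to vary
along the band. -/
lemma mem_TPlus_iff {σ : C} {ω : ℂ} : ω ∈ S.TPlus σ ↔ ‖ω‖ = 1 ∧
    ∃ x ∈ Set.Icc (S.aLim σ - 2 * S.bLim σ) (S.aLim σ + 2 * S.bLim σ), S.lam ω = (x : ℝ) := by
  constructor
  · rintro ⟨h1, h2⟩
    obtain ⟨_, _, h3, _⟩ := S.theta_spec σ h1
    have h4 := zhukovskii_of_norm_one (S.aLim σ) (S.bLim σ) h2
    exact ⟨h1, _, zhukovskii_mem_of_norm_one (S.bLim_pos σ) h2 h4, h3.symm.trans h4⟩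
  · rintro ⟨h1, x, hx, h2⟩
    obtain ⟨h0, _, h3, _⟩ := S.theta_spec σ h1
    exact ⟨h1, norm_one_of_zhukovskii_mem (S.bLim_pos σ) h0 hx (h3.trans h2)⟩

/-- The arcs `T_σ⁺` have no isolated points. -/
theorem frequently_mem_TPlus {σ : C} {ω₀ : ℂ} (h : ω₀ ∈ S.TPlus σ) :
    ∃ᶠ ω in 𝓝[≠] ω₀, ω ∈ S.TPlus σ := by
  obtain ⟨h1, x₀, hx₀, hl⟩ := S.mem_TPlus_iff.1 h
  have hb := S.b_pos
  have hbσ := S.bLim_pos σ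
  set I := Set.Icc (S.aLim σ - 2 * S.bLim σ) (S.aLim σ + 2 * S.bLim σ) with hI
  have hnt : I.Nontrivial := ⟨_, ⟨le_rfl, by linarith⟩, _, ⟨by linarith, le_rfl⟩, by linarith⟩
  have hacc : AccPt x₀ (𝓟 I) := isPreconnected_Icc.preperfect_of_nontrivial hnt x₀ hx₀
  -- The sign `e` selects a closed half circle containing `ω₀`. Below, `u` inverts `λ` on this half
  -- circle, so that the points of the band near `x₀` are carried to points of `T_σ⁺` near `ω₀`.
  obtain ⟨e, he, him⟩ : ∃ e : ℝ, e ^ 2 = 1 ∧ ω₀.im = e * Real.sqrt (1 - ω₀.re ^ 2) := by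
    have hn : ω₀.re ^ 2 + ω₀.im ^ 2 = 1 := by
      have := Complex.normSq_eq_norm_sq ω₀
      rw [Complex.normSq_apply, h1] at this
      linarith
    have hs : Real.sqrt (1 - ω₀.re ^ 2) = |ω₀.im| := by
      rw [← Real.sqrt_sq_eq_abs]; congr 1; linarith
    rw [hs]
    rcases le_total 0 ω₀.im with h2 | h2
    · exact ⟨1, by norm_num, by rw [abs_of_nonneg h2]; ring⟩
    · exact ⟨-1, by norm_num, by rw [abs_of_nonpos h2]; ring⟩
  set t : ℝ → ℝ := fun x => (S.a - x) / (2 * S.b) with ht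
  set u : ℝ → ℂ := fun x => (t x : ℂ) + (e * Real.sqrt (1 - t x ^ 2) : ℝ) * Complex.I with hu
  have hcont : Continuous u := by
    simp only [hu, ht]; fun_prop
  have hlamre : ∀ ω : ℂ, ‖ω‖ = 1 → S.lam ω = ((S.a - 2 * S.b * ω.re : ℝ) : ℂ) := fun ω hω =>
    zhukovskii_of_norm_one S.a S.b hω
  have ht0 : t x₀ = ω₀.re := by
    have := (hlamre ω₀ h1).symm.trans hl
    rw [Complex.ofReal_inj] at this
    simp only [ht]; rw [← this]; field_simp; ring
  have hu0 : u x₀ = ω₀ := by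
    simp only [hu]; rw [ht0, ← him, Complex.re_add_im]
  have hmem : ∀ x ∈ I, u x ∈ S.TPlus σ ∧ S.lam (u x) = x := by
    intro x hx
    have hx' := S.mem_band hx
    have h2 : -1 ≤ t x := by simp only [ht]; rw [le_div_iff₀ (by positivity)]; linarith [hx'.2]
    have h3 : t x ≤ 1 := by simp only [ht]; rw [div_le_iff₀ (by positivity)]; linarith [hx'.1]
    have hre : (u x).re = t x := by simp [hu]
    have him2 : (u x).im = e * Real.sqrt (1 - t x ^ 2) := by simp [hu]
    have hn : ‖u x‖ = 1 := by
      rw [← sq_eq_sq₀ (norm_nonneg _) zero_le_one, ← Complex.normSq_eq_norm_sq, Complex.normSq_apply,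
        hre, him2]
      have := Real.mul_self_sqrt (show 0 ≤ 1 - t x ^ 2 by nlinarith)
      linear_combination (e ^ 2) * this + (1 - t x ^ 2) * he
    have hl2 : S.lam (u x) = x := by
      rw [hlamre _ hn, hre, Complex.ofReal_inj]; simp only [ht]; field_simp; ring
    exact ⟨S.mem_TPlus_iff.2 ⟨hn, x, hx, hl2⟩, hl2⟩
  have : (𝓝[≠] x₀ ⊓ 𝓟 I).NeBot := hacc
  have htend : Tendsto u (𝓝[≠] x₀ ⊓ 𝓟 I) (𝓝[≠] ω₀) := by
    refine tendsto_nhdsWithin_iff.2 ⟨?_, ?_⟩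
    · have := hcont.tendsto x₀
      rw [hu0] at this
      exact this.mono_left (inf_le_left.trans nhdsWithin_le_nhds)
    · have h2 : ∀ᶠ x in 𝓝[≠] x₀ ⊓ 𝓟 I, x ≠ x₀ := by
        filter_upwards [mem_inf_of_left self_mem_nhdsWithin] with x hx using hx
      filter_upwards [h2, mem_inf_of_right (mem_principal_self I)] with x hx hxI hxe
      refine hx ?_
      have := (hmem x hxI).2
      rw [hxe, hl, Complex.ofReal_inj] at this
      exact this.symm
  refine htend.frequently (Eventually.frequently ?_)
  filter_upwards [mem_inf_of_right (mem_principal_self I)] with x hx using (hmem x hx).1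

end WebSystem
end

/-! ### Functions meromorphic or analytic in a local parameter -/

noncomputable section

/-- Along the filter `l`, `f` is a meromorphic function of the parameter `τ → 0`. -/
def IsMeroIn (l : Filter ℂ) (τ f : ℂ → ℂ) : Prop :=
  ∃ F : ℂ → ℂ, MeromorphicAt F 0 ∧ ∀ᶠ ω in l, f ω = F (τ ω)

/-- Along the filter `l`, `f` is an analytic function of the parameter `τ → 0`. -/
def IsAnalyticIn (l : Filter ℂ) (τ f : ℂ → ℂ) : Prop :=
  ∃ F : ℂ → ℂ, AnalyticAt ℂ F 0 ∧ ∀ᶠ ω in l, f ω = F (τ ω)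

section

variable {l : Filter ℂ} {τ f g : ℂ → ℂ}

namespace IsMeroIn

lemma const (c : ℂ) : IsMeroIn l τ fun _ => c :=
  ⟨fun _ => c, MeromorphicAt.const c 0, Eventually.of_forall fun _ => rfl⟩

lemma add (hf : IsMeroIn l τ f) (hg : IsMeroIn l τ g) : IsMeroIn l τ fun ω => f ω + g ω := by
  obtain ⟨F, hF, e⟩ := hf
  obtain ⟨G, hG, e'⟩ := hg
  exact ⟨F + G, hF.add hG, by filter_upwards [e, e'] with ω h1 h2 using by rw [h1, h2]; rfl⟩

lemma mul (hf : IsMeroIn l τ f) (hg : IsMeroIn l τ g) : IsMeroIn l τ fun ω => f ω * g ω := by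
  obtain ⟨F, hF, e⟩ := hf
  obtain ⟨G, hG, e'⟩ := hg
  exact ⟨F * G, hF.mul hG, by filter_upwards [e, e'] with ω h1 h2 using by rw [h1, h2]; rfl⟩

lemma inv (hf : IsMeroIn l τ f) : IsMeroIn l τ fun ω => (f ω)⁻¹ := by
  obtain ⟨F, hF, e⟩ := hf
  exact ⟨F⁻¹, hF.inv, by filter_upwards [e] with ω h1 using by rw [h1]; rfl⟩

lemma neg (hf : IsMeroIn l τ f) : IsMeroIn l τ fun ω => - f ω := by
  obtain ⟨F, hF, e⟩ := hf
  exact ⟨-F, hF.neg, by filter_upwards [e] with ω h1 using by rw [h1]; rfl⟩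

lemma sub (hf : IsMeroIn l τ f) (hg : IsMeroIn l τ g) : IsMeroIn l τ fun ω => f ω - g ω := by
  simpa only [sub_eq_add_neg] using hf.add hg.neg

lemma div (hf : IsMeroIn l τ f) (hg : IsMeroIn l τ g) : IsMeroIn l τ fun ω => f ω / g ω := by
  simpa only [div_eq_mul_inv] using hf.mul hg.inv

lemma sum {ι : Type*} {s : Finset ι} {f : ι → ℂ → ℂ} (h : ∀ i ∈ s, IsMeroIn l τ (f i)) :
    IsMeroIn l τ fun ω => ∑ i ∈ s, f i ω := by
  classical
  induction s using Finset.induction_on with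
  | empty => simpa using const 0
  | insert i s hi ih =>
    simp only [Finset.sum_insert hi]
    exact (h i (by simp)).add (ih fun j hj => h j (by simp [hj]))

lemma prod {ι : Type*} {s : Finset ι} {f : ι → ℂ → ℂ} (h : ∀ i ∈ s, IsMeroIn l τ (f i)) :
    IsMeroIn l τ fun ω => ∏ i ∈ s, f i ω := by
  classical
  induction s using Finset.induction_on with
  | empty => simpa using const 1
  | insert i s hi ih =>
    simp only [Finset.prod_insert hi]
    exact (h i (by simp)).mul (ih fun j hj => h j (by simp [hj]))

/-- A meromorphic function vanishes near a point either identically or nowhere in a punctured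
neighbourhood. Nonvanishing at some points arbitrarily far along the filter therefore suffices. -/
lemma eventually_ne_zero (hτ : Tendsto τ l (𝓝[≠] 0)) (hf : IsMeroIn l τ f)
    (h : ∃ᶠ ω in l, f ω ≠ 0) : ∀ᶠ ω in l, f ω ≠ 0 := by
  obtain ⟨F, hF, e⟩ := hf
  rcases hF.eventually_eq_zero_or_eventually_ne_zero with h0 | h0
  · refine absurd ?_ h
    simp only [not_not]
    filter_upwards [e, hτ.eventually h0] with ω h1 h2 using by rw [h1, h2]
  · filter_upwards [e, hτ.eventually h0] with ω h1 h2 using by rwa [h1]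

end IsMeroIn

/-- Matrices whose entries are meromorphic in the parameter. -/
def IsMeroMat {m n : Type*} (l : Filter ℂ) (τ : ℂ → ℂ) (M : ℂ → Matrix m n ℂ) : Prop :=
  ∀ i j, IsMeroIn l τ fun ω => M ω i j

namespace IsMeroMat

variable {m n p : Type*}

lemma const (M : Matrix m n ℂ) : IsMeroMat l τ fun _ => M := fun _ _ => IsMeroIn.const _

lemma sub {M N : ℂ → Matrix m n ℂ} (hM : IsMeroMat l τ M) (hN : IsMeroMat l τ N) :
    IsMeroMat l τ fun ω => M ω - N ω := fun i j => (hM i j).sub (hN i j)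

lemma mul [Fintype n] {M : ℂ → Matrix m n ℂ} {N : ℂ → Matrix n p ℂ} (hM : IsMeroMat l τ M)
    (hN : IsMeroMat l τ N) : IsMeroMat l τ fun ω => M ω * N ω := fun i j => by
  simp only [Matrix.mul_apply]
  exact IsMeroIn.sum fun k _ => (hM i k).mul (hN k j)

lemma diagonal [DecidableEq n] {d : n → ℂ → ℂ} (h : ∀ i, IsMeroIn l τ (d i)) :
    IsMeroMat l τ fun ω => Matrix.diagonal fun i => d i ω := fun i j => by
  by_cases hij : i = j
  · subst hij; simpa using h i
  · simpa [hij] using IsMeroIn.const 0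

lemma det [Fintype n] [DecidableEq n] {M : ℂ → Matrix n n ℂ} (hM : IsMeroMat l τ M) :
    IsMeroIn l τ fun ω => (M ω).det := by
  simp only [Matrix.det_apply']
  exact IsMeroIn.sum fun s _ => (IsMeroIn.const _).mul (IsMeroIn.prod fun i _ => hM _ _)

lemma inv [Fintype n] [DecidableEq n] {M : ℂ → Matrix n n ℂ} (hM : IsMeroMat l τ M) :
    IsMeroMat l τ fun ω => (M ω)⁻¹ := fun i j => by
  -- Cramer's formula holds also for singular matrices with the convention that the inverse is then
  -- 0, so no invertibility is needed here.
  simp only [Matrix.inv_def, Ring.inverse_eq_inv', Matrix.smul_apply, smul_eq_mul]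
  refine hM.det.inv.mul ?_
  simp only [Matrix.adjugate_apply]
  refine IsMeroMat.det (M := fun ω => (M ω).updateRow j (Pi.single i 1)) fun a b => ?_
  simp only [Matrix.updateRow_apply]
  split_ifs
  · exact IsMeroIn.const _
  · exact hM a b

end IsMeroMat

namespace IsAnalyticIn

lemma isMeroIn (hf : IsAnalyticIn l τ f) : IsMeroIn l τ f := by
  obtain ⟨F, hF, e⟩ := hf
  exact ⟨F, hF.meromorphicAt, e⟩

lemma congr (hf : IsAnalyticIn l τ f) (h : ∀ᶠ ω in l, g ω = f ω) : IsAnalyticIn l τ g := by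
  obtain ⟨F, hF, e⟩ := hf
  exact ⟨F, hF, by filter_upwards [h, e] with ω h1 h2 using h1.trans h2⟩

lemma const (c : ℂ) : IsAnalyticIn l τ fun _ => c :=
  ⟨fun _ => c, analyticAt_const, Eventually.of_forall fun _ => rfl⟩

lemma add (hf : IsAnalyticIn l τ f) (hg : IsAnalyticIn l τ g) :
    IsAnalyticIn l τ fun ω => f ω + g ω := by
  obtain ⟨F, hF, e⟩ := hf
  obtain ⟨G, hG, e'⟩ := hg
  exact ⟨F + G, hF.add hG, by filter_upwards [e, e'] with ω h1 h2 using by rw [h1, h2]; rfl⟩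

lemma mul (hf : IsAnalyticIn l τ f) (hg : IsAnalyticIn l τ g) :
    IsAnalyticIn l τ fun ω => f ω * g ω := by
  obtain ⟨F, hF, e⟩ := hf
  obtain ⟨G, hG, e'⟩ := hg
  exact ⟨F * G, hF.mul hG, by filter_upwards [e, e'] with ω h1 h2 using by rw [h1, h2]; rfl⟩

lemma sub (hf : IsAnalyticIn l τ f) (hg : IsAnalyticIn l τ g) :
    IsAnalyticIn l τ fun ω => f ω - g ω := by
  obtain ⟨F, hF, e⟩ := hf
  obtain ⟨G, hG, e'⟩ := hg
  exact ⟨F - G, hF.sub hG, by filter_upwards [e, e'] with ω h1 h2 using by rw [h1, h2]; rfl⟩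

lemma comp {G : ℂ → ℂ} {c : ℂ} (hτ : Tendsto τ l (𝓝[≠] 0)) [l.NeBot] (hf : IsAnalyticIn l τ f)
    (hc : Tendsto f l (𝓝 c)) (hG : AnalyticAt ℂ G c) : IsAnalyticIn l τ fun ω => G (f ω) := by
  obtain ⟨F, hF, e⟩ := hf
  have h1 : Tendsto (fun ω => F (τ ω)) l (𝓝 (F 0)) :=
    hF.continuousAt.tendsto.comp (hτ.mono_right nhdsWithin_le_nhds)
  have h2 : F 0 = c := tendsto_nhds_unique h1 (hc.congr' e)
  subst h2
  exact ⟨G ∘ F, hG.comp hF, by filter_upwards [e] with ω h1 using by rw [h1]; rfl⟩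

lemma exists_tendsto (hτ : Tendsto τ l (𝓝[≠] 0)) (hf : IsAnalyticIn l τ f) :
    ∃ c, Tendsto f l (𝓝 c) := by
  obtain ⟨F, hF, e⟩ := hf
  have h1 : Tendsto (fun ω => F (τ ω)) l (𝓝 (F 0)) :=
    hF.continuousAt.tendsto.comp (hτ.mono_right nhdsWithin_le_nhds)
  exact ⟨F 0, h1.congr' (by filter_upwards [e] with ω h using h.symm)⟩

end IsAnalyticIn

lemma MeromorphicAt.exists_analyticAt {F : ℂ → ℂ} {x : ℂ} (hF : MeromorphicAt F x)
    (h : 0 ≤ meromorphicOrderAt F x) : ∃ G : ℂ → ℂ, AnalyticAt ℂ G x ∧ F =ᶠ[𝓝[≠] x] G := by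
  by_cases ht : meromorphicOrderAt F x = ⊤
  · exact ⟨0, analyticAt_const, meromorphicOrderAt_eq_top_iff.1 ht⟩
  · lift meromorphicOrderAt F x to ℤ using ht with n hn
    obtain ⟨g, hg, _, he⟩ := (meromorphicOrderAt_eq_int_iff hF).1 hn.symm
    have hn0 : 0 ≤ n := by exact_mod_cast h
    lift n to ℕ using hn0
    refine ⟨fun z => (z - x) ^ n • g z, by fun_prop, ?_⟩
    filter_upwards [he] with z hz
    rw [hz, zpow_natCast]

/-- A finite family of functions meromorphic in the parameter is analytic in the parameter, or
it has nontrivial leading coefficients of negative order. -/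
theorem IsMeroIn.analytic_or_leading {ι : Type*} [Finite ι] {f : ι → ℂ → ℂ}
    (hτ : Tendsto τ l (𝓝[≠] 0)) (hf : ∀ i, IsMeroIn l τ (f i)) :
    (∀ i, IsAnalyticIn l τ (f i)) ∨ ∃ (n : ℕ) (L : ι → ℂ), n ≠ 0 ∧ L ≠ 0 ∧
      ∀ i, Tendsto (fun ω => τ ω ^ n * f i ω) l (𝓝 (L i)) := by
  choose F hF e using hf
  by_cases h : ∀ i, 0 ≤ meromorphicOrderAt (F i) 0
  · left
    intro i
    obtain ⟨G, hG, hFG⟩ := (hF i).exists_analyticAt (h i)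
    refine ⟨G, hG, ?_⟩
    filter_upwards [e i, hτ.eventually hFG] with ω h1 h2 using h1.trans h2
  · right
    push Not at h
    obtain ⟨j, hj⟩ := h
    have : Nonempty ι := ⟨j⟩
    -- The member of lowest order `-n` determines the common power: after multiplication by the
    -- `n`-th power of the parameter all limits exist, and the one at `i₀` is nonzero.
    obtain ⟨i₀, hi₀⟩ := Finite.exists_min fun i => meromorphicOrderAt (F i) 0
    have hneg : meromorphicOrderAt (F i₀) 0 < 0 := (hi₀ j).trans_lt hj
    obtain ⟨z, hz⟩ := WithTop.ne_top_iff_exists.1 hneg.ne_top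
    have hz0 : z < 0 := by rw [← hz] at hneg; exact_mod_cast hneg
    obtain ⟨n, hn⟩ := Int.eq_ofNat_of_zero_le (show 0 ≤ -z by omega)
    have hpow : MeromorphicAt (fun s : ℂ => s ^ n) 0 := by fun_prop
    have hord : meromorphicOrderAt (fun s : ℂ => s ^ n) 0 = ((n : ℤ) : WithTop ℤ) := by
      rw [meromorphicOrderAt_eq_int_iff hpow]
      exact ⟨fun _ => 1, analyticAt_const, one_ne_zero, Eventually.of_forall fun s => by simp⟩
    have hmul : ∀ i, meromorphicOrderAt ((fun s : ℂ => s ^ n) * F i) 0 =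
        ((n : ℤ) : WithTop ℤ) + meromorphicOrderAt (F i) 0 := fun i => by
      rw [meromorphicOrderAt_mul hpow (hF i), hord]
    have hz' : ((n : ℤ) : WithTop ℤ) + meromorphicOrderAt (F i₀) 0 = 0 := by
      rw [← hz, ← WithTop.coe_add, ← hn]; simp
    have hnn : ∀ i, 0 ≤ meromorphicOrderAt ((fun s : ℂ => s ^ n) * F i) 0 := fun i => by
      rw [hmul, ← hz']
      exact add_le_add_right (hi₀ i) _
    choose L hL using fun i => tendsto_nhds_of_meromorphicOrderAt_nonneg (hpow.mul (hF i)) (hnn i)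
    obtain ⟨c, hc, hc'⟩ := tendsto_ne_zero_of_meromorphicOrderAt_eq_zero (hpow.mul (hF i₀))
      ((hmul i₀).trans hz')
    refine ⟨n, L, by omega, ?_, fun i => ?_⟩
    · intro h0
      have h1 := tendsto_nhds_unique (hL i₀) hc'
      rw [h0] at h1
      exact hc h1.symm
    · refine ((hL i).comp hτ).congr' ?_
      filter_upwards [e i] with ω hω
      simp [hω]

end
end

/-! ### Dependence of the ingredients of U on the local parameter -/

noncomputable section

namespace WebSystem

variable {A C : Type*} (S : WebSystem A C)

/-- The coefficients of the channel `σ`. -/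
def tail (σ : C) : JacobiTail where
  diag := S.diagCoeff σ
  off := S.offCoeff σ
  A := S.aLim σ
  B := S.bLim σ
  ρ := 1 + (S.exp_decay σ).choose
  off_pos := S.offdiag_pos σ
  B_pos := S.bLim_pos σ
  one_lt := by linarith [(S.exp_decay σ).choose_spec.1]
  summ := (S.exp_decay σ).choose_spec.2

lemma norm_sq_le_rho (σ : C) {θ : ℂ} (h : ‖θ‖ ≤ 1) : ‖θ‖ ^ 2 ≤ (S.tail σ).ρ :=
  (pow_le_one₀ (norm_nonneg _) h).trans (S.tail σ).one_lt.le

lemma norm_sq_lt_rho (σ : C) {θ : ℂ} (h : ‖θ‖ ≤ 1) : ‖θ‖ ^ 2 < (S.tail σ).ρ :=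
  (pow_le_one₀ (norm_nonneg _) h).trans_lt (S.tail σ).one_lt

/-- By uniqueness the arbitrary choice in the definition of `jost` can only return the solution
constructed by backward recursion. -/
lemma jost_eq (σ : C) (k : ℕ) {θ : ℂ} (h : ‖θ‖ ≤ 1) (h0 : θ ≠ 0) :
    S.jost σ k θ = (S.tail σ).jostE k θ := by
  have hr := S.norm_sq_le_rho σ h
  have hex : S.IsJost σ θ (fun k => (S.tail σ).jostE k θ) :=
    ⟨(S.tail σ).isSol_jostE hr h0, JacobiTail.tendsto_jostE_div hr h0⟩
  have hsp : S.IsJost σ θ (Classical.epsilon (S.IsJost σ θ)) := Classical.epsilon_spec ⟨_, hex⟩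
  exact JacobiTail.IsSol.eq_jostE (J := S.tail σ) h h0 hsp.1 hsp.2 k

/-- The punctured neighbourhoods of `ω₀` in the closed unit disk. -/
abbrev diskNhds (ω₀ : ℂ) : Filter ℂ := 𝓝[closedBall (0 : ℂ) 1 \ {ω₀}] ω₀

lemma diskNhds_le (ω₀ : ℂ) : diskNhds ω₀ ≤ 𝓝[≠] ω₀ :=
  nhdsWithin_mono _ fun _ h => h.2

lemma eventually_norm_le (ω₀ : ℂ) : ∀ᶠ ω in diskNhds ω₀, ‖ω‖ ≤ 1 ∧ ω ≠ ω₀ := by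
  filter_upwards [self_mem_nhdsWithin] with ω h using ⟨mem_closedBall_zero_iff.1 h.1, h.2⟩

lemma ne_zero_of_norm_one {ω₀ : ℂ} (h : ‖ω₀‖ = 1) : ω₀ ≠ 0 := by rintro rfl; simp at h

/-- Nonreal points of the open disk accumulate at every point of the circle. -/
lemma frequently_nonreal {ω₀ : ℂ} (h : ‖ω₀‖ = 1) :
    ∃ᶠ ω in diskNhds ω₀, ‖ω‖ < 1 ∧ ω.im ≠ 0 := by
  have hsub : ball (0 : ℂ) 1 ∩ {z : ℂ | z.im ≠ 0} ⊆ closedBall (0 : ℂ) 1 \ {ω₀} := fun z hz =>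
    ⟨ball_subset_closedBall hz.1, fun he => by
      have := mem_ball_zero_iff.1 hz.1
      rw [Set.mem_singleton_iff.1 he, h] at this
      exact lt_irrefl _ this⟩
  have hdense : Dense {z : ℂ | z.im ≠ 0} := by
    have hd : Dense ({0}ᶜ : Set ℝ) := dense_compl_singleton 0
    exact hd.preimage Complex.isOpenMap_im
  have hcl : ω₀ ∈ closure (ball (0 : ℂ) 1 ∩ {z : ℂ | z.im ≠ 0}) := by
    have h1 := closure_mono (hdense.open_subset_closure_inter (isOpen_ball (x := (0 : ℂ)) (ε := 1)))
    rw [closure_closure, closure_ball _ one_ne_zero] at h1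
    exact h1 (by simp [h])
  have hne := mem_closure_iff_nhdsWithin_neBot.1 hcl
  have hle : 𝓝[ball (0 : ℂ) 1 ∩ {z : ℂ | z.im ≠ 0}] ω₀ ≤ diskNhds ω₀ := nhdsWithin_mono _ hsub
  refine Frequently.filter_mono (Eventually.frequently ?_) hle
  filter_upwards [self_mem_nhdsWithin] with z hz using ⟨mem_ball_zero_iff.1 hz.1, hz.2⟩

lemma diskNhds_neBot {ω₀ : ℂ} (h : ‖ω₀‖ = 1) : (diskNhds ω₀).NeBot :=
  ⟨fun hb => by simpa [hb] using frequently_nonreal h⟩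

variable {S}
variable {m : ℕ} {ω₀ : ℂ}

lemma Admissible.tendsto_tau (h : S.Admissible m ω₀) (hω₀ : ‖ω₀‖ = 1) :
    Tendsto (tau m ω₀) (diskNhds ω₀) (𝓝[≠] 0) :=
  (_root_.tendsto_tau h.ne_zero hω₀).mono_left (diskNhds_le ω₀)

/-- The analytic dependence of `θ_σ` on the local parameter. -/
lemma Admissible.theta_analytic (h : S.Admissible m ω₀) (hω₀ : ‖ω₀‖ = 1) (σ : C) :
    IsAnalyticIn (diskNhds ω₀) (tau m ω₀) (S.theta σ) := by
  obtain ⟨Θ, hΘ, _, _, hev⟩ := h.exists_theta_branch hω₀ σ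
  refine ⟨Θ, hΘ, ?_⟩
  filter_upwards [nhdsWithin_le_nhds hev, eventually_norm_le ω₀] with ω h1 h2 using h1.2.2 h2.1

lemma Admissible.theta_inv_sub (h : S.Admissible m ω₀) (hω₀ : ‖ω₀‖ = 1) (σ : C) :
    ∃ κ : ℝ, 0 < κ ∧ ∀ᶠ ω in diskNhds ω₀,
      κ * ‖tau m ω₀ ω‖ ≤ ‖(S.theta σ ω)⁻¹ - S.theta σ ω‖ := by
  obtain ⟨Θ, hΘ, _, ⟨κ, hκ, hk⟩, hev⟩ := h.exists_theta_branch hω₀ σ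
  refine ⟨κ, hκ, ?_⟩
  filter_upwards [nhdsWithin_le_nhds hev, eventually_norm_le ω₀,
    ((h.tendsto_tau hω₀).mono_right nhdsWithin_le_nhds).eventually hk] with ω h1 h2 h3
  rw [h1.2.2 h2.1]; exact h3

lemma tendsto_theta (S : WebSystem A C) (hω₀ : ‖ω₀‖ = 1) (σ : C) :
    Tendsto (S.theta σ) (diskNhds ω₀) (𝓝 (S.theta σ ω₀)) :=
  (S.theta_spec σ hω₀).2.2.2.2.1.tendsto.mono_left (nhdsWithin_mono _ fun _ h => h.1)

/-- The defining properties of `θ_σ(ω)`. -/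
def ThetaGood (S : WebSystem A C) (σ : C) (ω : ℂ) : Prop :=
  S.theta σ ω ≠ 0 ∧ ‖S.theta σ ω‖ ≤ 1 ∧
    zhukovskii (S.aLim σ) (S.bLim σ) (S.theta σ ω) = S.lam ω ∧ (‖ω‖ < 1 → ‖S.theta σ ω‖ < 1)

lemma thetaGood_of_norm_one (S : WebSystem A C) (σ : C) {ω : ℂ} (h : ‖ω‖ = 1) :
    S.ThetaGood σ ω :=
  ⟨(S.theta_spec σ h).1, (S.theta_spec σ h).2.1, (S.theta_spec σ h).2.2.1,
    fun h1 => absurd h h1.ne⟩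

lemma eventually_thetaGood (S : WebSystem A C) (hω₀ : ‖ω₀‖ = 1) (σ : C) :
    ∀ᶠ ω in diskNhds ω₀, S.ThetaGood σ ω := by
  have h0 : ∀ᶠ ω in 𝓝 ω₀, ω ≠ 0 := isOpen_ne.mem_nhds (ne_zero_of_norm_one hω₀)
  filter_upwards [eventually_norm_le ω₀, nhdsWithin_le_nhds h0,
    nhdsWithin_le_nhds (S.theta_spec σ hω₀).2.2.2.2.2] with ω h1 h2 h3
  rcases h1.1.eq_or_lt with h4 | h4
  · exact S.thetaGood_of_norm_one σ h4
  · have := S.thetaDisk_spec σ h2 h4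
    unfold ThetaGood
    rw [h3 h4]
    exact ⟨this.1, this.2.1.le, this.2.2, fun _ => this.2.1⟩

lemma ThetaGood.jost_eq {σ : C} {ω : ℂ} (h : S.ThetaGood σ ω) (k : ℕ) :
    S.jost σ k (S.theta σ ω) = (S.tail σ).jostE k (S.theta σ ω) := S.jost_eq σ k h.2.1 h.1

lemma Admissible.jost_analytic (h : S.Admissible m ω₀) (hω₀ : ‖ω₀‖ = 1) (σ : C) (k : ℕ) :
    IsAnalyticIn (diskNhds ω₀) (tau m ω₀) fun ω => S.jost σ k (S.theta σ ω) := by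
  have := diskNhds_neBot hω₀
  have h1 := (h.theta_analytic hω₀ σ).comp (h.tendsto_tau hω₀) (tendsto_theta S hω₀ σ)
    ((S.tail σ).analyticAt_jostE (S.norm_sq_lt_rho σ (S.theta_spec σ hω₀).2.1) k)
  refine h1.congr ?_
  filter_upwards [S.eventually_thetaGood hω₀ σ] with ω hω using hω.jost_eq k

lemma Admissible.theta_inv_analytic (h : S.Admissible m ω₀) (hω₀ : ‖ω₀‖ = 1) (σ : C) :
    IsAnalyticIn (diskNhds ω₀) (tau m ω₀) fun ω => (S.theta σ ω)⁻¹ := by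
  have := diskNhds_neBot hω₀
  exact (h.theta_analytic hω₀ σ).comp (h.tendsto_tau hω₀) (tendsto_theta S hω₀ σ)
    (analyticAt_inv (S.theta_spec σ hω₀).1)

/-- On `T_σ⁺` the value `θ_σ(ω₀)⁻¹` is unimodular, hence interior to the disk where the Jost
solution is analytic. Thus the incoming wave is free of poles. -/
lemma Admissible.jostE_inv_analytic (h : S.Admissible m ω₀) {σ : C} (hσ : ω₀ ∈ S.TPlus σ) (k : ℕ) :
    IsAnalyticIn (diskNhds ω₀) (tau m ω₀) fun ω => (S.tail σ).jostE k (S.theta σ ω)⁻¹ := by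
  have := diskNhds_neBot hσ.1
  refine (h.theta_inv_analytic hσ.1 σ).comp (h.tendsto_tau hσ.1)
    ((tendsto_theta S hσ.1 σ).inv₀ (S.theta_spec σ hσ.1).1)
    ((S.tail σ).analyticAt_jostE (S.norm_sq_lt_rho σ ?_) k)
  rw [norm_inv, hσ.2, inv_one]

lemma Admissible.lam_analytic (h : S.Admissible m ω₀) (hω₀ : ‖ω₀‖ = 1) :
    IsAnalyticIn (diskNhds ω₀) (tau m ω₀) S.lam := by
  have h0 := ne_zero_of_norm_one hω₀
  refine ⟨_, analyticAt_lam_param (S := S) h.ne_zero h0, Eventually.of_forall fun ω => ?_⟩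
  simp only [mul_one_sub_tau_pow h.ne_zero h0]

lemma tendsto_lam (S : WebSystem A C) (hω₀ : ‖ω₀‖ = 1) :
    Tendsto S.lam (diskNhds ω₀) (𝓝 (S.lam ω₀)) :=
  (S.analyticAt_lam (ne_zero_of_norm_one hω₀)).continuousAt.tendsto.mono_left nhdsWithin_le_nhds

/-- `λ` is locally injective at `ω₀`. -/
lemma eventually_lam_ne (S : WebSystem A C) (hω₀ : ‖ω₀‖ = 1) :
    ∀ᶠ ω in diskNhds ω₀, S.lam ω ≠ S.lam ω₀ := by
  have h0 := ne_zero_of_norm_one hω₀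
  have hne : ∀ᶠ ω in diskNhds ω₀, ω * ω₀ ≠ 1 := by
    by_cases h : ω₀ * ω₀ = 1
    · filter_upwards [eventually_norm_le ω₀] with ω hω h1
      exact hω.2 (mul_right_cancel₀ h0 (h1.trans h.symm))
    · have hc : ContinuousAt (fun ω : ℂ => ω * ω₀) ω₀ := by fun_prop
      exact nhdsWithin_le_nhds (hc.eventually_ne h)
  have hz : ∀ᶠ ω in 𝓝 ω₀, ω ≠ 0 := isOpen_ne.mem_nhds h0
  filter_upwards [hne, nhdsWithin_le_nhds hz, eventually_norm_le ω₀] with ω h1 h2 h3 h4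
  rcases (zhukovskii_eq_iff S.b_pos.ne' h2 h0).1 h4 with h5 | h5
  · exact h3.2 h5
  · exact h1 h5

lemma Admissible.centralMatrix_mero (h : S.Admissible m ω₀) (hω₀ : ‖ω₀‖ = 1) :
    IsMeroMat (diskNhds ω₀) (tau m ω₀) fun ω => S.centralMatrix (S.lam ω) := fun α β => by
  simp only [centralMatrix, Matrix.sub_apply, Matrix.smul_apply, smul_eq_mul, Matrix.of_apply]
  exact (IsMeroIn.const _).sub ((h.lam_analytic hω₀).isMeroIn.mul (IsMeroIn.const _))

lemma Admissible.resolvent_mero (h : S.Admissible m ω₀) (hω₀ : ‖ω₀‖ = 1) :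
    IsMeroMat (diskNhds ω₀) (tau m ω₀) fun ω => S.resolvent (S.lam ω) :=
  (h.centralMatrix_mero hω₀).inv

section

variable [DecidableEq C]

lemma Admissible.EMat_mero (h : S.Admissible m ω₀) (hω₀ : ‖ω₀‖ = 1) (k : ℕ) :
    IsMeroMat (diskNhds ω₀) (tau m ω₀) (S.EMat k) :=
  IsMeroMat.diagonal fun σ => (h.jost_analytic hω₀ σ k).isMeroIn

lemma Admissible.DMat_mero (h : S.Admissible m ω₀) (hω₀ : ‖ω₀‖ = 1) :
    IsMeroMat (diskNhds ω₀) (tau m ω₀) S.DMat :=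
  IsMeroMat.diagonal fun σ =>
    (h.theta_analytic hω₀ σ).isMeroIn.inv.sub (h.theta_analytic hω₀ σ).isMeroIn

variable [Fintype C]

lemma Admissible.TMat_mero (h : S.Admissible m ω₀) (hω₀ : ‖ω₀‖ = 1) :
    IsMeroMat (diskNhds ω₀) (tau m ω₀) S.TMat := by
  have hR : IsMeroMat (diskNhds ω₀) (tau m ω₀) fun ω => S.RMat (S.lam ω) :=
    fun σ ν => h.resolvent_mero hω₀ (S.attach σ) (S.attach ν)
  exact (h.EMat_mero hω₀ 0).sub ((hR.mul (IsMeroMat.const S.BZero)).mul (h.EMat_mero hω₀ 1))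

/-- The second summand `T(ω)⁻¹ B B(0)⁻¹ D(ω) ℰ(1, ω)⁻¹` of `U`, without the factor `ℰ(k, ω)`. -/
def XMat (S : WebSystem A C) (ω : ℂ) : Matrix C C ℂ :=
  (S.TMat ω)⁻¹ * S.BMat * (S.BZero)⁻¹ * S.DMat ω * (S.EMat 1 ω)⁻¹

lemma Admissible.XMat_mero (h : S.Admissible m ω₀) (hω₀ : ‖ω₀‖ = 1) :
    IsMeroMat (diskNhds ω₀) (tau m ω₀) S.XMat := by
  have h1 : IsMeroMat (diskNhds ω₀) (tau m ω₀) fun ω => (S.TMat ω)⁻¹ := (h.TMat_mero hω₀).inv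
  have h2 : IsMeroMat (diskNhds ω₀) (tau m ω₀) fun ω => (S.EMat 1 ω)⁻¹ := (h.EMat_mero hω₀ 1).inv
  have h3 := (h1.mul (IsMeroMat.const S.BMat)).mul (IsMeroMat.const (S.BZero)⁻¹)
  exact (h3.mul (h.DMat_mero hω₀)).mul h2

end

end WebSystem
end

/-! ### Green's formula and invertibility off the real axis -/

noncomputable section

open Matrix

namespace WebSystem

variable {A C : Type*} {S : WebSystem A C}

lemma ThetaGood.theta_inv_rho {σ : C} {ω : ℂ} (h : ‖S.theta σ ω‖ = 1) :
    ‖(S.theta σ ω)⁻¹‖ ^ 2 ≤ (S.tail σ).ρ :=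
  S.norm_sq_le_rho σ (by rw [norm_inv, h, inv_one])

variable (S)

lemma attach_injective : Function.Injective S.attach := fun σ ν h => by
  have h1 : S.chan σ 0 = S.chan ν 0 := congrArg Subtype.val h
  have h2 := S.chan_injective (a₁ := (σ, 0)) (a₂ := (ν, 0)) h1
  exact congrArg Prod.fst h2

lemma centralMatrix_transpose (z : ℂ) : (S.centralMatrix z)ᵀ = S.centralMatrix z := by
  ext α β
  simp [centralMatrix, Matrix.one_apply, eq_comm, S.symm α.1 β.1]

lemma resolvent_transpose (z : ℂ) : (S.resolvent z)ᵀ = S.resolvent z := by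
  unfold resolvent
  rw [transpose_nonsing_inv, centralMatrix_transpose]

lemma star_centralMatrix_mulVec (z : ℂ) (x : S.Central → ℂ) :
    star (S.centralMatrix z *ᵥ x) = S.centralMatrix (star z) *ᵥ star x := by
  ext α
  simp only [Matrix.mulVec, dotProduct, Pi.star_apply, star_sum, star_mul']
  refine Finset.sum_congr rfl fun β _ => ?_
  congr 1
  by_cases h : α = β <;> simp [centralMatrix, h]

section

variable [Fintype C]

/-- The forces which the channels exert on the central part. -/
def source (u : C → ℂ) : S.Central → ℂ :=
  ∑ ν, Pi.single (S.attach ν) ((S.offCoeff ν 0 : ℂ) * u ν)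

variable {S}

lemma dotProduct_source (x : S.Central → ℂ) (u : C → ℂ) :
    x ⬝ᵥ S.source u = ∑ ν, (S.offCoeff ν 0 : ℂ) * (u ν * x (S.attach ν)) := by
  unfold source
  rw [dotProduct_sum]
  refine Finset.sum_congr rfl fun ν _ => ?_
  rw [dotProduct_single]; ring

lemma star_source (u : C → ℂ) : star (S.source u) = S.source (star u) := by
  unfold source
  rw [star_sum]
  refine Finset.sum_congr rfl fun ν _ => ?_
  rw [← Pi.single_star]; simp

/-- Green's formula in the central part. -/
lemma green {z z' : ℂ} {x x' : S.Central → ℂ} {u u' : C → ℂ}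
    (h : S.centralMatrix z *ᵥ x = S.source u) (h' : S.centralMatrix z' *ᵥ x' = S.source u') :
    (z' - z) * (x ⬝ᵥ x') = ∑ ν, (S.offCoeff ν 0 : ℂ) *
      (u ν * x' (S.attach ν) - u' ν * x (S.attach ν)) := by
  have e1 : x' ⬝ᵥ (S.centralMatrix z *ᵥ x) = x ⬝ᵥ (S.centralMatrix z *ᵥ x') := by
    rw [dotProduct_mulVec, ← mulVec_transpose, centralMatrix_transpose, dotProduct_comm]
  have e2 : S.centralMatrix z *ᵥ x' = S.centralMatrix z' *ᵥ x' + (z' - z) • x' := by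
    simp only [centralMatrix, sub_mulVec, smul_mulVec, one_mulVec, sub_smul]
    abel
  have e3 := dotProduct_source x' u
  rw [← h, e1, e2, h', dotProduct_add, dotProduct_smul, smul_eq_mul, dotProduct_source] at e3
  simp only [mul_sub, Finset.sum_sub_distrib]
  linear_combination e3

lemma resolvent_mulVec_source {z : ℂ} (hz : IsUnit (S.centralMatrix z).det) (u : C → ℂ) :
    S.centralMatrix z *ᵥ (S.resolvent z *ᵥ S.source u) = S.source u := by
  rw [mulVec_mulVec, resolvent, mul_nonsing_inv _ hz, one_mulVec]

lemma mulVec_source_apply (M : Matrix S.Central S.Central ℂ) (u : C → ℂ) (α : S.Central) :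
    (M *ᵥ S.source u) α = ∑ ν, M α (S.attach ν) * (S.offCoeff ν 0 : ℂ) * u ν := by
  change M α ⬝ᵥ _ = _
  rw [dotProduct_source]
  exact Finset.sum_congr rfl fun ν _ => by ring

end

lemma dotProduct_star_eq (n : Type*) [Fintype n] (x : n → ℂ) :
    x ⬝ᵥ star x = ((∑ i, ‖x i‖ ^ 2 : ℝ) : ℂ) := by
  simp only [dotProduct, Pi.star_apply, Complex.star_def, Complex.mul_conj']
  push_cast; rfl

lemma eq_zero_of_dotProduct_star {n : Type*} [Fintype n] {x : n → ℂ} (h : x ⬝ᵥ star x = 0) :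
    x = 0 := by
  rw [dotProduct_star_eq, Complex.ofReal_eq_zero] at h
  ext i
  simpa using (Finset.sum_eq_zero_iff_of_nonneg fun i _ => by positivity).1 h i (Finset.mem_univ i)

/-- The current of an outgoing solution at a real value of the spectral parameter. -/
lemma wronskian_star_of_real {σ : C} {ω : ℂ} (h : S.ThetaGood σ ω) {x : ℝ} (hx : S.lam ω = x) :
    (S.tail σ).wronskian (fun k => (S.tail σ).jostE k (S.theta σ ω))
      (fun k => (S.tail σ).jostE k (star (S.theta σ ω))) 0 =
      S.bLim σ * (S.theta σ ω - star (S.theta σ ω)) := by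
  rcases im_eq_zero_or_norm_one (S.bLim_pos σ).ne' h.1 (h.2.2.1.trans hx) with h1 | h1
  · have e : star (S.theta σ ω) = S.theta σ ω := Complex.conj_eq_iff_im.2 h1
    rw [e]
    unfold JacobiTail.wronskian
    ring
  · rw [← inv_eq_conj_of_norm_one h1]
    exact (S.tail σ).wronskian_jostE_inv (S.norm_sq_le_rho σ h.2.1)
      (ThetaGood.theta_inv_rho h1) h.1

/-- The Lagrange identity is applied to a decaying Jost solution and its conjugate, so the channel
sum is its squared norm. -/
lemma wronskian_star_of_lt {σ : C} {ω : ℂ} (h : S.ThetaGood σ ω) (hlt : ‖S.theta σ ω‖ < 1) :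
    ∃ t : ℝ, 0 < t ∧ (S.tail σ).wronskian (fun k => (S.tail σ).jostE k (S.theta σ ω))
      (fun k => (S.tail σ).jostE k (star (S.theta σ ω))) 0 = (S.lam ω - star (S.lam ω)) * t := by
  have hr := S.norm_sq_le_rho σ h.2.1
  obtain ⟨t, ht, e⟩ := (S.tail σ).tsum_jostE_conj hr h.1 hlt
  refine ⟨t, ht, ?_⟩
  rw [(S.tail σ).wronskian_jostE hr (by rwa [norm_star]) h.1 (star_ne_zero.2 h.1)
    (by rw [norm_star]; nlinarith [norm_nonneg (S.theta σ ω)]), e, zhukovskii_star]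
  have : zhukovskii (S.tail σ).A (S.tail σ).B (S.theta σ ω) = S.lam ω := h.2.2.1
  rw [this]

lemma lam_im_ne_zero {ω : ℂ} (h1 : ‖ω‖ < 1) (h : ω.im ≠ 0) : (S.lam ω).im ≠ 0 := by
  have h0 : ω ≠ 0 := by rintro rfl; simp at h
  have hp : 0 < Complex.normSq ω := Complex.normSq_pos.2 h0
  have hlt : Complex.normSq ω < 1 := by
    rw [Complex.normSq_eq_norm_sq]; nlinarith [norm_nonneg ω]
  have := (one_lt_inv₀ hp).2 hlt
  rw [lam, zhukovskii_im _ _ h0]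
  exact mul_ne_zero (mul_ne_zero S.b_pos.ne' h) (by linarith)

lemma sub_star_ne_zero {z : ℂ} (h : z.im ≠ 0) : z - star z ≠ 0 := by
  rw [Complex.star_def, Complex.sub_conj]
  simp [h]

variable [Fintype C]

/-- A real symmetric matrix has no nonreal eigenvalues; this is Green's formula without sources, for
a null vector and its conjugate. -/
lemma isUnit_centralMatrix_det {z : ℂ} (h : z.im ≠ 0) : IsUnit (S.centralMatrix z).det := by
  rw [isUnit_iff_ne_zero]
  intro h0
  obtain ⟨v, hv, hv0⟩ := exists_mulVec_eq_zero_iff.2 h0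
  have hs0 : S.source (0 : C → ℂ) = 0 := by simp [source]
  have hs := star_centralMatrix_mulVec S z v
  rw [hv0, star_zero] at hs
  have hg := green (S := S) (u := 0) (u' := 0) (hv0.trans hs0.symm) (hs.symm.trans hs0.symm)
  simp only [Pi.zero_apply, zero_mul, sub_zero, mul_zero, Finset.sum_const_zero] at hg
  have h1 := (mul_eq_zero.1 hg).resolve_left (by
    rw [← neg_sub]; exact neg_ne_zero.2 (sub_star_ne_zero h))
  exact hv (eq_zero_of_dotProduct_star h1)

lemma eventually_forall_thetaGood (S : WebSystem A C) {ω₀ : ℂ} (hω₀ : ‖ω₀‖ = 1) :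
    ∀ᶠ ω in diskNhds ω₀, ∀ σ, S.ThetaGood σ ω :=
  eventually_all.2 fun σ => S.eventually_thetaGood hω₀ σ

variable [DecidableEq C]

lemma isUnit_EMat_det_iff {ω : ℂ} :
    IsUnit (S.EMat 1 ω).det ↔ ∀ σ, S.jost σ 1 (S.theta σ ω) ≠ 0 := by
  rw [EMat, det_diagonal, isUnit_iff_ne_zero, Finset.prod_ne_zero_iff]
  simp

/-- `ℛ B(0) diag(u)` applied to a vector. -/
lemma resolvent_source_attach (z : ℂ) (u : C → ℂ) (σ : C) :
    (S.resolvent z *ᵥ S.source u) (S.attach σ) = ((S.RMat z * S.BZero) *ᵥ u) σ := by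
  rw [mulVec_source_apply]
  simp only [mulVec, dotProduct, BZero, mul_diagonal, RMat, of_apply]

/-- Away from the real axis all inverses in the formula for `U` exist. -/
theorem isRegular_of_nonreal {ω : ℂ} (hg : ∀ σ, S.ThetaGood σ ω) (h1 : ‖ω‖ < 1) (h : ω.im ≠ 0) :
    S.IsRegular ω := by
  have hl := S.lam_im_ne_zero h1 h
  have hne := sub_star_ne_zero hl
  have hcen := S.isUnit_centralMatrix_det hl
  refine ⟨hcen, ?_, ?_⟩
  · rw [isUnit_iff_ne_zero]
    intro h0
    -- A null vector of `T(ω)` gives amplitudes of outgoing waves which match the central solution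
    -- `x` at the attachment points. Together they form a square summable eigenvector with a nonreal
    -- eigenvalue, and Green's formula makes its norm zero.
    obtain ⟨c, hc, hTc⟩ := exists_mulVec_eq_zero_iff.2 h0
    set u₁ : C → ℂ := fun ν => (S.tail ν).jostE 1 (S.theta ν ω) * c ν with hu₁
    set x := S.resolvent (S.lam ω) *ᵥ S.source u₁ with hx
    have hsol := resolvent_mulVec_source hcen u₁
    have hE1 : S.EMat 1 ω *ᵥ c = u₁ := by
      ext ν; simp [EMat, mulVec_diagonal, hu₁, (hg ν).jost_eq]
    have hatt : ∀ ν, x (S.attach ν) = (S.tail ν).jostE 0 (S.theta ν ω) * c ν := by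
      intro ν
      have e := congrFun hTc ν
      rw [TMat, sub_mulVec, ← mulVec_mulVec, hE1] at e
      simp only [Pi.sub_apply, Pi.zero_apply, ← resolvent_source_attach, sub_eq_zero] at e
      rw [hx, ← e, EMat, mulVec_diagonal, (hg ν).jost_eq]
    rw [← hx] at hsol
    have hsol' : S.centralMatrix (star (S.lam ω)) *ᵥ star x = S.source (star u₁) := by
      rw [← star_centralMatrix_mulVec, hsol, star_source]
    have hgreen := green hsol hsol'
    choose t ht hw using fun ν => S.wronskian_star_of_lt (hg ν) ((hg ν).2.2.2 h1)
    have hterm : ∀ ν, (S.offCoeff ν 0 : ℂ) * (u₁ ν * (star x) (S.attach ν) -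
        (star u₁) ν * x (S.attach ν)) = (S.lam ω - star (S.lam ω)) * ((‖c ν‖ ^ 2 * t ν : ℝ) : ℂ) := by
      intro ν
      have e := hw ν
      unfold JacobiTail.wronskian at e
      simp only [JacobiTail.conj_jostE, zero_add] at e
      rw [Pi.star_apply, Pi.star_apply, hatt]
      simp only [hu₁, star_mul']
      have hcc : c ν * star (c ν) = ((‖c ν‖ ^ 2 : ℝ) : ℂ) := by
        rw [Complex.star_def, Complex.mul_conj']; norm_cast
      rw [Complex.ofReal_mul, ← hcc]
      change ((S.tail ν).off 0 : ℂ) * _ = _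
      linear_combination (c ν * star (c ν)) * e
    rw [Finset.sum_congr rfl fun ν _ => hterm ν, ← Finset.mul_sum, dotProduct_star_eq,
      ← Complex.ofReal_sum] at hgreen
    have hsum : (S.lam ω - star (S.lam ω)) *
        (((∑ i, ‖x i‖ ^ 2 : ℝ) : ℂ) + ((∑ ν, ‖c ν‖ ^ 2 * t ν : ℝ) : ℂ)) = 0 := by
      linear_combination (-1 : ℂ) * hgreen
    have h2 := (mul_eq_zero.1 hsum).resolve_left hne
    rw [← Complex.ofReal_add, Complex.ofReal_eq_zero] at h2
    have p1 : 0 ≤ ∑ i, ‖x i‖ ^ 2 := Finset.sum_nonneg fun i _ => by positivity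
    have p2 : ∀ ν, 0 ≤ ‖c ν‖ ^ 2 * t ν := fun ν => mul_nonneg (by positivity) (ht ν).le
    have p3 : 0 ≤ ∑ ν, ‖c ν‖ ^ 2 * t ν := Finset.sum_nonneg fun ν _ => p2 ν
    have p4 : ∑ ν, ‖c ν‖ ^ 2 * t ν = 0 := by linarith
    refine hc (funext fun ν => ?_)
    have p5 := (Finset.sum_eq_zero_iff_of_nonneg fun ν _ => p2 ν).1 p4 ν (Finset.mem_univ ν)
    have p6 := (mul_eq_zero.1 p5).resolve_right (ht ν).ne'
    simpa using p6
  · rw [isUnit_EMat_det_iff]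
    -- A zero of `e_σ(1, θ_σ)` makes the Wronskian with the conjugate vanish at 0, although it is a
    -- nonzero multiple of the squared norm.
    intro σ h0
    rw [(hg σ).jost_eq] at h0
    obtain ⟨t, ht, hw⟩ := S.wronskian_star_of_lt (hg σ) ((hg σ).2.2.2 h1)
    unfold JacobiTail.wronskian at hw
    simp only [JacobiTail.conj_jostE, zero_add, h0, star_zero, zero_mul, mul_zero, sub_zero] at hw
    have := hw.symm
    rw [mul_eq_zero] at this
    rcases this with h2 | h2
    · exact hne h2
    · exact ht.ne' (Complex.ofReal_eq_zero.1 h2)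

variable {S}

/-- The three determinants are meromorphic in the local parameter and do not vanish at the nonreal
points of the open disk near `ω₀`, so their zeros do not accumulate at `ω₀`. -/
theorem eventually_isRegular (S : WebSystem A C) {ω₀ : ℂ} (hω₀ : ‖ω₀‖ = 1) :
    ∀ᶠ ω in diskNhds ω₀, S.IsRegular ω := by
  obtain ⟨m, hm⟩ := S.exists_admissible ω₀
  have hτ := hm.tendsto_tau hω₀
  have hfreq : ∃ᶠ ω in diskNhds ω₀, S.IsRegular ω := by
    refine ((frequently_nonreal hω₀).and_eventually (S.eventually_forall_thetaGood hω₀)).mono ?_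
    rintro ω ⟨⟨h1, h2⟩, h3⟩
    exact S.isRegular_of_nonreal h3 h1 h2
  have e1 := (hm.centralMatrix_mero hω₀).det.eventually_ne_zero hτ
    (hfreq.mono fun ω h => h.1.ne_zero)
  have e2 := (hm.TMat_mero hω₀).det.eventually_ne_zero hτ (hfreq.mono fun ω h => h.2.1.ne_zero)
  have e3 := (hm.EMat_mero hω₀ 1).det.eventually_ne_zero hτ (hfreq.mono fun ω h => h.2.2.ne_zero)
  filter_upwards [e1, e2, e3] with ω h1 h2 h3 using ⟨h1.isUnit, h2.isUnit, h3.isUnit⟩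

end WebSystem
end

/-! ### Incoming and outgoing waves, conservation of the current -/

noncomputable section

open Matrix

lemma Matrix.inv_diagonal_of_ne_zero {n : Type*} [Fintype n] [DecidableEq n] {v : n → ℂ}
    (h : ∀ i, v i ≠ 0) : (diagonal v)⁻¹ = diagonal fun i => (v i)⁻¹ := by
  refine inv_eq_left_inv ?_
  rw [diagonal_mul_diagonal, ← diagonal_one]
  congr 1
  ext i
  exact inv_mul_cancel₀ (h i)

/-- Used for the outgoing currents: terms of one sign cannot cancel, so each of them is controlled
by the total. The sign is that of `t`, later `Im ω`. -/
lemma abs_le_abs_sum_of_same_sign {ι : Type*} [Fintype ι] {f : ι → ℝ} {t : ℝ} (ht : t ≠ 0)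
    (h : ∀ i, 0 ≤ f i * t) (j : ι) : |f j| ≤ |∑ i, f i| := by
  have h1 : f j * t ≤ (∑ i, f i) * t := by
    rw [Finset.sum_mul]
    exact Finset.single_le_sum (fun i _ => h i) (Finset.mem_univ j)
  have h2 := abs_le_abs_of_nonneg (h j) h1
  rw [abs_mul, abs_mul] at h2
  exact le_of_mul_le_mul_right h2 (abs_pos.2 ht)

namespace WebSystem

variable {A C : Type*} {S : WebSystem A C}

lemma isSol_pSol (S : WebSystem A C) (σ : C) (ω : ℂ) :
    (S.tail σ).IsSol (S.lam ω) (S.pSol σ ω) := by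
  intro k
  have : ((S.tail σ).off (k + 1) : ℂ) ≠ 0 := (S.tail σ).off_ne_zero _
  change -(S.offCoeff σ k : ℂ) * S.pSol σ ω k + (S.diagCoeff σ (k + 1) : ℂ) * S.pSol σ ω (k + 1) -
    (S.offCoeff σ (k + 1) : ℂ) * S.pSol σ ω (k + 2) = _
  change (S.offCoeff σ (k + 1) : ℂ) ≠ 0 at this
  rw [pSol]
  field_simp
  ring

/-- The solution `p_σ` in terms of the incoming and outgoing Jost solutions. -/
lemma ThetaGood.pSol_eq {σ : C} {ω : ℂ} (h : S.ThetaGood σ ω)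
    (hr : ‖(S.theta σ ω)⁻¹‖ ^ 2 ≤ (S.tail σ).ρ) (k : ℕ) :
    S.bLim σ * ((S.theta σ ω)⁻¹ - S.theta σ ω) * S.pSol σ ω k = (S.offCoeff σ 0 : ℂ) *
      ((S.tail σ).jostE k (S.theta σ ω) * (S.tail σ).jostE 1 (S.theta σ ω)⁻¹ -
        (S.tail σ).jostE 1 (S.theta σ ω) * (S.tail σ).jostE k (S.theta σ ω)⁻¹) := by
  set J := S.tail σ
  set θ := S.theta σ ω
  have hz : zhukovskii J.A J.B θ = S.lam ω := h.2.2.1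
  have hr0 := S.norm_sq_le_rho σ h.2.1
  have s1 := J.isSol_jostE hr0 h.1
  have s2 := J.isSol_jostE hr (inv_ne_zero h.1)
  rw [zhukovskii_inv] at s2
  rw [hz] at s1 s2
  have s3 := s1.add s2 ((S.offCoeff σ 0 : ℂ) * J.jostE 1 θ⁻¹) (-(S.offCoeff σ 0 : ℂ) * J.jostE 1 θ)
  have s4 := (S.isSol_pSol σ ω).add (S.isSol_pSol σ ω) (S.bLim σ * (θ⁻¹ - θ)) 0
  have hw := J.wronskian_jostE_inv hr0 hr h.1
  unfold JacobiTail.wronskian at hw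
  change (S.offCoeff σ 0 : ℂ) * _ = (S.bLim σ : ℂ) * _ at hw
  have e := s4.eq_of_initial s3 (by simp only [pSol]; linear_combination hw)
    (by simp only [pSol]; ring) k
  linear_combination e

variable [DecidableEq C]

lemma PMat_one (ω : ℂ) : S.PMat 1 ω = 0 := by
  unfold PMat
  simp [pSol]

lemma PMat_zero (ω : ℂ) : S.PMat 0 ω = 1 := by
  unfold PMat
  simp [pSol]

variable [Fintype C]

lemma U_eq_XMat (k : ℕ) (ω : ℂ) : S.U k ω =
    S.EMat k ω * S.XMat ω - S.PMat k ω * (S.BMat * (S.BZero)⁻¹ * S.DMat ω * (S.EMat 1 ω)⁻¹) := by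
  simp only [U, XMat, Matrix.add_mul, Matrix.neg_mul, Matrix.mul_assoc]
  abel

lemma U_one_apply (ω : ℂ) (γ σ : C) :
    S.U 1 ω γ σ = S.jost γ 1 (S.theta γ ω) * S.XMat ω γ σ := by
  rw [U_eq_XMat, PMat_one, Matrix.zero_mul, sub_zero, EMat, diagonal_mul]

/-- The coefficient of the outgoing Jost solution of the channel `γ` in the special solution
`ψ^σ`. -/
def scat (S : WebSystem A C) (γ σ : C) (ω : ℂ) : ℂ :=
  S.XMat ω γ σ - if γ = σ then
    (S.tail σ).jostE 1 (S.theta σ ω)⁻¹ / S.jost σ 1 (S.theta σ ω) else 0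

/-- The incoming part of the special solution `ψ^σ` on the channel `γ`. -/
def incoming (S : WebSystem A C) (γ σ : C) (k : ℕ) (ω : ℂ) : ℂ :=
  if γ = σ then (S.tail σ).jostE k (S.theta σ ω)⁻¹ else 0

/-- The special solution `ψ^σ` on the central part. -/
def centralSol (S : WebSystem A C) (σ : C) (ω : ℂ) : S.Central → ℂ :=
  S.resolvent (S.lam ω) *ᵥ S.source fun ν => S.U 1 ω ν σ

lemma IsRegular.inv_eq {ω : ℂ} (h : S.IsRegular ω) :
    S.BMat * (S.BZero)⁻¹ * S.DMat ω * (S.EMat 1 ω)⁻¹ = diagonal fun σ =>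
      S.bLim σ * (S.offCoeff σ 0 : ℂ)⁻¹ * ((S.theta σ ω)⁻¹ - S.theta σ ω) *
        (S.jost σ 1 (S.theta σ ω))⁻¹ := by
  rw [EMat, inv_diagonal_of_ne_zero (S.isUnit_EMat_det_iff.1 h.2.2), BZero,
    inv_diagonal_of_ne_zero (v := fun σ => (S.offCoeff σ 0 : ℂ)) fun σ => (S.tail σ).off_ne_zero 0, BMat, DMat, diagonal_mul_diagonal,
    diagonal_mul_diagonal, diagonal_mul_diagonal]

/-- The special solution on the channels as a sum of incoming and outgoing Jost solutions. -/
lemma U_apply {ω : ℂ} (h : S.IsRegular ω) (hg : ∀ γ, S.ThetaGood γ ω) {σ : C}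
    (hr : ‖(S.theta σ ω)⁻¹‖ ^ 2 ≤ (S.tail σ).ρ) (k : ℕ) (γ : C) :
    S.U k ω γ σ = S.incoming γ σ k ω + S.scat γ σ ω * (S.tail γ).jostE k (S.theta γ ω) := by
  rw [U_eq_XMat, h.inv_eq, PMat, EMat, diagonal_mul_diagonal, Matrix.sub_apply, diagonal_mul,
    (hg γ).jost_eq]
  unfold incoming scat
  by_cases hγ : γ = σ
  · subst hγ
    have hp := (hg γ).pSol_eq hr k
    have h1 : (S.tail γ).jostE 1 (S.theta γ ω) ≠ 0 := by
      rw [← (hg γ).jost_eq]; exact S.isUnit_EMat_det_iff.1 h.2.2 γ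
    have h2 : (S.offCoeff γ 0 : ℂ) ≠ 0 := (S.tail γ).off_ne_zero 0
    rw [diagonal_apply_eq, if_pos rfl, if_pos rfl, (hg γ).jost_eq]
    -- The summand with `p_σ` produces the incoming wave and a multiple of the outgoing one; that
    -- multiple is the correction subtracted in `scat`.
    have e : S.pSol γ ω k * (S.bLim γ * (S.offCoeff γ 0 : ℂ)⁻¹ *
        ((S.theta γ ω)⁻¹ - S.theta γ ω) * ((S.tail γ).jostE 1 (S.theta γ ω))⁻¹) =
        ((S.tail γ).jostE k (S.theta γ ω) * (S.tail γ).jostE 1 (S.theta γ ω)⁻¹ -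
        (S.tail γ).jostE 1 (S.theta γ ω) * (S.tail γ).jostE k (S.theta γ ω)⁻¹) /
          (S.tail γ).jostE 1 (S.theta γ ω) := by
      rw [eq_div_iff h1]
      have e1 : S.pSol γ ω k * (S.bLim γ * (S.offCoeff γ 0 : ℂ)⁻¹ *
        ((S.theta γ ω)⁻¹ - S.theta γ ω) * ((S.tail γ).jostE 1 (S.theta γ ω))⁻¹) *
          (S.tail γ).jostE 1 (S.theta γ ω) =
          (S.offCoeff γ 0 : ℂ)⁻¹ * (S.bLim γ * ((S.theta γ ω)⁻¹ - S.theta γ ω) * S.pSol γ ω k) *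
          (((S.tail γ).jostE 1 (S.theta γ ω))⁻¹ * (S.tail γ).jostE 1 (S.theta γ ω)) := by ring
      rw [e1, hp, inv_mul_cancel₀ h1, mul_one, ← mul_assoc, inv_mul_cancel₀ h2, one_mul]
    rw [e, sub_div, mul_div_assoc, mul_div_cancel_left₀ _ h1]
    ring
  · rw [diagonal_apply_ne _ hγ, if_neg hγ, if_neg hγ]
    ring

lemma centralSol_spec {ω : ℂ} (h : S.IsRegular ω) (σ : C) :
    S.centralMatrix (S.lam ω) *ᵥ S.centralSol σ ω = S.source fun ν => S.U 1 ω ν σ :=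
  resolvent_mulVec_source h.1 _

/-- The central and the channel descriptions agree at the attachment points. This is the identity `ℛ
B(0) ℰ(1) = ℰ(0) - T`, combined with the initial values of `p_σ`. -/
lemma centralSol_attach {ω : ℂ} (h : S.IsRegular ω) (σ γ : C) :
    S.centralSol σ ω (S.attach γ) = S.U 0 ω γ σ := by
  unfold centralSol
  rw [resolvent_source_attach]
  have e1 : (fun ν => S.U 1 ω ν σ) = (S.U 1 ω).col σ := rfl
  have e2 : S.U 0 ω = S.RMat (S.lam ω) * S.BZero * S.U 1 ω := by
    rw [U_eq_XMat, U_eq_XMat, PMat_one, PMat_zero, Matrix.zero_mul, sub_zero, Matrix.one_mul,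
      ← Matrix.mul_assoc]
    have e3 : S.RMat (S.lam ω) * S.BZero * S.EMat 1 ω = S.EMat 0 ω - S.TMat ω := by
      rw [TMat, sub_sub_cancel]
    have e4 : S.TMat ω * S.XMat ω = S.BMat * (S.BZero)⁻¹ * S.DMat ω * (S.EMat 1 ω)⁻¹ := by
      simp only [XMat, ← Matrix.mul_assoc]
      rw [mul_nonsing_inv _ h.2.1, Matrix.one_mul]
    rw [e3, Matrix.sub_mul, e4]
  rw [e2]
  rfl

/-- Conservation of the current on the unit circle bounds the outgoing amplitudes. -/
lemma current_bound {ω : ℂ} (h : S.IsRegular ω) (hω : ‖ω‖ = 1) (him : ω.im ≠ 0) {σ : C}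
    (hr : ‖(S.theta σ ω)⁻¹‖ ^ 2 ≤ (S.tail σ).ρ) (γ : C) :
    ‖S.scat γ σ ω‖ ^ 2 * S.bLim γ * (2 * |(S.theta γ ω).im|) ≤ S.bLim σ * 2 +
      2 * ‖S.scat σ σ ω‖ * S.bLim σ *
        (if (S.theta σ ω).im = 0 then ‖S.theta σ ω - (S.theta σ ω)⁻¹‖ else 0) := by
  have hg : ∀ γ, S.ThetaGood γ ω := fun γ => S.thetaGood_of_norm_one γ hω
  obtain ⟨x, hx⟩ : ∃ x : ℝ, S.lam ω = x := ⟨_, zhukovskii_of_norm_one S.a S.b hω⟩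
  have hsol := centralSol_spec h σ
  have hsol' : S.centralMatrix (S.lam ω) *ᵥ star (S.centralSol σ ω) =
      S.source (star fun ν => S.U 1 ω ν σ) := by
    rw [← star_source, ← hsol, star_centralMatrix_mulVec, hx, Complex.star_def, Complex.conj_ofReal]
  have hgreen := green hsol hsol'
  rw [sub_self, zero_mul] at hgreen
  -- `R ν` is the current through the channel `ν`, and `main ν` is the part due to its outgoing wave
  -- alone. They differ only for `ν = σ`.
  set R : C → ℂ := fun ν => (S.offCoeff ν 0 : ℂ) * (S.U 1 ω ν σ * star (S.centralSol σ ω)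
    (S.attach ν) - (star fun ν => S.U 1 ω ν σ) ν * S.centralSol σ ω (S.attach ν)) with hR
  set main : C → ℂ := fun ν => ((‖S.scat ν σ ω‖ ^ 2 * S.bLim ν : ℝ) : ℂ) *
    (S.theta ν ω - star (S.theta ν ω)) with hmain
  have hbσ := S.bLim_pos σ
  set δ : ℝ := if (S.theta σ ω).im = 0 then ‖S.theta σ ω - (S.theta σ ω)⁻¹‖ else 0 with hδ
  have hcc : ∀ c : ℂ, c * star c = ((‖c‖ ^ 2 : ℝ) : ℂ) := fun c => by
    rw [Complex.star_def, Complex.mul_conj']; norm_cast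
  have hne : ∀ ν, ν ≠ σ → R ν = main ν := by
    intro ν hν
    have hw := wronskian_star_of_real S (hg ν) hx
    unfold JacobiTail.wronskian at hw
    simp only [JacobiTail.conj_jostE, zero_add] at hw
    simp only [hR, hmain, Pi.star_apply, centralSol_attach h, U_apply h hg hr, incoming, if_neg hν,
      zero_add, star_mul']
    rw [Complex.ofReal_mul, ← hcc]
    change ((S.tail ν).off 0 : ℂ) * _ = _
    linear_combination (S.scat ν σ ω * star (S.scat ν σ ω)) * hw
  have hself : ‖R σ - main σ‖ ≤ S.bLim σ * 2 + 2 * ‖S.scat σ σ ω‖ * S.bLim σ * δ := by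
    have hU : ∀ k, S.U k ω σ σ = (S.tail σ).jostE k (S.theta σ ω)⁻¹ +
        S.scat σ σ ω * (S.tail σ).jostE k (S.theta σ ω) := fun k => by
      rw [U_apply h hg hr, incoming, if_pos rfl]
    set c := S.scat σ σ ω
    rcases im_eq_zero_or_norm_one hbσ.ne' (hg σ).1 ((hg σ).2.2.1.trans hx) with h1 | h1
    -- Here `θ_σ` is real, as can happen on the circle beyond the end of the arc. Both waves are
    -- real, and only the interference term survives, with the factor `θ_σ - θ_σ⁻¹`.
    · have e0 : star (S.theta σ ω) = S.theta σ ω := Complex.conj_eq_iff_im.2 h1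
      have e1 : ∀ k, star ((S.tail σ).jostE k (S.theta σ ω)) = (S.tail σ).jostE k (S.theta σ ω) :=
        fun k => by rw [← JacobiTail.conj_jostE, e0]
      have e2 : ∀ k, star ((S.tail σ).jostE k (S.theta σ ω)⁻¹) =
          (S.tail σ).jostE k (S.theta σ ω)⁻¹ := fun k => by
        rw [← JacobiTail.conj_jostE, star_inv₀, e0]
      have hw := (S.tail σ).wronskian_jostE_inv (S.norm_sq_le_rho σ (hg σ).2.1) hr (hg σ).1
      unfold JacobiTail.wronskian at hw
      have e3 : R σ - main σ = (c - star c) * (S.bLim σ * (S.theta σ ω - (S.theta σ ω)⁻¹)) := by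
        simp only [hR, hmain, Pi.star_apply, centralSol_attach h, hU, star_add, star_mul', e1, e2, e0]
        change ((S.tail σ).off 0 : ℂ) * _ - _ = (c - star c) * (((S.tail σ).B : ℂ) * _)
        linear_combination (c - star c) * hw
      have hδ' : δ = ‖S.theta σ ω - (S.theta σ ω)⁻¹‖ := by rw [hδ, if_pos h1]
      rw [e3, norm_mul, norm_mul, Complex.norm_real, Real.norm_of_nonneg hbσ.le, ← hδ']
      have h2 : ‖c - star c‖ ≤ 2 * ‖c‖ := by
        have := norm_sub_le c (star c)
        rw [norm_star] at this
        linarith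
      have h3 : 0 ≤ S.bLim σ * δ := by rw [hδ']; positivity
      nlinarith
    -- Here `θ_σ` is unimodular, so the incoming wave is the conjugate of the outgoing one. The
    -- interference terms cancel and the incoming current remains.
    · have hw := wronskian_star_of_real S (hg σ) hx
      unfold JacobiTail.wronskian at hw
      simp only [JacobiTail.conj_jostE, zero_add] at hw
      have e1 : ∀ k, (S.tail σ).jostE k (S.theta σ ω)⁻¹ =
          star ((S.tail σ).jostE k (S.theta σ ω)) := fun k => by
        rw [inv_eq_conj_of_norm_one h1, JacobiTail.conj_jostE]
      have e3 : R σ - main σ = -(S.bLim σ * (S.theta σ ω - star (S.theta σ ω))) := by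
        simp only [hR, hmain, Pi.star_apply, centralSol_attach h, hU, star_add, star_mul', e1,
          star_star]
        rw [Complex.ofReal_mul, ← hcc]
        change ((S.tail σ).off 0 : ℂ) * _ - _ = _
        linear_combination (c * star c - 1) * hw
      have hδ0 : 0 ≤ δ := by rw [hδ]; split_ifs <;> positivity
      rw [e3, norm_neg, norm_mul, Complex.norm_real, Real.norm_of_nonneg hbσ.le]
      have h2 : ‖S.theta σ ω - star (S.theta σ ω)‖ ≤ 2 := by
        have := norm_sub_le (S.theta σ ω) (star (S.theta σ ω))
        rw [norm_star, h1] at this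
        linarith
      have h3 : 0 ≤ 2 * ‖c‖ * S.bLim σ * δ := by positivity
      nlinarith
  have hsum : ∑ ν, main ν = -(R σ - main σ) := by
    have e1 : ∑ ν, R ν = 0 := hgreen.symm
    have e2 : ∑ ν, (R ν - main ν) = R σ - main σ :=
      Finset.sum_eq_single σ (fun ν _ hν => by rw [hne ν hν, sub_self]) (by simp)
    rw [Finset.sum_sub_distrib, e1] at e2
    linear_combination (-1 : ℂ) * e2
  set f : C → ℝ := fun ν => ‖S.scat ν σ ω‖ ^ 2 * S.bLim ν * (2 * (S.theta ν ω).im) with hf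
  have hmf : ∀ ν, main ν = (f ν : ℂ) * Complex.I := fun ν => by
    simp only [hmain, hf, Complex.star_def, Complex.sub_conj]
    push_cast; ring
  have hnorm : |∑ ν, f ν| = ‖R σ - main σ‖ := by
    rw [← norm_neg, ← hsum, Finset.sum_congr rfl fun ν _ => hmf ν, ← Finset.sum_mul, norm_mul,
      Complex.norm_I, mul_one, ← Complex.ofReal_sum, Complex.norm_real, Real.norm_eq_abs]
  have hsign : ∀ ν, 0 ≤ f ν * ω.im := fun ν => by
    have h1 := (S.theta_spec ν hω).2.2.2.1
    have hb := S.bLim_pos ν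
    have : f ν * ω.im = ‖S.scat ν σ ω‖ ^ 2 * S.bLim ν * 2 * ((S.theta ν ω).im * ω.im) := by
      simp only [hf]; ring
    rw [this]; positivity
  have hj := abs_le_abs_sum_of_same_sign him hsign γ
  rw [hnorm] at hj
  have hbγ := S.bLim_pos γ
  have : |f γ| = ‖S.scat γ σ ω‖ ^ 2 * S.bLim γ * (2 * |(S.theta γ ω).im|) := by
    simp only [hf]
    rw [abs_mul, abs_of_nonneg (by positivity), abs_mul, abs_two]
  rw [← this]
  exact hj.trans hself

end WebSystem
end

/-! ### The leading coefficient at a pole vanishes -/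

noncomputable section

open Matrix

namespace WebSystem

variable {A C : Type*} {S : WebSystem A C} {m : ℕ} {ω₀ : ℂ}

lemma eventually_inv_rho {σ : C} (hσ : ω₀ ∈ S.TPlus σ) :
    ∀ᶠ ω in diskNhds ω₀, ‖(S.theta σ ω)⁻¹‖ ^ 2 ≤ (S.tail σ).ρ := by
  have h1 := (((tendsto_theta S hσ.1 σ).inv₀ (S.theta_spec σ hσ.1).1).norm).pow 2
  rw [norm_inv, hσ.2, inv_one, one_pow] at h1
  exact (h1.eventually_lt_const (S.tail σ).one_lt).mono fun _ h => h.le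

/-- Off the points of `𝕋` where `θ_σ = ±1`, the function `θ_σ - θ_σ⁻¹` is small where `θ_σ` is
real. -/
lemma tendsto_real_theta {σ : C} (hσ : ω₀ ∈ S.TPlus σ) :
    Tendsto (fun ω => if (S.theta σ ω).im = 0 then ‖S.theta σ ω - (S.theta σ ω)⁻¹‖ else 0)
      (diskNhds ω₀) (𝓝 0) := by
  have ht := tendsto_theta S hσ.1 σ
  by_cases h : (S.theta σ ω₀).im = 0
  · have h1 : S.theta σ ω₀ - (S.theta σ ω₀)⁻¹ = 0 := by
      rw [inv_eq_conj_of_norm_one hσ.2, Complex.star_def, Complex.conj_eq_iff_im.2 h, sub_self]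
    have h2 := (ht.sub (ht.inv₀ (S.theta_spec σ hσ.1).1)).norm
    rw [h1, norm_zero] at h2
    refine squeeze_zero (fun ω => ?_) (fun ω => ?_) h2
    · split_ifs <;> positivity
    · split_ifs
      · exact le_rfl
      · positivity
  · have h2 : ∀ᶠ ω in diskNhds ω₀, (S.theta σ ω).im ≠ 0 :=
      ((Complex.continuous_im.tendsto _).comp ht).eventually_ne h
    refine (tendsto_const_nhds (x := (0 : ℝ))).congr' ?_
    filter_upwards [h2] with ω hω
    rw [if_neg hω]

lemma eventually_im_ne_zero :
    ∀ᶠ ω in diskNhds ω₀, ‖ω‖ = 1 → ω.im ≠ 0 := by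
  have h : ∀ c : ℂ, ∀ᶠ ω in diskNhds ω₀, ω ≠ c := by
    intro c
    by_cases hc : ω₀ = c
    · subst hc
      exact (eventually_norm_le ω₀).mono fun _ h => h.2
    · exact nhdsWithin_le_nhds (isOpen_ne.mem_nhds hc)
  filter_upwards [h 1, h (-1)] with ω h1 h2 h3 h4
  have h5 : ω.re ^ 2 = 1 := by
    have := Complex.normSq_eq_norm_sq ω
    rw [Complex.normSq_apply, h3, h4] at this
    linarith
  rcases sq_eq_one_iff.1 h5 with h6 | h6
  · exact h1 (Complex.ext h6 h4)
  · exact h2 (Complex.ext (by simpa using h6) (by simpa using h4))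

variable [Fintype C] [DecidableEq C]

/-- The leading coefficients, at a pole of order `n`, of a special solution. -/
structure IsLeading (S : WebSystem A C) (m : ℕ) (ω₀ : ℂ) (σ : C) (n : ℕ) (c : C → ℂ)
    (x : S.Central → ℂ) : Prop where
  admissible : S.Admissible m ω₀
  mem : ω₀ ∈ S.TPlus σ
  order_ne : n ≠ 0
  scat : ∀ γ, Tendsto (fun ω => tau m ω₀ ω ^ n * S.scat γ σ ω) (diskNhds ω₀) (𝓝 (c γ))
  central : ∀ α, Tendsto (fun ω => tau m ω₀ ω ^ n * S.centralSol σ ω α) (diskNhds ω₀) (𝓝 (x α))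

namespace IsLeading

variable {σ : C} {n : ℕ} {c : C → ℂ} {x : S.Central → ℂ}

lemma tendsto_tau_zero (h : S.IsLeading m ω₀ σ n c x) :
    Tendsto (tau m ω₀) (diskNhds ω₀) (𝓝 0) :=
  (h.admissible.tendsto_tau h.mem.1).mono_right nhdsWithin_le_nhds

/-- Where the channel is open, the leading coefficient vanishes. -/
lemma eq_zero_of_open (h : S.IsLeading m ω₀ σ n c x) {γ : C} (hγ : ω₀ ∈ S.TPlus γ) : c γ = 0 := by
  have hω₀ := h.mem.1
  have hτ := h.tendsto_tau_zero
  obtain ⟨κ, hκ, hκev⟩ := h.admissible.theta_inv_sub hω₀ γ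
  obtain ⟨p, rfl⟩ := Nat.exists_eq_succ_of_ne_zero h.order_ne
  have hbγ := S.bLim_pos γ
  have hbσ := S.bLim_pos σ
  set δ : ℂ → ℝ := fun ω =>
    if (S.theta σ ω).im = 0 then ‖S.theta σ ω - (S.theta σ ω)⁻¹‖ else 0 with hδ
  -- This is the right side of the current bound times `‖τ‖ ^ (2p + 1)`, where `n = p + 1`. One
  -- power fewer than `2n` is enough, since `|Im θ_γ|` supplies the missing one. For a simple pole,
  -- `p = 0`, the second summand is small only because the real values of `θ_σ` are close to `±1`.
  set G : ℂ → ℝ := fun ω => ‖tau m ω₀ ω‖ * (‖tau m ω₀ ω‖ ^ p * ‖tau m ω₀ ω‖ ^ p) * (S.bLim σ * 2) +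
    ‖tau m ω₀ ω‖ ^ p * (2 * ‖tau m ω₀ ω ^ (p + 1) * S.scat σ σ ω‖ * S.bLim σ * δ ω) with hG
  have hG0 : Tendsto G (diskNhds ω₀) (𝓝 0) := by
    have hn : Tendsto (fun ω => ‖tau m ω₀ ω‖) (diskNhds ω₀) (𝓝 0) := by simpa using hτ.norm
    have t1 := (hn.mul ((hn.pow p).mul (hn.pow p))).mul_const (S.bLim σ * 2)
    have t2 := (hn.pow p).mul (((((h.scat σ).norm).const_mul 2).mul_const (S.bLim σ)).mul
      (tendsto_real_theta h.mem))
    have := t1.add t2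
    simpa only [zero_mul, mul_zero, add_zero] using this
  have hL : Tendsto (fun ω => ‖tau m ω₀ ω ^ (p + 1) * S.scat γ σ ω‖ ^ 2 * S.bLim γ * κ)
      (diskNhds ω₀) (𝓝 (‖c γ‖ ^ 2 * S.bLim γ * κ)) :=
    ((((h.scat γ).norm.pow 2).mul_const _).mul_const _)
  -- The bound is available only on `T_γ⁺`, but the limit exists along the whole disk, so points of
  -- the arc accumulating at `ω₀` are enough.
  have hfreq : ∃ᶠ ω in diskNhds ω₀, ω ∈ S.TPlus γ := by
    have h1 := S.frequently_mem_TPlus hγ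
    rw [frequently_nhdsWithin_iff] at h1 ⊢
    refine h1.mono fun ω hω => ⟨hω.1, ?_, hω.2⟩
    simp [hω.1.1]
  have hle : ∃ᶠ ω in diskNhds ω₀,
      ‖tau m ω₀ ω ^ (p + 1) * S.scat γ σ ω‖ ^ 2 * S.bLim γ * κ ≤ G ω := by
    have hne : ∀ᶠ ω in diskNhds ω₀, tau m ω₀ ω ≠ 0 :=
      (h.admissible.tendsto_tau hω₀).eventually self_mem_nhdsWithin
    refine (hfreq.and_eventually ((S.eventually_isRegular hω₀).and (eventually_im_ne_zero.and
      ((eventually_inv_rho h.mem).and (hκev.and hne))))).mono ?_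
    rintro ω ⟨hT, hreg, him, hrho, hk, ht0⟩
    have hb := current_bound hreg hT.1 (him hT.1) hrho γ
    have hth : κ * ‖tau m ω₀ ω‖ ≤ 2 * |(S.theta γ ω).im| := by
      refine hk.trans (le_of_eq ?_)
      rw [inv_eq_conj_of_norm_one hT.2, norm_sub_rev, Complex.star_def, Complex.sub_conj, norm_mul,
        Complex.norm_I, mul_one, Complex.norm_real, Real.norm_eq_abs, abs_mul, abs_two]
    set t := ‖tau m ω₀ ω‖ with htdef
    have htp : 0 < t := norm_pos_iff.2 ht0
    have hb2 : ‖S.scat γ σ ω‖ ^ 2 * S.bLim γ * (κ * t) ≤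
        S.bLim σ * 2 + 2 * ‖S.scat σ σ ω‖ * S.bLim σ * δ ω :=
      le_trans (mul_le_mul_of_nonneg_left hth (by positivity)) hb
    have hb3 := mul_le_mul_of_nonneg_left hb2 (show 0 ≤ t ^ (2 * p + 1) by positivity)
    have e1 : ‖tau m ω₀ ω ^ (p + 1) * S.scat γ σ ω‖ ^ 2 * S.bLim γ * κ =
        t ^ (2 * p + 1) * (‖S.scat γ σ ω‖ ^ 2 * S.bLim γ * (κ * t)) := by
      rw [norm_mul, norm_pow, ← htdef]; ring
    have e2 : G ω = t ^ (2 * p + 1) * (S.bLim σ * 2 + 2 * ‖S.scat σ σ ω‖ * S.bLim σ * δ ω) := by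
      simp only [hG]
      rw [norm_mul, norm_pow, ← htdef]; ring
    rw [e1, e2]
    exact hb3
  have hfin : ‖c γ‖ ^ 2 * S.bLim γ * κ ≤ 0 := le_of_tendsto_of_tendsto_of_frequently hL hG0 hle
  by_contra hc
  have : 0 < ‖c γ‖ ^ 2 * S.bLim γ * κ := by positivity
  linarith

/-- The incoming wave has a finite limit, which the factor `τ ^ n` with `n ≠ 0` annihilates; the
leading part is purely outgoing. -/
lemma tendsto_U (h : S.IsLeading m ω₀ σ n c x) (k : ℕ) (γ : C) :
    Tendsto (fun ω => tau m ω₀ ω ^ n * S.U k ω γ σ) (diskNhds ω₀)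
      (𝓝 (c γ * (S.tail γ).jostE k (S.theta γ ω₀))) := by
  have hω₀ := h.mem.1
  have hp : Tendsto (fun ω => tau m ω₀ ω ^ n) (diskNhds ω₀) (𝓝 0) := by
    simpa [h.order_ne] using h.tendsto_tau_zero.pow n
  have hinc : ∃ a, Tendsto (S.incoming γ σ k) (diskNhds ω₀) (𝓝 a) := by
    by_cases hγ : γ = σ
    · subst hγ
      obtain ⟨a, ha⟩ := (h.admissible.jostE_inv_analytic h.mem k).exists_tendsto
        (h.admissible.tendsto_tau hω₀)
      exact ⟨a, ha.congr fun ω => by rw [incoming, if_pos rfl]⟩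
    · exact ⟨0, tendsto_const_nhds.congr fun ω => by rw [incoming, if_neg hγ]⟩
  obtain ⟨a, ha⟩ := hinc
  have he : Tendsto (fun ω => (S.tail γ).jostE k (S.theta γ ω)) (diskNhds ω₀)
      (𝓝 ((S.tail γ).jostE k (S.theta γ ω₀))) :=
    ((S.tail γ).analyticAt_jostE (S.norm_sq_lt_rho γ (S.theta_spec γ hω₀).2.1)
      k).continuousAt.tendsto.comp (tendsto_theta S hω₀ γ)
  have hlim := (hp.mul ha).add ((h.scat γ).mul he)
  rw [zero_mul, zero_add] at hlim
  refine hlim.congr' ?_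
  filter_upwards [S.eventually_isRegular hω₀, S.eventually_forall_thetaGood hω₀,
    eventually_inv_rho h.mem] with ω h1 h2 h3
  rw [U_apply h1 h2 h3]
  ring

lemma source_eq (h : S.IsLeading m ω₀ σ n c x) : S.centralMatrix (S.lam ω₀) *ᵥ x =
    S.source fun ν => c ν * (S.tail ν).jostE 1 (S.theta ν ω₀) := by
  have hω₀ := h.mem.1
  have := diskNhds_neBot hω₀
  ext α
  have hL : Tendsto (fun ω => tau m ω₀ ω ^ n * (S.centralMatrix (S.lam ω) *ᵥ S.centralSol σ ω) α)
      (diskNhds ω₀) (𝓝 ((S.centralMatrix (S.lam ω₀) *ᵥ x) α)) := by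
    simp only [mulVec, dotProduct, Finset.mul_sum]
    refine tendsto_finsetSum _ fun β _ => ?_
    have hM : Tendsto (fun ω => S.centralMatrix (S.lam ω) α β) (diskNhds ω₀)
        (𝓝 (S.centralMatrix (S.lam ω₀) α β)) := by
      simp only [centralMatrix, Matrix.sub_apply, Matrix.smul_apply, smul_eq_mul, Matrix.of_apply]
      exact ((tendsto_lam S hω₀).mul_const _).const_sub _
    refine (hM.mul (h.central β)).congr fun ω => by ring
  have hR : Tendsto (fun ω => tau m ω₀ ω ^ n * (S.source fun ν => S.U 1 ω ν σ) α) (diskNhds ω₀)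
      (𝓝 ((S.source fun ν => c ν * (S.tail ν).jostE 1 (S.theta ν ω₀)) α)) := by
    have e : ∀ u : C → ℂ, S.source u α =
        ∑ ν, (1 : Matrix S.Central S.Central ℂ) α (S.attach ν) * (S.offCoeff ν 0 : ℂ) * u ν :=
      fun u => by rw [← mulVec_source_apply, one_mulVec]
    simp only [e, Finset.mul_sum]
    refine tendsto_finsetSum _ fun ν _ => ?_
    exact ((h.tendsto_U 1 ν).const_mul _).congr fun ω => by ring
  refine tendsto_nhds_unique hL (hR.congr' ?_)
  filter_upwards [S.eventually_isRegular hω₀] with ω hω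
  rw [centralSol_spec hω]

lemma attach_eq (h : S.IsLeading m ω₀ σ n c x) (γ : C) :
    x (S.attach γ) = c γ * (S.tail γ).jostE 0 (S.theta γ ω₀) := by
  have := diskNhds_neBot h.mem.1
  refine tendsto_nhds_unique (h.central (S.attach γ)) ((h.tendsto_U 0 γ).congr' ?_)
  filter_upwards [S.eventually_isRegular h.mem.1] with ω hω
  rw [centralSol_attach hω]

/-- A special solution is orthogonal to its leading coefficient, on the channel `γ`. -/
lemma channel_term (h : S.IsLeading m ω₀ σ n c x) (γ : C) : ∃ (q : ℂ → ℂ) (r : ℝ), 0 ≤ r ∧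
    (r = 0 → c γ = 0) ∧ Tendsto (fun ω => tau m ω₀ ω ^ n * q ω) (diskNhds ω₀) (𝓝 (r : ℂ)) ∧
    ∀ᶠ ω in diskNhds ω₀, (S.offCoeff γ 0 : ℂ) * (S.U 1 ω γ σ * star (x (S.attach γ)) -
      star (c γ * (S.tail γ).jostE 1 (S.theta γ ω₀)) * S.centralSol σ ω (S.attach γ)) =
        (S.lam ω - S.lam ω₀) * q ω := by
  have hω₀ := h.mem.1
  by_cases hγ : ω₀ ∈ S.TPlus γ
  · have hc := h.eq_zero_of_open hγ
    refine ⟨fun _ => 0, 0, le_rfl, fun _ => hc, by simpa using tendsto_const_nhds, Eventually.of_forall fun ω => ?_⟩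
    rw [h.attach_eq, hc]; simp
  -- The channel `γ` is closed at `ω₀`, whereas `σ` is open. So there is no incoming wave on `γ`,
  -- and the boundary term is the Wronskian of `e_γ(k, θ_γ(ω))` with a decaying conjugate Jost
  -- solution.
  · have hne : γ ≠ σ := by rintro rfl; exact hγ h.mem
    obtain ⟨hθ0, hθ1, hθz, _⟩ := S.theta_spec γ hω₀
    have hlt : ‖S.theta γ ω₀‖ < 1 := lt_of_le_of_ne hθ1 fun e => hγ ⟨hω₀, e⟩
    have hr := S.norm_sq_le_rho γ hθ1
    have hr' : ‖star (S.theta γ ω₀)‖ ^ 2 ≤ (S.tail γ).ρ := by rwa [norm_star]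
    have hll : ‖S.theta γ ω₀‖ * ‖star (S.theta γ ω₀)‖ < 1 := by
      rw [norm_star]; nlinarith [norm_nonneg (S.theta γ ω₀)]
    obtain ⟨t, ht, hts⟩ := (S.tail γ).tsum_jostE_conj hr hθ0 hlt
    have htend := tendsto_theta S hω₀ γ
    have hgood := S.eventually_forall_thetaGood hω₀
    have hsum := (S.tail γ).tendsto_tsum_jostE htend
      (hgood.mono fun ω hω => S.norm_sq_le_rho γ (hω γ).2.1) (S.norm_sq_lt_rho γ hθ1) hr' hll
    rw [hts] at hsum
    have hlims : ∀ᶠ ω in diskNhds ω₀, ‖S.theta γ ω‖ * ‖star (S.theta γ ω₀)‖ < 1 :=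
      (htend.norm.mul_const _).eventually_lt_const hll
    refine ⟨fun ω => star (c γ) * S.scat γ σ ω *
      ∑' k, (S.tail γ).jostE (k + 1) (S.theta γ ω) * (S.tail γ).jostE (k + 1) (star (S.theta γ ω₀)),
      ‖c γ‖ ^ 2 * t, by positivity, fun e => ?_, ?_, ?_⟩
    · have := (mul_eq_zero.1 e).resolve_right ht.ne'
      simpa using this
    · have h1 := (((h.scat γ).const_mul (star (c γ))).mul hsum)
      have e : star (c γ) * c γ * (t : ℂ) = ((‖c γ‖ ^ 2 * t : ℝ) : ℂ) := by
        rw [Complex.star_def, Complex.conj_mul']; push_cast; ring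
      rw [e] at h1
      exact h1.congr fun ω => by ring
    · filter_upwards [S.eventually_isRegular hω₀, hgood, eventually_inv_rho h.mem, hlims]
        with ω h1 h2 h3 h4
      have hw := (S.tail γ).wronskian_jostE (S.norm_sq_le_rho γ (h2 γ).2.1) hr' (h2 γ).1
        (star_ne_zero.2 hθ0) h4
      have e1 : zhukovskii (S.tail γ).A (S.tail γ).B (S.theta γ ω) = S.lam ω := (h2 γ).2.2.1
      have e2 : zhukovskii (S.tail γ).A (S.tail γ).B (star (S.theta γ ω₀)) = S.lam ω₀ := by
        have e3 : zhukovskii (S.tail γ).A (S.tail γ).B (S.theta γ ω₀) = S.lam ω₀ := hθz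
        rw [zhukovskii_star, e3, lam, zhukovskii_of_norm_one _ _ hω₀, Complex.star_def,
          Complex.conj_ofReal]
      rw [e1, e2] at hw
      unfold JacobiTail.wronskian at hw
      simp only [zero_add] at hw
      rw [centralSol_attach h1, U_apply h1 h2 h3, U_apply h1 h2 h3, h.attach_eq]
      simp only [incoming, if_neg hne, zero_add, star_mul', ← JacobiTail.conj_jostE]
      change ((S.tail γ).off 0 : ℂ) * _ = _
      linear_combination (star (c γ) * S.scat γ σ ω) * hw

/-- The leading coefficients of a special solution vanish. -/
theorem eq_zero (h : S.IsLeading m ω₀ σ n c x) : c = 0 ∧ x = 0 := by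
  have hω₀ := h.mem.1
  have := diskNhds_neBot hω₀
  choose q r hr hr0 hq hev using h.channel_term
  have hreal : star (S.lam ω₀) = S.lam ω₀ := by
    rw [lam, zhukovskii_of_norm_one _ _ hω₀, Complex.star_def, Complex.conj_ofReal]
  have hsol' : S.centralMatrix (S.lam ω₀) *ᵥ star x =
      S.source (star fun ν => c ν * (S.tail ν).jostE 1 (S.theta ν ω₀)) := by
    rw [← star_source, ← h.source_eq, star_centralMatrix_mulVec, hreal]
  -- Orthogonality of `ψ^σ(ω)` to the bound state: the common factor `λ(ω) - λ(ω₀)` is nonzero for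
  -- `ω` near `ω₀` and cancels.
  have horth : ∀ᶠ ω in diskNhds ω₀,
      tau m ω₀ ω ^ n * (S.centralSol σ ω ⬝ᵥ star x) + ∑ ν, tau m ω₀ ω ^ n * q ν ω = 0 := by
    filter_upwards [S.eventually_isRegular hω₀, S.eventually_lam_ne hω₀, eventually_all.2 hev]
      with ω h1 h2 h3
    have hg := green (centralSol_spec h1 σ) hsol'
    simp only [Pi.star_apply] at hg
    rw [Finset.sum_congr rfl fun ν _ => h3 ν, ← Finset.mul_sum] at hg
    have h4 : (S.lam ω - S.lam ω₀) * (S.centralSol σ ω ⬝ᵥ star x + ∑ ν, q ν ω) = 0 := by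
      linear_combination (-1 : ℂ) * hg
    have h5 := (mul_eq_zero.1 h4).resolve_left (sub_ne_zero.2 h2)
    rw [← Finset.mul_sum, ← mul_add, h5, mul_zero]
  have hlim : Tendsto (fun ω => tau m ω₀ ω ^ n * (S.centralSol σ ω ⬝ᵥ star x) +
      ∑ ν, tau m ω₀ ω ^ n * q ν ω) (diskNhds ω₀) (𝓝 (x ⬝ᵥ star x + ∑ ν, (r ν : ℂ))) := by
    refine Tendsto.add ?_ (tendsto_finsetSum _ fun ν _ => hq ν)
    simp only [dotProduct, Finset.mul_sum]
    refine tendsto_finsetSum _ fun α _ => ?_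
    exact ((h.central α).mul_const _).congr fun ω => by ring
  have hzero : x ⬝ᵥ star x + ∑ ν, (r ν : ℂ) = 0 :=
    tendsto_nhds_unique (hlim.congr' horth) tendsto_const_nhds
  rw [dotProduct_star_eq, ← Complex.ofReal_sum, ← Complex.ofReal_add, Complex.ofReal_eq_zero] at hzero
  have p1 : 0 ≤ ∑ i, ‖x i‖ ^ 2 := Finset.sum_nonneg fun i _ => by positivity
  have p2 : 0 ≤ ∑ ν, r ν := Finset.sum_nonneg fun ν _ => hr ν
  refine ⟨funext fun ν => hr0 ν ?_, eq_zero_of_dotProduct_star ?_⟩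
  · exact (Finset.sum_eq_zero_iff_of_nonneg fun ν _ => hr ν).1 (by linarith) ν (Finset.mem_univ ν)
  · rw [dotProduct_star_eq, Complex.ofReal_eq_zero]; linarith

end IsLeading

/-- On the arc `T_σ⁺` the special solution `ψ^σ` has no poles. -/
theorem Admissible.special_analytic (h : S.Admissible m ω₀) {σ : C} (hσ : ω₀ ∈ S.TPlus σ) :
    (∀ γ, IsAnalyticIn (diskNhds ω₀) (tau m ω₀) (S.scat γ σ)) ∧
      ∀ α, IsAnalyticIn (diskNhds ω₀) (tau m ω₀) fun ω => S.centralSol σ ω α := by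
  have hω₀ := hσ.1
  have hτ := h.tendsto_tau hω₀
  have hscat : ∀ γ, IsMeroIn (diskNhds ω₀) (tau m ω₀) (S.scat γ σ) := by
    intro γ
    unfold scat
    refine (h.XMat_mero hω₀ γ σ).sub ?_
    by_cases hγ : γ = σ
    · simp only [if_pos hγ]
      exact (h.jostE_inv_analytic hσ 1).isMeroIn.div (h.jost_analytic hω₀ σ 1).isMeroIn
    · simp only [if_neg hγ]
      exact IsMeroIn.const 0
  have hcen : ∀ α, IsMeroIn (diskNhds ω₀) (tau m ω₀) fun ω => S.centralSol σ ω α := by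
    intro α
    unfold centralSol
    simp only [mulVec_source_apply, U_one_apply]
    exact IsMeroIn.sum fun ν _ => ((h.resolvent_mero hω₀ _ _).mul (IsMeroIn.const _)).mul
      ((h.jost_analytic hω₀ ν 1).isMeroIn.mul (h.XMat_mero hω₀ ν σ))
  -- Outgoing amplitudes and central values are treated as one family, so that a single pole order
  -- `n` serves all of them and some leading coefficient is nonzero.
  set f : C ⊕ S.Central → ℂ → ℂ :=
    Sum.elim (fun γ => S.scat γ σ) (fun α ω => S.centralSol σ ω α) with hf
  have hfm : ∀ i, IsMeroIn (diskNhds ω₀) (tau m ω₀) (f i) := by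
    rintro (γ | α)
    · exact hscat γ
    · exact hcen α
  rcases IsMeroIn.analytic_or_leading hτ hfm with h1 | ⟨n, L, hn, hL, hlim⟩
  · exact ⟨fun γ => h1 (Sum.inl γ), fun α => h1 (Sum.inr α)⟩
  · have hlead : S.IsLeading m ω₀ σ n (fun γ => L (Sum.inl γ)) fun α => L (Sum.inr α) :=
      ⟨h, hσ, hn, fun γ => hlim (Sum.inl γ), fun α => hlim (Sum.inr α)⟩
    obtain ⟨e1, e2⟩ := hlead.eq_zero
    refine absurd (funext fun i => ?_) hL
    rcases i with γ | α
    · exact congrFun e1 γ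
    · exact congrFun e2 α

end WebSystem
end

/-! ### Residues, boundary continuity and the symmetry of U -/

noncomputable section

open Matrix

lemma tendsto_matrix_diagonal {n ι : Type*} [DecidableEq n] {l : Filter ι} {d : n → ι → ℂ}
    {d₀ : n → ℂ} (h : ∀ i, Tendsto (d i) l (𝓝 (d₀ i))) :
    Tendsto (fun ω => diagonal fun i => d i ω) l (𝓝 (diagonal d₀)) := by
  have hc : Continuous fun v : n → ℂ => diagonal v := continuous_id.matrix_diagonal
  exact (hc.tendsto d₀).comp (tendsto_pi_nhds.2 h)

lemma tendsto_matrix_inv {n ι : Type*} [Fintype n] [DecidableEq n] {l : Filter ι}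
    {M : ι → Matrix n n ℂ} {M₀ : Matrix n n ℂ} (h : Tendsto M l (𝓝 M₀)) (h0 : IsUnit M₀.det) :
    Tendsto (fun ω => (M ω)⁻¹) l (𝓝 M₀⁻¹) := by
  simp only [Matrix.inv_def, Ring.inverse_eq_inv']
  have h1 : Tendsto (fun ω => (M ω).det) l (𝓝 M₀.det) :=
    ((continuous_id.matrix_det).tendsto M₀).comp h
  have h2 : Tendsto (fun ω => (M ω).adjugate) l (𝓝 M₀.adjugate) :=
    ((continuous_id.matrix_adjugate).tendsto M₀).comp h
  exact (h1.inv₀ h0.ne_zero).smul h2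

lemma AnalyticAt.eventually_circleIntegral_eq_zero {F : ℂ → ℂ} {z : ℂ} (hF : AnalyticAt ℂ F z) :
    ∀ᶠ ρ : ℝ in 𝓝[>] 0, (∮ ω in C(z, ρ), F ω) = 0 := by
  obtain ⟨r, hr, hball⟩ := Metric.eventually_nhds_iff_ball.1 hF.eventually_analyticAt
  filter_upwards [Ioo_mem_nhdsGT hr] with ρ hρ
  refine DiffContOnCl.circleIntegral_eq_zero hρ.1.le (DifferentiableOn.diffContOnCl ?_)
  rw [closure_ball _ hρ.1.ne']
  intro w hw
  have hw' : w ∈ ball z r := closedBall_subset_ball hρ.2 hw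
  exact (hball w hw').differentiableAt.differentiableWithinAt

namespace WebSystem

variable {A C : Type*} {S : WebSystem A C} {m : ℕ} {ω₀ : ℂ}

/-- For `m = 1` the parameter is the affine function `1 - ω / ω₀`, so analyticity in it is a genuine
analytic continuation across the circle. -/
lemma hasResidue_zero (hω₀ : ‖ω₀‖ = 1) {f : ℂ → ℂ}
    (hf : IsAnalyticIn (diskNhds ω₀) (tau 1 ω₀) f) : HasResidue f ω₀ 0 := by
  obtain ⟨F, hF, e⟩ := hf
  have h0 := ne_zero_of_norm_one hω₀
  have hG : AnalyticAt ℂ (fun ω => F (1 - ω / ω₀)) ω₀ := by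
    have h1 : AnalyticAt ℂ (fun ω => 1 - ω / ω₀) ω₀ := by fun_prop (disch := assumption)
    have h2 : AnalyticAt ℂ F (1 - ω₀ / ω₀) := by rwa [div_self h0, sub_self]
    exact AnalyticAt.comp (g := F) (f := fun ω => 1 - ω / ω₀) h2 h1
  refine ⟨_, hG.meromorphicAt, ?_, ?_⟩
  · filter_upwards [e] with ω hω
    rw [hω]; simp [tau]
  · filter_upwards [hG.eventually_circleIntegral_eq_zero] with ρ hρ
    rw [hρ, mul_zero]

lemma tendsto_sub_mul_zero (h : S.Admissible m ω₀) (hω₀ : ‖ω₀‖ = 1) {f : ℂ → ℂ}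
    (hf : IsAnalyticIn (diskNhds ω₀) (tau m ω₀) f) :
    Tendsto (fun ω => (ω - ω₀) * f ω) (diskNhds ω₀) (𝓝 0) := by
  obtain ⟨c, hc⟩ := hf.exists_tendsto (h.tendsto_tau hω₀)
  have h1 : Tendsto (fun ω : ℂ => ω - ω₀) (diskNhds ω₀) (𝓝 0) := by
    have : ContinuousAt (fun ω : ℂ => ω - ω₀) ω₀ := by fun_prop
    have h2 := this.tendsto
    rw [sub_self] at h2
    exact h2.mono_left nhdsWithin_le_nhds
  simpa using h1.mul hc

lemma theta_sq_eq_one_iff (σ : C) (hω₀ : ‖ω₀‖ = 1) :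
    S.theta σ ω₀ ^ 2 = 1 ↔ S.joukowski σ ω₀ ^ 2 = 4 := by
  obtain ⟨h0, _, hz, _⟩ := S.theta_spec σ hω₀
  rw [zhukovskii_eq_lam_iff] at hz
  rw [← hz]
  have e : (S.theta σ ω₀ + (S.theta σ ω₀)⁻¹) ^ 2 - 4 =
      (S.theta σ ω₀ ^ 2 - 1) ^ 2 / S.theta σ ω₀ ^ 2 := by field_simp; ring
  rw [← sub_eq_zero, ← sub_eq_zero (a := (S.theta σ ω₀ + (S.theta σ ω₀)⁻¹) ^ 2), e]
  simp [h0]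

/-- Only the inner edges require a square root; the edges at `±1` are already resolved by `ω`
itself. -/
lemma admissible_one_of_not_isInnerEdge (hω₀ : ‖ω₀‖ = 1) (h : ¬ S.IsInnerEdge ω₀) :
    S.Admissible 1 ω₀ := by
  by_cases h1 : ω₀ ^ 2 = 1
  · exact Or.inr (Or.inl ⟨rfl, h1⟩)
  · refine Or.inl ⟨rfl, fun σ hσ => h ⟨?_, ?_, σ, ?_⟩⟩
    · rintro rfl; simp at h1
    · rintro rfl; simp at h1
    · exact sq_eq_one_iff.1 ((theta_sq_eq_one_iff σ hω₀).2 hσ)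

lemma residueVanishes_of_analytic (hω₀ : ‖ω₀‖ = 1) {f : ℂ → ℂ}
    (hf : ∀ m, S.Admissible m ω₀ → IsAnalyticIn (diskNhds ω₀) (tau m ω₀) f) :
    S.ResidueVanishes f ω₀ := by
  obtain ⟨m, hm⟩ := S.exists_admissible ω₀
  exact ⟨tendsto_sub_mul_zero hm hω₀ (hf m hm), fun h =>
    hasResidue_zero hω₀ (hf 1 (admissible_one_of_not_isInnerEdge hω₀ h))⟩

/-- A function of boundary limits is continuous: closed neighbourhoods of `ψ ω₀` form a basis, and
the limit at a nearby `ω` of values in such a set lies in it. -/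
lemma continuousOn_of_tendsto_diskNhds {f ψ : ℂ → ℂ} {T : Set ℂ}
    (hne : ∀ ω ∈ T, (diskNhds ω).NeBot) (h : ∀ ω ∈ T, Tendsto f (diskNhds ω) (𝓝 (ψ ω))) :
    ContinuousOn ψ T := by
  intro ω₀ hω₀
  refine (closed_nhds_basis (ψ ω₀)).tendsto_right_iff.2 fun V hV => ?_
  have h1 := (h ω₀ hω₀).eventually hV.1
  obtain ⟨U, hUV, hU, hU0⟩ := _root_.eventually_nhds_iff.1 (eventually_nhdsWithin_iff.1 h1)
  filter_upwards [nhdsWithin_le_nhds (hU.mem_nhds hU0), self_mem_nhdsWithin] with ω hω hωT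
  by_cases he : ω = ω₀
  · rw [he]; exact mem_of_mem_nhds hV.1
  · have := hne ω hωT
    refine hV.2.mem_of_tendsto (h ω hωT) ?_
    filter_upwards [self_mem_nhdsWithin, nhdsWithin_le_nhds (hU.mem_nhds hω),
      nhdsWithin_le_nhds (isOpen_ne.mem_nhds he)] with z hz1 hz2 hz3
    exact hUV z hz2 ⟨hz1.1, hz3⟩

lemma tendsto_jost (hω₀ : ‖ω₀‖ = 1) (σ : C) (k : ℕ) :
    Tendsto (fun ω => S.jost σ k (S.theta σ ω)) (diskNhds ω₀) (𝓝 (S.jost σ k (S.theta σ ω₀))) := by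
  rw [(S.thetaGood_of_norm_one σ hω₀).jost_eq]
  refine Tendsto.congr' ?_ (((S.tail σ).analyticAt_jostE (S.norm_sq_lt_rho σ (S.theta_spec σ hω₀).2.1)
    k).continuousAt.tendsto.comp (tendsto_theta S hω₀ σ))
  filter_upwards [S.eventually_thetaGood hω₀ σ] with ω hω using (hω.jost_eq k).symm

lemma tendsto_pSol (hω₀ : ‖ω₀‖ = 1) (σ : C) (k : ℕ) :
    Tendsto (fun ω => S.pSol σ ω k) (diskNhds ω₀) (𝓝 (S.pSol σ ω₀ k)) := by
  have key : ∀ k, Tendsto (fun ω => S.pSol σ ω k) (diskNhds ω₀) (𝓝 (S.pSol σ ω₀ k)) ∧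
      Tendsto (fun ω => S.pSol σ ω (k + 1)) (diskNhds ω₀) (𝓝 (S.pSol σ ω₀ (k + 1))) := by
    intro k
    induction k with
    | zero => exact ⟨tendsto_const_nhds, tendsto_const_nhds⟩
    | succ k ih =>
      refine ⟨ih.2, ?_⟩
      simp only [pSol]
      exact (((tendsto_const_nhds.sub (tendsto_lam S hω₀)).mul ih.2).sub (ih.1.const_mul _)).div_const _
  exact (key k).1

lemma tendsto_resolvent (hω₀ : ‖ω₀‖ = 1) (h : IsUnit (S.centralMatrix (S.lam ω₀)).det) :
    Tendsto (fun ω => S.resolvent (S.lam ω)) (diskNhds ω₀) (𝓝 (S.resolvent (S.lam ω₀))) := by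
  refine tendsto_matrix_inv ?_ h
  exact tendsto_const_nhds.sub ((tendsto_lam S hω₀).smul_const _)

variable [Fintype C] [DecidableEq C]

lemma tendsto_U_of_isRegular (hω₀ : ‖ω₀‖ = 1) (h : S.IsRegular ω₀) (k : ℕ) :
    Tendsto (S.U k) (diskNhds ω₀) (𝓝 (S.U k ω₀)) := by
  have hE : ∀ k, Tendsto (S.EMat k) (diskNhds ω₀) (𝓝 (S.EMat k ω₀)) := fun k =>
    tendsto_matrix_diagonal fun σ => tendsto_jost hω₀ σ k
  have hP : Tendsto (S.PMat k) (diskNhds ω₀) (𝓝 (S.PMat k ω₀)) :=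
    tendsto_matrix_diagonal fun σ => tendsto_pSol hω₀ σ k
  have hD : Tendsto S.DMat (diskNhds ω₀) (𝓝 (S.DMat ω₀)) :=
    tendsto_matrix_diagonal fun σ =>
      ((tendsto_theta S hω₀ σ).inv₀ (S.theta_spec σ hω₀).1).sub (tendsto_theta S hω₀ σ)
  have hR : Tendsto (fun ω => S.RMat (S.lam ω)) (diskNhds ω₀) (𝓝 (S.RMat (S.lam ω₀))) :=
    tendsto_pi_nhds.2 fun σ => tendsto_pi_nhds.2 fun ν =>
      tendsto_pi_nhds.1 (tendsto_pi_nhds.1 (tendsto_resolvent hω₀ h.1) (S.attach σ)) (S.attach ν)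
  have hT : Tendsto S.TMat (diskNhds ω₀) (𝓝 (S.TMat ω₀)) :=
    (hE 0).sub ((hR.mul_const _).mul (hE 1))
  have hTi := tendsto_matrix_inv hT h.2.1
  have hEi := tendsto_matrix_inv (hE 1) h.2.2
  exact (((((hP.neg.add ((hE k).mul hTi)).mul_const _).mul_const _).mul hD).mul hEi)

lemma special_eq (S : WebSystem A C) (σ : C) (α : A) :
    (∃ k γ, S.special σ α = fun ω => S.U k ω γ σ) ∨
      (∃ β : S.Central, S.special σ α = fun ω => S.centralSol σ ω β) ∨
        S.special σ α = fun _ => 0 := by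
  by_cases h : ∃ q : C × ℕ, S.chan q.1 q.2 = α
  · refine Or.inl ⟨h.choose.2, h.choose.1, funext fun ω => ?_⟩
    rw [special, dif_pos h]
  · by_cases h' : ∀ γ k, α ≠ S.chan γ (k + 1)
    · refine Or.inr (Or.inl ⟨⟨α, h'⟩, funext fun ω => ?_⟩)
      rw [special, dif_neg h, dif_pos h', centralSol, mulVec_source_apply]
    -- This case is void: a particle outside the central part lies on a channel. The default value 0
    -- is harmless.
    · refine Or.inr (Or.inr (funext fun ω => ?_))
      rw [special, dif_neg h, dif_neg h']

lemma tendsto_special_of_isRegular (hω₀ : ‖ω₀‖ = 1) (h : S.IsRegular ω₀) (σ : C) (α : A) :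
    Tendsto (S.special σ α) (diskNhds ω₀) (𝓝 (S.special σ α ω₀)) := by
  have hU : ∀ k γ, Tendsto (fun ω => S.U k ω γ σ) (diskNhds ω₀) (𝓝 (S.U k ω₀ γ σ)) := fun k γ =>
    tendsto_pi_nhds.1 (tendsto_pi_nhds.1 (tendsto_U_of_isRegular hω₀ h k) γ) σ
  rcases S.special_eq σ α with ⟨k, γ, e⟩ | ⟨β, e⟩ | e
  · rw [e]; exact hU k γ
  · rw [e]
    simp only [centralSol, mulVec_source_apply]
    refine tendsto_finsetSum _ fun ν _ => Tendsto.mul (Tendsto.mul_const _ ?_) (hU 1 ν)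
    exact tendsto_pi_nhds.1 (tendsto_pi_nhds.1 (tendsto_resolvent hω₀ h.1) β) (S.attach ν)
  · rw [e]; exact tendsto_const_nhds

lemma Admissible.U_analytic (h : S.Admissible m ω₀) {σ : C} (hσ : ω₀ ∈ S.TPlus σ) (k : ℕ) (γ : C) :
    IsAnalyticIn (diskNhds ω₀) (tau m ω₀) fun ω => S.U k ω γ σ := by
  have hω₀ := hσ.1
  have hinc : IsAnalyticIn (diskNhds ω₀) (tau m ω₀) (S.incoming γ σ k) := by
    unfold incoming
    by_cases hγ : γ = σ
    · simp only [if_pos hγ]; exact h.jostE_inv_analytic hσ k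
    · simp only [if_neg hγ]; exact IsAnalyticIn.const 0
  refine (hinc.add (((h.special_analytic hσ).1 γ).mul (h.jost_analytic hω₀ γ k))).congr ?_
  filter_upwards [S.eventually_isRegular hω₀, S.eventually_forall_thetaGood hω₀,
    eventually_inv_rho hσ] with ω h1 h2 h3
  rw [U_apply h1 h2 h3, (h2 γ).jost_eq]

lemma exists_tendsto_special {σ : C} (hσ : ω₀ ∈ S.TPlus σ) (α : A) :
    ∃ c, Tendsto (S.special σ α) (diskNhds ω₀) (𝓝 c) := by
  obtain ⟨m, hm⟩ := S.exists_admissible ω₀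
  have hτ := hm.tendsto_tau hσ.1
  rcases S.special_eq σ α with ⟨k, γ, e⟩ | ⟨β, e⟩ | e
  · rw [e]; exact (hm.U_analytic hσ k γ).exists_tendsto hτ
  · rw [e]; exact ((hm.special_analytic hσ).2 β).exists_tendsto hτ
  · rw [e]; exact ⟨0, tendsto_const_nhds⟩

/-- The symmetry of the matrix `T⁻¹ B(0)⁻¹ ℰ(1)⁻¹`. -/
lemma TMat_inv_symm (ω : ℂ) :
    ((S.TMat ω)⁻¹ * (S.BZero)⁻¹ * (S.EMat 1 ω)⁻¹)ᵀ =
      (S.TMat ω)⁻¹ * (S.BZero)⁻¹ * (S.EMat 1 ω)⁻¹ := by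
  have hR : (S.RMat (S.lam ω))ᵀ = S.RMat (S.lam ω) := by
    ext σ ν
    have := congrFun (congrFun (S.resolvent_transpose (S.lam ω)) (S.attach σ)) (S.attach ν)
    simpa [RMat] using this
  have hB : (S.BZero)ᵀ = S.BZero := diagonal_transpose _
  have hE : ∀ k, (S.EMat k ω)ᵀ = S.EMat k ω := fun k => diagonal_transpose _
  -- The inverse matrix is `ℰ(1) B(0) ℰ(0) - ℰ(1) B(0) ℛ B(0) ℰ(1)`: its first term is a product of
  -- commuting diagonal matrices, and the second is symmetric together with `ℛ`.
  have hc : S.EMat 1 ω * S.BZero * S.EMat 0 ω = S.EMat 0 ω * S.BZero * S.EMat 1 ω := by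
    simp only [EMat, BZero, diagonal_mul_diagonal]
    congr 1; ext σ; ring
  have e : (S.TMat ω)⁻¹ * (S.BZero)⁻¹ * (S.EMat 1 ω)⁻¹ =
      (S.EMat 1 ω * S.BZero * S.TMat ω)⁻¹ := by
    rw [Matrix.mul_inv_rev, Matrix.mul_inv_rev, ← Matrix.mul_assoc]
  rw [e, transpose_nonsing_inv]
  congr 1
  simp only [TMat, Matrix.mul_sub, transpose_sub, transpose_mul, hR, hB, hE]
  rw [← Matrix.mul_assoc, ← hc]
  simp only [Matrix.mul_assoc]

lemma XMat_symm {ω : ℂ} (h : S.IsRegular ω) (σ ν : C) :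
    S.XMat ω ν σ * (S.bLim ν * ((S.theta ν ω)⁻¹ - S.theta ν ω)) =
      S.XMat ω σ ν * (S.bLim σ * ((S.theta σ ω)⁻¹ - S.theta σ ω)) := by
  set K := (S.TMat ω)⁻¹ * (S.BZero)⁻¹ * (S.EMat 1 ω)⁻¹ with hK
  have hKs : ∀ σ ν, K σ ν = K ν σ := fun σ ν => congrFun (congrFun (TMat_inv_symm ω) ν) σ
  have hX : ∀ σ ν, S.XMat ω σ ν = K σ ν * (S.bLim ν * ((S.theta ν ω)⁻¹ - S.theta ν ω)) := by
    intro σ ν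
    have e1 : S.XMat ω = (S.TMat ω)⁻¹ * (S.BMat * (S.BZero)⁻¹ * S.DMat ω * (S.EMat 1 ω)⁻¹) := by
      simp only [XMat, Matrix.mul_assoc]
    rw [e1, h.inv_eq, mul_diagonal, hK, EMat,
      inv_diagonal_of_ne_zero (S.isUnit_EMat_det_iff.1 h.2.2), BZero,
      inv_diagonal_of_ne_zero (v := fun σ => (S.offCoeff σ 0 : ℂ)) fun σ =>
        (S.tail σ).off_ne_zero 0, mul_diagonal, mul_diagonal]
    ring
  rw [hX, hX, hKs]; ring

/-- Off the endpoints of the spectrum the residues of the transposed entry vanish, too. -/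
theorem residueVanishes_transpose {σ ν : C} (hν : ω₀ ∈ S.TPlus ν) (hne : σ ≠ ν) (k : ℕ)
    (h1 : ω₀ ≠ 1) (h2 : ω₀ ≠ -1) : S.ResidueVanishes (fun ω => S.U k ω ν σ) ω₀ := by
  have hω₀ := hν.1
  have hsq : ω₀ ^ 2 ≠ 1 := fun h => (sq_eq_one_iff.1 h).elim h1 h2
  set h : C → ℂ → ℂ := fun γ ω => (S.theta γ ω)⁻¹ - S.theta γ ω with hh
  have hU : ∀ᶠ ω in diskNhds ω₀, S.U k ω ν σ * (S.bLim ν * h ν ω) =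
      S.jost ν k (S.theta ν ω) * S.scat σ ν ω * (S.bLim σ * h σ ω) := by
    filter_upwards [S.eventually_isRegular hω₀] with ω hω
    rw [U_eq_XMat, hω.inv_eq, PMat, diagonal_mul_diagonal, Matrix.sub_apply,
      diagonal_apply_ne _ hne.symm, sub_zero, EMat, diagonal_mul, mul_assoc, XMat_symm hω, scat,
      if_neg hne, sub_zero, mul_assoc]
  have hbν := S.bLim_ne_zero ν
  have hnum : ∀ m, S.Admissible m ω₀ → IsAnalyticIn (diskNhds ω₀) (tau m ω₀) fun ω =>
      S.jost ν k (S.theta ν ω) * S.scat σ ν ω * (S.bLim σ * h σ ω) / S.bLim ν := by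
    intro m hm
    simp only [div_eq_mul_inv]
    exact (((hm.jost_analytic hω₀ ν k).mul ((hm.special_analytic hν).1 σ)).mul
      ((IsAnalyticIn.const _).mul ((hm.theta_inv_analytic hω₀ σ).sub
        (hm.theta_analytic hω₀ σ)))).mul (IsAnalyticIn.const _)
  refine ⟨?_, fun hedge => ?_⟩
  -- With `m = 2`, `‖ω - ω₀‖ = ‖τ‖ ^ 2`, while the division by `θ_ν⁻¹ - θ_ν` costs at most one
  -- factor `‖τ‖`. One factor is left, so the product tends to zero.
  · have hm : S.Admissible 2 ω₀ := Or.inr (Or.inr ⟨rfl, hsq⟩)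
    have hτ := hm.tendsto_tau hω₀
    obtain ⟨c, hc⟩ := (hnum 2 hm).exists_tendsto hτ
    obtain ⟨κ, hκ, hev⟩ := hm.theta_inv_sub hω₀ ν
    have hτ0 : Tendsto (fun ω => ‖tau 2 ω₀ ω‖) (diskNhds ω₀) (𝓝 0) := by
      simpa using (hτ.mono_right nhdsWithin_le_nhds).norm
    have hlim := (hτ0.mul_const κ⁻¹).mul hc.norm
    rw [zero_mul, zero_mul] at hlim
    refine squeeze_zero_norm' ?_ hlim
    have hne0 : ∀ᶠ ω in diskNhds ω₀, tau 2 ω₀ ω ≠ 0 := hτ.eventually self_mem_nhdsWithin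
    filter_upwards [hU, hev, hne0] with ω e1 e2 e3
    have hp : 0 < ‖tau 2 ω₀ ω‖ := norm_pos_iff.2 e3
    have hpos : 0 < ‖h ν ω‖ := lt_of_lt_of_le (by positivity) e2
    have hh0 : h ν ω ≠ 0 := norm_pos_iff.1 hpos
    have e4 : S.U k ω ν σ = (S.jost ν k (S.theta ν ω) * S.scat σ ν ω * (S.bLim σ * h σ ω) /
        S.bLim ν) / h ν ω := by
      rw [eq_div_iff hh0, eq_div_iff hbν, ← e1]; ring
    have e5 : ‖ω - ω₀‖ = ‖tau 2 ω₀ ω‖ ^ 2 := by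
      have e6 := mul_one_sub_tau_pow two_ne_zero (ne_zero_of_norm_one hω₀) ω
      have e7 : ω - ω₀ = -ω₀ * tau 2 ω₀ ω ^ 2 := by linear_combination (-1 : ℂ) * e6
      rw [e7, norm_mul, norm_neg, hω₀, one_mul, norm_pow]
    rw [e4, norm_mul, norm_div _ (h ν ω), e5, ← mul_div_assoc, div_le_iff₀ hpos]
    set w := ‖S.jost ν k (S.theta ν ω) * S.scat σ ν ω * (S.bLim σ * h σ ω) / S.bLim ν‖ with hw
    have hw0 : 0 ≤ w := norm_nonneg _
    calc ‖tau 2 ω₀ ω‖ ^ 2 * w = ‖tau 2 ω₀ ω‖ * κ⁻¹ * w * (κ * ‖tau 2 ω₀ ω‖) := by field_simp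
      _ ≤ _ := by gcongr
  · have hm := admissible_one_of_not_isInnerEdge hω₀ hedge
    -- Off the inner edges and `±1` the divisor `θ_ν⁻¹ - θ_ν` does not vanish at `ω₀`, so the
    -- quotient is analytic in `ω`.
    have hne0 : S.theta ν ω₀ ^ 2 ≠ 1 := fun h3 =>
      hedge ⟨h1, h2, ν, sq_eq_one_iff.1 h3⟩
    have hθ0 := (S.theta_spec ν hω₀).1
    have hh0 : h ν ω₀ ≠ 0 := by
      intro h3
      apply hne0
      simp only [hh] at h3
      field_simp at h3
      linear_combination (-1 : ℂ) * h3
    have := diskNhds_neBot hω₀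
    have hth : Tendsto (h ν) (diskNhds ω₀) (𝓝 (h ν ω₀)) :=
      ((tendsto_theta S hω₀ ν).inv₀ hθ0).sub (tendsto_theta S hω₀ ν)
    have hinv : IsAnalyticIn (diskNhds ω₀) (tau 1 ω₀) fun ω => (h ν ω)⁻¹ :=
      ((hm.theta_inv_analytic hω₀ ν).sub (hm.theta_analytic hω₀ ν)).comp (hm.tendsto_tau hω₀) hth
        (analyticAt_inv hh0)
    refine hasResidue_zero hω₀ (((hnum 1 hm).mul hinv).congr ?_)
    filter_upwards [hU, hth.eventually_ne hh0] with ω e1 e2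
    rw [← div_eq_mul_inv, eq_div_iff e2, eq_div_iff hbν, ← e1]; ring

end WebSystem
end

theorem mainTheorem5 {A C : Type*} [Fintype C] [DecidableEq C] (S : WebSystem A C) :
    (∀ (σ ν : C) (k : ℕ) (ω₀ : ℂ), ω₀ ∈ S.TPlus σ ∪ S.TPlus ν → ω₀ ≠ 1 → ω₀ ≠ -1 →
      S.ResidueVanishes (fun ω => S.U k ω σ ν) ω₀ ∧
      S.ResidueVanishes (fun ω => S.U k ω ν σ) ω₀) ∧
    (∀ (σ ν : C) (k : ℕ) (ω₀ : ℂ), ω₀ ∈ S.TPlus ν →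
      S.ResidueVanishes (fun ω => S.U k ω σ ν) ω₀) ∧
    (∀ (σ : C) (α : A), ∃ ψ : ℂ → ℂ, ContinuousOn ψ (S.TPlus σ) ∧
      (∀ ω ∈ S.TPlus σ, S.IsRegular ω → ψ ω = S.special σ α ω) ∧
      ∀ ω₀ ∈ S.TPlus σ,
        Tendsto (S.special σ α) (𝓝[closedBall (0 : ℂ) 1 \ {ω₀}] ω₀) (𝓝 (ψ ω₀))) := by
  have hcol : ∀ (σ ν : C) (k : ℕ) (ω₀ : ℂ), ω₀ ∈ S.TPlus ν →
      S.ResidueVanishes (fun ω => S.U k ω σ ν) ω₀ := fun σ ν k ω₀ hν =>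
    WebSystem.residueVanishes_of_analytic hν.1 fun m hm => hm.U_analytic hν k σ
  have hrow : ∀ (σ ν : C) (k : ℕ) (ω₀ : ℂ), ω₀ ∈ S.TPlus ν → ω₀ ≠ 1 → ω₀ ≠ -1 →
      S.ResidueVanishes (fun ω => S.U k ω ν σ) ω₀ := fun σ ν k ω₀ hν h1 h2 => by
    -- The symmetry argument concerns off-diagonal entries, where `P` does not contribute; a
    -- diagonal entry is covered by its column.
    by_cases hne : σ = ν
    · subst hne; exact hcol σ σ k ω₀ hν
    · exact WebSystem.residueVanishes_transpose hν hne k h1 h2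
  refine ⟨fun σ ν k ω₀ hω h1 h2 => ?_, hcol, fun σ α => ?_⟩
  · rcases hω with hω | hω
    · exact ⟨hrow ν σ k ω₀ hω h1 h2, hcol ν σ k ω₀ hω⟩
    · exact ⟨hcol σ ν k ω₀ hω, hrow σ ν k ω₀ hω h1 h2⟩
  · have hlim : ∀ ω₀ ∈ S.TPlus σ, Tendsto (S.special σ α) (WebSystem.diskNhds ω₀)
        (𝓝 (limUnder (WebSystem.diskNhds ω₀) (S.special σ α))) := fun ω₀ hω₀ =>
      tendsto_nhds_limUnder (WebSystem.exists_tendsto_special hω₀ α)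
    -- The boundary limit is taken as the value everywhere on the arc, also where `special` is
    -- evaluated with singular inverses; at regular points it agrees with `special`, which is
    -- continuous there.
    refine ⟨fun ω₀ => limUnder (WebSystem.diskNhds ω₀) (S.special σ α), ?_, ?_, hlim⟩
    · exact WebSystem.continuousOn_of_tendsto_diskNhds
        (fun ω hω => WebSystem.diskNhds_neBot hω.1) hlim
    · intro ω hω hreg
      have := WebSystem.diskNhds_neBot hω.1
      exact tendsto_nhds_unique (hlim ω hω) (WebSystem.tendsto_special_of_isRegular hω.1 hreg σ α)
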